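/- **Almost critical points.** Fix $\beta\in\mathbb R$, $G>0$ and $\tau=e^{2i\pi/3}=\tau_R+i\tau_I$. For $\varepsilon>0$ and $s\in\mathbb R$ let $\mathfrak F_\varepsilon^s$ be the space of entire functions $f$ with $\|f\|_{\mathfrak F^s_\varepsilon}^2:=\int_{\mathbb C}(1+|z|^2)^s|f|^2e^{-|z|^2/\varepsilon}\,dz<\infty$, let $\mathfrak F_\varepsilon=\mathfrak F_\varepsilon^0$, and let $$\Pi_\varepsilon(g)(z)=\frac1{\pi\varepsilon}\int_{\mathbb C}e^{z\bar z'/\varepsilon}e^{-|z'|^2/\varepsilon}g(z')\,dz'.$$ For $f\in\mathfrak F_\varepsilon^2$ put $$\mathcal F^{\rm LLL}[f]=\int_{\mathbb C}\Big(\big(-\beta|z|^2+\tfrac14|z|^4\big)|f|^2e^{-|z|^2/\varepsilon}+\tfrac G2|f|^4e^{-2|z|^2/\varepsilon}\Big)dz,$$ with $\mathcal F^{\rm LLL}[f]=+\infty$ if $f\notin\mathfrak F^2_\varepsilon$, and let $F^{\rm LLL}=\inf\{\mathcal F^{\rm LLL}[f]: f\in\mathfrak F^1_\varepsilon,\ \|f\|_{\mathfrak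 F_\varepsilon}=1\}$. Let $$f_\tau(z)=e^{z^2/2\varepsilon}\,\Theta\Big(\sqrt{\tfrac{\tau_I}{\pi\varepsilon}}\,z,\tau\Big),\quad \Theta(v,\tau)=\frac1i\sum_{n\in\mathbb Z}(-1)^ne^{i\pi\tau(n+1/2)^2}e^{(2n+1)\pi iv},\quad u_\tau(z)=e^{-|z|^2/2\varepsilon}f_\tau(z),$$ so that $|u_\tau|$ is periodic over the lattice $\sqrt{\pi\varepsilon/\tau_I}\,(\mathbb Z\oplus\mathbb Z\tau)$, and let $b$ be the average of $|u_\tau|^4$ over a period cell divided by the square of the average of $|u_\tau|^2$ (a number that does not depend on $\varepsilon$). Let $$\rho^{\rm TF}_b=\max\Big(\frac{\mu^{\rm TF}_b+\beta|z|^2-\frac14|z|^4}{bG},0\Big),$$ where $\mu^{\rm TF}_b\in\mathbb R$ is the number fixed by $\int_{\mathbb C}\rho^{\rm TF}_b=1$, and let $E^{\rm TF}_b$ be the infimum of $\int_{\mathbb C}\big((-\beta|z|^2+\frac14|z|^4)\rho+\frac{bG}2\rho^2\big)dz$ over all $\rho\ge0$ with $\int|z|^2\rho<\infty$ and $\int\rho=1$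 (this integral being $+\infty$ when it does not converge). Let $\alpha:\mathbb C\to\mathbb C$ be Hölder continuous with exponent $1/2$, independent of $\varepsilon$, with $|\alpha|^2=\rho^{\rm TF}_b$. There are constants $C>0$ and $\varepsilon_0>0$ such that for every $0<\varepsilon\le\varepsilon_0$ the function $\Pi_\varepsilon(\alpha f_\tau)$ is a nonzero element of $\mathfrak F_\varepsilon$, its normalization $f_{\alpha,\tau}=\Pi_\varepsilon(\alpha f_\tau)/\|\Pi_\varepsilon(\alpha f_\tau)\|_{\mathfrak F_\varepsilon}$ belongs to $\mathfrak F_\varepsilon^2$, and: 1. for some $R_\varepsilon\in\mathfrak F_\varepsilon$ with $\|R_\varepsilon\|_{\mathfrak F_\varepsilon}\le C\varepsilon^{1/4}$, $$\big(-\beta+\tfrac14\varepsilon\big)\Pi_\varepsilon(|z|^2f_{\alpha,\tau})+\tfrac14\Pi_\varepsilon\big(|z|^2\Pi_\varepsilon(|z|^2f_{\alpha,\tau})\big)+G\,\Pi_\varepsilon\big(e^{-|z|^2/\varepsilon}|f_{\alpha,\tau}|^2f_{\alpha,\tau}\big)=\mu^{\rm TF}_b f_{\alpha,\tau}+R_\varepsilon;$$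 2. $\displaystyle\Big|\mathcal F^{\rm LLL}[f_{\alpha,\tau}]-\int_{\mathbb C}\Big(\big(-\beta|z|^2+\tfrac14|z|^4\big)|\alpha|^2+\tfrac{bG}2|\alpha|^4\Big)dz\Big|\le C\varepsilon^{1/4}$; 3. $F^{\rm LLL}\le\mathcal F^{\rm LLL}[f_{\alpha,\tau}]$ and $\big|\mathcal F^{\rm LLL}[f_{\alpha,\tau}]-E^{\rm TF}_b\big|\le C\varepsilon^{1/4}$. -/

import Mathlib

open MeasureTheory
open scoped NNReal ComplexConjugate

noncomputable section

namespace LLL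

/-! ### Fock-Bargmann spaces and the Szego projector -/

/-- The density `(1 + |z|²)^s |f(z)|² exp (-|z|²/ε)`. -/
def fockDensity (ε s : ℝ) (f : ℂ → ℂ) (z : ℂ) : ℝ :=
  (1 + ‖z‖ ^ 2) ^ s * ‖f z‖ ^ 2 * Real.exp (-‖z‖ ^ 2 / ε)

/-- The weighted Fock-Bargmann space of order `s`: entire functions with integrable density.
The Fock-Bargmann space itself is the case `s = 0`. -/
def fockSpace (ε s : ℝ) : Set (ℂ → ℂ) :=
  {f | Differentiable ℂ f ∧ Integrable (fockDensity ε s f)}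

/-- The norm of the weighted Fock-Bargmann space of order `s`. -/
def fockNorm (ε s : ℝ) (f : ℂ → ℂ) : ℝ :=
  Real.sqrt (∫ z, fockDensity ε s f z)

/-- The Szego projector
`g ↦ (π ε)⁻¹ ∫ exp (z conj z' / ε) exp (-|z'|²/ε) g(z') dz'`. -/
def szego (ε : ℝ) (g : ℂ → ℂ) (z : ℂ) : ℂ :=
  1 / ((Real.pi * ε : ℝ) : ℂ) *
    ∫ w : ℂ, Complex.exp (z * conj w / (ε : ℂ)) * (Real.exp (-‖w‖ ^ 2 / ε) : ℂ) * g w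

/-! ### The energy in the lowest Landau level -/

/-- The effective potential `-β |z|² + |z|⁴ / 4`. -/
def potential (β : ℝ) (z : ℂ) : ℝ := -β * ‖z‖ ^ 2 + 1 / 4 * ‖z‖ ^ 4

/-- The energy of `f` in the lowest Landau level (a finite quantity on `fockSpace ε 2`). -/
def energyLLL (β G ε : ℝ) (f : ℂ → ℂ) : ℝ :=
  ∫ z : ℂ, (potential β z * ‖f z‖ ^ 2 * Real.exp (-‖z‖ ^ 2 / ε)
    + G / 2 * ‖f z‖ ^ 4 * Real.exp (-2 * ‖z‖ ^ 2 / ε))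

/-- The infimum of the energy under the mass constraint. Functions in `fockSpace ε 1` that are not
in `fockSpace ε 2` have energy `+∞` and do not contribute to the infimum. -/
def groundEnergyLLL (β G ε : ℝ) : ℝ :=
  sInf {E | ∃ f : ℂ → ℂ, f ∈ fockSpace ε 1 ∧ f ∈ fockSpace ε 2 ∧ fockNorm ε 0 f = 1 ∧
    E = energyLLL β G ε f}

/-! ### The theta function and the Abrikosov lattice -/

/-- The Jacobi theta function
`Θ(v, τ) = (1/i) ∑ (-1)^n exp (iπτ (n + 1/2)²) exp ((2n + 1) π i v)`, `n` ranging over `ℤ`. -/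
def theta (v τ : ℂ) : ℂ :=
  1 / Complex.I * ∑' n : ℤ, (-1 : ℂ) ^ n *
    Complex.exp (Complex.I * Real.pi * τ * ((n : ℂ) + 1 / 2) ^ 2) *
    Complex.exp ((2 * (n : ℂ) + 1) * Real.pi * Complex.I * v)

/-- The entire function `f_τ(z) = exp (z²/(2ε)) Θ(√(τ_I/(πε)) z, τ)`. -/
def latticeF (ε : ℝ) (τ z : ℂ) : ℂ :=
  Complex.exp (z ^ 2 / (2 * (ε : ℂ))) * theta ((Real.sqrt (τ.im / (Real.pi * ε)) : ℂ) * z) τ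

/-- The function `u_τ(z) = exp (-|z|²/(2ε)) f_τ(z)`, whose modulus is periodic over the lattice
`√(πε/τ_I) (ℤ ⊕ ℤ τ)`. -/
def latticeU (ε : ℝ) (τ z : ℂ) : ℂ :=
  (Real.exp (-‖z‖ ^ 2 / (2 * ε)) : ℂ) * latticeF ε τ z

/-- The average over the fundamental cell `√(πε/τ_I) ([0,1] ⊕ [0,1] τ)` of a function that is
periodic over the lattice. -/
def cellAverage (ε : ℝ) (τ : ℂ) (v : ℂ → ℝ) : ℝ :=
  ∫ s in (0 : ℝ)..1, ∫ t in (0 : ℝ)..1,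
    v ((Real.sqrt (Real.pi * ε / τ.im) : ℂ) * ((s : ℂ) + (t : ℂ) * τ))

/-- The ratio of the average of `|u_τ|⁴` to the squared average of `|u_τ|²`, at the scale `ε`. -/
def abrikosovRatio (ε : ℝ) (τ : ℂ) : ℝ :=
  cellAverage ε τ (fun z => ‖latticeU ε τ z‖ ^ 4) /
    (cellAverage ε τ (fun z => ‖latticeU ε τ z‖ ^ 2)) ^ 2

/-- The lattice parameter of the hexagonal lattice. -/
def hexTau : ℂ := Complex.exp (2 * Complex.I * Real.pi / 3)

/-- The Abrikosov constant of the hexagonal lattice. The ratio does not depend on the scale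
(`abrikosovRatio_eq`); it is taken at scale one. -/
def hexB : ℝ := abrikosovRatio 1 hexTau

theorem latticeU_scale {ε : ℝ} (hε : 0 < ε) (τ z : ℂ) :
    latticeU ε τ ((Real.sqrt ε : ℂ) * z) = latticeU 1 τ z := by
  have h1 : ((Real.sqrt ε : ℝ) : ℂ) ^ 2 = (ε : ℂ) := by
    rw [← Complex.ofReal_pow, Real.sq_sqrt hε.le]
  have hε' : (ε : ℂ) ≠ 0 := by exact_mod_cast hε.ne'
  have e1 : -‖(Real.sqrt ε : ℂ) * z‖ ^ 2 / (2 * ε) = -‖z‖ ^ 2 / (2 * 1) := by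
    rw [norm_mul, Complex.norm_real, mul_pow, Real.norm_eq_abs, sq_abs, Real.sq_sqrt hε.le]
    field_simp
  have e2 : ((Real.sqrt ε : ℂ) * z) ^ 2 / (2 * (ε : ℂ)) = z ^ 2 / (2 * ((1 : ℝ) : ℂ)) := by
    rw [mul_pow, h1]
    push_cast
    field_simp
  have e3 : (Real.sqrt (τ.im / (Real.pi * ε)) : ℂ) * ((Real.sqrt ε : ℂ) * z)
      = (Real.sqrt (τ.im / (Real.pi * 1)) : ℂ) * z := by
    rw [← mul_assoc, ← Complex.ofReal_mul, ← Real.sqrt_mul' _ hε.le]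
    congr 3
    field_simp
  simp only [latticeU, latticeF, e1, e2, e3]

theorem abrikosovRatio_eq {ε : ℝ} (hε : 0 < ε) (τ : ℂ) :
    abrikosovRatio ε τ = abrikosovRatio 1 τ := by
  have key : ∀ w : ℂ, (Real.sqrt (Real.pi * ε / τ.im) : ℂ) * w
      = (Real.sqrt ε : ℂ) * ((Real.sqrt (Real.pi * 1 / τ.im) : ℂ) * w) := by
    intro w
    rw [← mul_assoc, ← Complex.ofReal_mul, ← Real.sqrt_mul hε.le]
    congr 3
    ring
  simp only [abrikosovRatio, cellAverage, key, latticeU_scale hε]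

/-! ### The Thomas-Fermi problem -/

/-- The Thomas-Fermi density with chemical potential `μ`. -/
def densityTF (b β G μ : ℝ) (z : ℂ) : ℝ :=
  max ((μ + β * ‖z‖ ^ 2 - 1 / 4 * ‖z‖ ^ 4) / (b * G)) 0

/-- The Thomas-Fermi chemical potential: the value of `μ` for which the density has mass one
(for `b G > 0` there is exactly one such value). -/
def muTF (b β G : ℝ) : ℝ := sInf {μ | ∫ z : ℂ, densityTF b β G μ z = 1}

/-- The Thomas-Fermi profile `ρ^TF_b`. -/
def rhoTF (b β G : ℝ) : ℂ → ℝ := densityTF b β G (muTF b β G)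

/-- The density of the Thomas-Fermi energy. -/
def energyDensityTF (b β G : ℝ) (ρ : ℂ → ℝ) (z : ℂ) : ℝ :=
  potential β z * ρ z + b * G / 2 * ρ z ^ 2

/-- The Thomas-Fermi energy of `ρ`. -/
def energyTF (b β G : ℝ) (ρ : ℂ → ℝ) : ℝ := ∫ z : ℂ, energyDensityTF b β G ρ z

/-- The Thomas-Fermi ground state energy: the infimum over nonnegative densities of mass one with
finite second moment. Densities of infinite energy do not contribute to the infimum. -/
def groundEnergyTF (b β G : ℝ) : ℝ :=
  sInf {E | ∃ ρ : ℂ → ℝ, (∀ z, 0 ≤ ρ z) ∧ Integrable ρ ∧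
    Integrable (fun z : ℂ => ‖z‖ ^ 2 * ρ z) ∧ ∫ z : ℂ, ρ z = 1 ∧
    Integrable (energyDensityTF b β G ρ) ∧ E = energyTF b β G ρ}

/-! ### The trial function -/

/-- The projected profile `Π_ε (α f_τ)`. -/
def projectedTrial (ε : ℝ) (α : ℂ → ℂ) (τ : ℂ) : ℂ → ℂ :=
  szego ε (fun z => α z * latticeF ε τ z)

/-- The trial function `f_{α,τ}`: the normalization of `Π_ε (α f_τ)` in the Fock-Bargmann space. -/
def trial (ε : ℝ) (α : ℂ → ℂ) (τ z : ℂ) : ℂ :=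
  projectedTrial ε α τ z / (fockNorm ε 0 (projectedTrial ε α τ) : ℂ)

/-- The left-hand side of the Euler-Lagrange equation. -/
def eulerLagrange (β G ε : ℝ) (f : ℂ → ℂ) (z : ℂ) : ℂ :=
  (-(β : ℂ) + 1 / 4 * (ε : ℂ)) * szego ε (fun w => (‖w‖ ^ 2 : ℂ) * f w) z
    + 1 / 4 * szego ε (fun w => (‖w‖ ^ 2 : ℂ) * szego ε (fun w' => (‖w'‖ ^ 2 : ℂ) * f w') w) z
    + (G : ℂ) * szego ε
        (fun w => (Real.exp (-‖w‖ ^ 2 / ε) : ℂ) * (‖f w‖ ^ 2 : ℂ) * f w) z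

end LLL

end

open LLL

namespace LLL

open Filter Topology

/-! Multiplied by `exp (-|z|²/(2ε))` on the left, the kernel of `Π_ε` has the modulus of a Gaussian
in `z - w` of width `√ε`. It therefore almost commutes with multiplication by a compactly supported
profile `φ` that is Hölder with exponent `1/2`: over a distance `√ε` such a profile moves by
`O(ε^(1/4))`, and this is the source of every error in the theorem (`CompHolder.szego_commutator`).
The function `f_τ` is entire and bounded in the weighted sense, so `Π_ε f_τ = f_τ`
(`szego_eq_self`), whence `Π_ε(α f_τ) = α f_τ + O(ε^(1/4))`. The errors are controlled pointwise
with all polynomial weights (`Decays`), so that they survive multiplication by `|z|²`, further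
projections, and integration against the potential.

The nonlinear term rests on an exact relation. Both `e^{-|z|²/ε}|f_τ|² f_τ` and its projection have
the quasi-periods of `f_τ`; a Fourier argument shows that the entire functions with these
quasi-periods form a line, so `Π_ε(e^{-|z|²/ε}|f_τ|² f_τ) = c_ε f_τ`
(`exists_szego_cubicTerm_latticeF`). Pairing with `χ f_τ` for a profile `χ` of integral one and
averaging the periodic functions `|u_τ|²`, `|u_τ|⁴` gives `c_ε = m₄/m₂ + O(ε^(1/4))`, where `mₙ` is
the cell average of `|u_τ|ⁿ` (`CompHolder.averaging`, `eigenvalue_asymptotics`).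

The normalized trial function has profile `α/√m₂` (`hasProfile_trial`). Since `b = m₄/m₂²`, the
Euler-Lagrange defect has profile `α (V + bG|α|² - μ)/√m₂`, with `V` the potential, and this
vanishes by the Thomas-Fermi equation for `|α|² = ρ^TF_b`; the term with `ε/4` is of lower order.
The same averaging turns the energy into the Thomas-Fermi energy of `|α|²`, which is minimal by
convexity (`groundEnergyTF_eq`). The bound on `F^LLL` holds because the trial function is admissible
and the energy is bounded below. -/

/-! ### The Gaussian weight and integrable majorants. -/

/-- The square root `exp (-|z|²/(2ε))` of the Gaussian weight. -/
noncomputable def gauss (ε : ℝ) (z : ℂ) : ℝ := Real.exp (-‖z‖ ^ 2 / (2 * ε))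

theorem gauss_pos (ε : ℝ) (z : ℂ) : 0 < gauss ε z := Real.exp_pos _

theorem gauss_sq (ε : ℝ) (z : ℂ) : gauss ε z ^ 2 = Real.exp (-‖z‖ ^ 2 / ε) := by
  rw [gauss, ← Real.exp_nat_mul]
  congr 1
  rcases eq_or_ne ε 0 with rfl | h
  · simp
  · push_cast
    field_simp

theorem continuous_gauss (ε : ℝ) : Continuous (gauss ε) := by
  unfold gauss
  fun_prop

/-- The common majorant of the file: a bound with the weight `(1 + |z|²)^2` is integrable over the
plane. -/
theorem integrable_inv_one_add_norm_sq_sq :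
    Integrable (fun y : ℂ => ((1 + ‖y‖ ^ 2) ^ 2)⁻¹) := by
  have h := integrable_rpow_neg_one_add_norm_sq (E := ℂ) (μ := volume) (r := 4)
    (by rw [Complex.finrank_real_complex]; norm_num)
  refine h.congr (Filter.Eventually.of_forall fun y => ?_)
  have : (0 : ℝ) < 1 + ‖y‖ ^ 2 := by positivity
  simp only
  rw [show (-4 / 2 : ℝ) = -(2 : ℕ) by norm_num, Real.rpow_neg this.le, Real.rpow_natCast]

theorem integrable_pow_mul_exp_neg_norm_sq (k : ℕ) {a : ℝ} (ha : 0 < a) :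
    Integrable (fun y : ℂ => (1 + ‖y‖ ^ 2) ^ k * Real.exp (-a * ‖y‖ ^ 2)) := by
  -- From `x^(k+2)/(k+2)! ≤ e^x` at `x = a(1 + |y|²)`; two of the powers pay for integrability.
  set C : ℝ := (k + 2).factorial / a ^ (k + 2) * Real.exp a
  refine (integrable_inv_one_add_norm_sq_sq.const_mul C).mono'
    (Continuous.aestronglyMeasurable (by fun_prop)) (Filter.Eventually.of_forall fun y => ?_)
  have hp : (0 : ℝ) < 1 + ‖y‖ ^ 2 := by positivity
  rw [Real.norm_of_nonneg (by positivity), ← div_eq_mul_inv, le_div_iff₀ (by positivity)]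
  have h := Real.pow_div_factorial_le_exp (a * (1 + ‖y‖ ^ 2)) (by positivity) (k + 2)
  rw [div_le_iff₀ (by positivity), mul_pow] at h
  have e : Real.exp (-a * ‖y‖ ^ 2) = Real.exp a * (Real.exp (a * (1 + ‖y‖ ^ 2)))⁻¹ := by
    rw [← Real.exp_neg, ← Real.exp_add]
    congr 1
    ring
  rw [e]
  have hE : 0 < Real.exp (a * (1 + ‖y‖ ^ 2)) := Real.exp_pos _
  calc (1 + ‖y‖ ^ 2) ^ k * (Real.exp a * (Real.exp (a * (1 + ‖y‖ ^ 2)))⁻¹) * (1 + ‖y‖ ^ 2) ^ 2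
      = (a ^ (k + 2) * (1 + ‖y‖ ^ 2) ^ (k + 2)) *
          (Real.exp a * (Real.exp (a * (1 + ‖y‖ ^ 2)))⁻¹ / a ^ (k + 2)) := by
        field_simp
        ring
    _ ≤ (Real.exp (a * (1 + ‖y‖ ^ 2)) * (k + 2).factorial) *
          (Real.exp a * (Real.exp (a * (1 + ‖y‖ ^ 2)))⁻¹ / a ^ (k + 2)) := by
        gcongr
    _ = C := by
        simp only [C]
        field_simp

theorem integrable_pow_mul_gaussian (k : ℕ) :
    Integrable (fun y : ℂ => (1 + ‖y‖ ^ 2) ^ k * Real.exp (-‖y‖ ^ 2 / 2)) := by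
  refine (integrable_pow_mul_exp_neg_norm_sq k (a := 1 / 2) (by norm_num)).congr
    (Filter.Eventually.of_forall fun y => ?_)
  simp only
  congr 2
  ring

/-! ### The projector: weighted bounds, holomorphy, reproducing property, symmetry. -/

/-- The integrand of the Szego projector. -/
noncomputable def szegoIntegrand (ε : ℝ) (z : ℂ) (g : ℂ → ℂ) (w : ℂ) : ℂ :=
  Complex.exp (z * conj w / (ε : ℂ)) * (Real.exp (-‖w‖ ^ 2 / ε) : ℂ) * g w

theorem szego_eq (ε : ℝ) (g : ℂ → ℂ) (z : ℂ) :
    szego ε g z = 1 / ((Real.pi * ε : ℝ) : ℂ) * ∫ w, szegoIntegrand ε z g w := rfl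

/-- Completing the square: with half of the Gaussian weight on each side, the kernel is in modulus a
convolution kernel. -/
theorem gauss_mul_norm_szegoIntegrand {ε : ℝ} (hε : 0 < ε) (z : ℂ) (g : ℂ → ℂ) (w : ℂ) :
    gauss ε z * ‖szegoIntegrand ε z g w‖
      = Real.exp (-‖z - w‖ ^ 2 / (2 * ε)) * (gauss ε w * ‖g w‖) := by
  rw [szegoIntegrand, norm_mul, norm_mul, Complex.norm_exp, Complex.norm_real,
    Real.norm_of_nonneg (Real.exp_pos _).le, gauss, gauss, ← mul_assoc, ← mul_assoc, ← mul_assoc,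
    ← Real.exp_add, ← Real.exp_add, ← Real.exp_add]
  congr 2
  have h1 : (z * conj w / (ε : ℂ)).re = (z * conj w).re / ε := by
    rw [Complex.div_ofReal_re]
  rw [h1]
  have h2 : ‖z - w‖ ^ 2 = ‖z‖ ^ 2 - 2 * (z * conj w).re + ‖w‖ ^ 2 := by
    rw [← Complex.normSq_eq_norm_sq, ← Complex.normSq_eq_norm_sq, ← Complex.normSq_eq_norm_sq,
      Complex.normSq_sub]
    ring
  rw [h2]
  field_simp
  ring

/-- Recentring at `z` at the natural scale `√ε`. The Jacobian is `ε` in real dimension two and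
cancels the `ε` of the prefactor `1/(πε)`. -/
theorem integral_comp_add_sqrt_smul {E : Type*} [NormedAddCommGroup E] [NormedSpace ℝ E]
    {ε : ℝ} (hε : 0 < ε) (z : ℂ) (F : ℂ → E) :
    ∫ w, F w = ε • ∫ y, F (z + (Real.sqrt ε) • y) := by
  have h := Measure.integral_comp_smul (volume : Measure ℂ) (fun y => F (z + y)) (Real.sqrt ε)
  rw [h, Complex.finrank_real_complex, Real.sq_sqrt hε.le, abs_of_pos (inv_pos.2 hε), smul_smul,
    mul_inv_cancel₀ hε.ne', one_smul]
  exact (integral_add_left_eq_self F z).symm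

theorem norm_sub_add_sqrt_smul {ε : ℝ} (hε : 0 < ε) (z y : ℂ) :
    -‖z - (z + (Real.sqrt ε) • y)‖ ^ 2 / (2 * ε) = -‖y‖ ^ 2 / 2 := by
  rw [sub_add_cancel_left, norm_neg, norm_smul, Real.norm_of_nonneg (Real.sqrt_nonneg _), mul_pow,
    Real.sq_sqrt hε.le]
  field_simp

/-- All pointwise estimates on the projector go through this bound. The majorant `H` lives in the
rescaled variable and may depend on `z` and `ε`. -/
theorem gauss_mul_norm_szego_le {ε : ℝ} (hε : 0 < ε) (z : ℂ) (h : ℂ → ℂ) (H : ℂ → ℝ)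
    (hH : ∀ y : ℂ, gauss ε (z + (Real.sqrt ε) • y) * ‖h (z + (Real.sqrt ε) • y)‖ ≤ H y)
    (hi : Integrable (fun y => Real.exp (-‖y‖ ^ 2 / 2) * H y)) :
    gauss ε z * ‖szego ε h z‖ ≤ 1 / Real.pi * ∫ y, Real.exp (-‖y‖ ^ 2 / 2) * H y := by
  rw [szego_eq, integral_comp_add_sqrt_smul hε z, norm_mul, norm_smul, Real.norm_of_nonneg hε.le]
  have hpi := Real.pi_pos
  have e : ‖1 / ((Real.pi * ε : ℝ) : ℂ)‖ = 1 / (Real.pi * ε) := by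
    rw [norm_div, norm_one, Complex.norm_real, Real.norm_of_nonneg (by positivity)]
  rw [e]
  have key : gauss ε z * ‖∫ y, szegoIntegrand ε z h (z + (Real.sqrt ε) • y)‖
      ≤ ∫ y, Real.exp (-‖y‖ ^ 2 / 2) * H y := by
    calc gauss ε z * ‖∫ y, szegoIntegrand ε z h (z + (Real.sqrt ε) • y)‖
        ≤ gauss ε z * ∫ y, ‖szegoIntegrand ε z h (z + (Real.sqrt ε) • y)‖ := by
          gcongr
          · exact (gauss_pos _ _).le
          · exact norm_integral_le_integral_norm _
      _ = ∫ y, gauss ε z * ‖szegoIntegrand ε z h (z + (Real.sqrt ε) • y)‖ :=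
          (integral_const_mul _ _).symm
      _ ≤ ∫ y, Real.exp (-‖y‖ ^ 2 / 2) * H y := by
          refine integral_mono_of_nonneg (Filter.Eventually.of_forall fun y => ?_) hi
            (Filter.Eventually.of_forall fun y => ?_)
          · exact mul_nonneg (gauss_pos _ _).le (norm_nonneg _)
          · simp only
            rw [gauss_mul_norm_szegoIntegrand hε, norm_sub_add_sqrt_smul hε]
            gcongr
            exact hH y
  calc gauss ε z * (1 / (Real.pi * ε) * (ε * ‖∫ y, szegoIntegrand ε z h (z + (Real.sqrt ε) • y)‖))
      = 1 / Real.pi * (gauss ε z * ‖∫ y, szegoIntegrand ε z h (z + (Real.sqrt ε) • y)‖) := by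
        field_simp
    _ ≤ _ := by gcongr

theorem integrable_exp_neg_norm_sub_sq {ε : ℝ} (hε : 0 < ε) (z : ℂ) :
    Integrable (fun w : ℂ => Real.exp (-‖z - w‖ ^ 2 / (2 * ε))) := by
  have h := (integrable_pow_mul_exp_neg_norm_sq 0 (a := 1 / (2 * ε)) (by positivity))
  have h2 := h.comp_sub_left z
  refine h2.congr (Filter.Eventually.of_forall fun y => ?_)
  simp only [pow_zero, one_mul]
  congr 1
  field_simp

theorem continuous_szegoIntegrand (ε : ℝ) (z : ℂ) {g : ℂ → ℂ} (hg : Continuous g) :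
    Continuous (szegoIntegrand ε z g) := by
  unfold szegoIntegrand
  have := Complex.continuous_conj
  fun_prop

theorem integrable_szegoIntegrand {ε : ℝ} (hε : 0 < ε) (z : ℂ) {g : ℂ → ℂ} (hg : Continuous g)
    {M : ℝ} (hM : ∀ w, gauss ε w * ‖g w‖ ≤ M) : Integrable (szegoIntegrand ε z g) := by
  refine ((integrable_exp_neg_norm_sub_sq hε z).const_mul (M / gauss ε z)).mono'
    (continuous_szegoIntegrand ε z hg).aestronglyMeasurable
    (Filter.Eventually.of_forall fun w => ?_)
  rw [div_mul_eq_mul_div, le_div_iff₀ (gauss_pos _ _), mul_comm,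
    gauss_mul_norm_szegoIntegrand hε, mul_comm M]
  gcongr
  exact hM w

theorem szego_const_mul (ε : ℝ) (c : ℂ) (g : ℂ → ℂ) (z : ℂ) :
    szego ε (fun w => c * g w) z = c * szego ε g z := by
  rw [szego_eq, szego_eq]
  have : ∀ w, szegoIntegrand ε z (fun w => c * g w) w = c * szegoIntegrand ε z g w := by
    intro w
    simp only [szegoIntegrand]
    ring
  simp only [this]
  rw [integral_const_mul]
  ring

theorem szego_sub {ε : ℝ} (hε : 0 < ε) {g h : ℂ → ℂ} (hg : Continuous g) (hh : Continuous h)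
    {M N : ℝ} (hM : ∀ w, gauss ε w * ‖g w‖ ≤ M) (hN : ∀ w, gauss ε w * ‖h w‖ ≤ N) (z : ℂ) :
    szego ε (fun w => g w - h w) z = szego ε g z - szego ε h z := by
  rw [szego_eq, szego_eq, szego_eq, ← mul_sub,
    ← integral_sub (integrable_szegoIntegrand hε z hg hM) (integrable_szegoIntegrand hε z hh hN)]
  congr 2
  ext w
  simp only [szegoIntegrand]
  ring

theorem differentiable_szego {ε : ℝ} (hε : 0 < ε) {g : ℂ → ℂ} (hg : Continuous g)
    {M : ℝ} (hM : ∀ w, gauss ε w * ‖g w‖ ≤ M) : Differentiable ℂ (szego ε g) := by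
  intro z₀
  have hεc : (ε : ℂ) ≠ 0 := by exact_mod_cast hε.ne'
  have hM0 : 0 ≤ M := le_trans (mul_nonneg (gauss_pos _ _).le (norm_nonneg _)) (hM 0)
  have hconj := Complex.continuous_conj
  set R : ℝ := ‖z₀‖ + 1
  set F' : ℂ → ℂ → ℂ := fun z w => conj w / (ε : ℂ) * szegoIntegrand ε z g w
  -- For `|z| ≤ R` one has `|z||w| ≤ R² + |w|²/4`; the growth of the kernel costs half of the decay
  -- `|w|²/(2ε)` left after `g` is bounded.
  set B : ℂ → ℝ := fun w => M / ε * Real.exp (R ^ 2 / ε) *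
    ((1 + ‖w‖ ^ 2) ^ 1 * Real.exp (-(1 / (4 * ε)) * ‖w‖ ^ 2))
  have key := hasDerivAt_integral_of_dominated_loc_of_deriv_le (μ := (volume : Measure ℂ))
    (F := fun z w => szegoIntegrand ε z g w) (F' := F') (x₀ := z₀) (s := Metric.ball z₀ 1)
    (bound := B) (Metric.ball_mem_nhds z₀ one_pos)
    (Filter.Eventually.of_forall fun z => (continuous_szegoIntegrand ε z hg).aestronglyMeasurable)
    (integrable_szegoIntegrand hε z₀ hg hM)
    (((hconj.div_const _).mul (continuous_szegoIntegrand ε z₀ hg)).aestronglyMeasurable) ?_ ?_ ?_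
  · have h2 : szego ε g = fun z => 1 / ((Real.pi * ε : ℝ) : ℂ) * ∫ w, szegoIntegrand ε z g w := rfl
    rw [h2]
    exact (key.2.differentiableAt).const_mul _
  · refine Filter.Eventually.of_forall fun w z hz => ?_
    have hzR : ‖z‖ ≤ R := by
      rw [Metric.mem_ball, dist_eq_norm] at hz
      have := norm_le_norm_add_norm_sub' z z₀
      simp only [R]
      linarith
    have e1 : ‖Complex.exp (z * conj w / (ε : ℂ))‖ ≤
        Real.exp (R ^ 2 / ε) * Real.exp (‖w‖ ^ 2 / (4 * ε)) := by
      rw [← Real.exp_add]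
      refine (Complex.norm_exp_le_exp_norm _).trans (Real.exp_le_exp.2 ?_)
      rw [norm_div, norm_mul, RCLike.norm_conj, Complex.norm_real, Real.norm_of_nonneg hε.le]
      have : ‖z‖ * ‖w‖ ≤ R * ‖w‖ := by gcongr
      rw [div_le_iff₀ hε]
      have e2 : (R ^ 2 / ε + ‖w‖ ^ 2 / (4 * ε)) * ε = R ^ 2 + ‖w‖ ^ 2 / 4 := by
        field_simp
      rw [e2]
      nlinarith [sq_nonneg (R - ‖w‖ / 2)]
    have e3 : Real.exp (-‖w‖ ^ 2 / ε) * ‖g w‖ ≤ Real.exp (-‖w‖ ^ 2 / (2 * ε)) * M := by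
      rw [← gauss_sq, sq, mul_assoc]
      exact mul_le_mul_of_nonneg_left (hM w) (gauss_pos _ _).le
    have e4 : ‖w‖ ≤ 1 + ‖w‖ ^ 2 := by nlinarith [sq_nonneg (‖w‖ - 1)]
    have e5 : Real.exp (‖w‖ ^ 2 / (4 * ε)) * Real.exp (-‖w‖ ^ 2 / (2 * ε))
        = Real.exp (-(1 / (4 * ε)) * ‖w‖ ^ 2) := by
      rw [← Real.exp_add]
      congr 1
      field_simp
      ring
    simp only [F', B, szegoIntegrand]
    rw [norm_mul, norm_div, RCLike.norm_conj, norm_mul, norm_mul, Complex.norm_real,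
      Complex.norm_real, Real.norm_of_nonneg hε.le, Real.norm_of_nonneg (Real.exp_pos _).le]
    calc ‖w‖ / ε * (‖Complex.exp (z * conj w / (ε : ℂ))‖ * Real.exp (-‖w‖ ^ 2 / ε) * ‖g w‖)
        = ‖w‖ / ε * (‖Complex.exp (z * conj w / (ε : ℂ))‖ * (Real.exp (-‖w‖ ^ 2 / ε) * ‖g w‖)) := by
          ring
      _ ≤ (1 + ‖w‖ ^ 2) / ε * ((Real.exp (R ^ 2 / ε) * Real.exp (‖w‖ ^ 2 / (4 * ε))) *
            (Real.exp (-‖w‖ ^ 2 / (2 * ε)) * M)) := by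
          gcongr
      _ = M / ε * Real.exp (R ^ 2 / ε) * ((1 + ‖w‖ ^ 2) ^ 1 *
            (Real.exp (‖w‖ ^ 2 / (4 * ε)) * Real.exp (-‖w‖ ^ 2 / (2 * ε)))) := by
          ring
      _ = _ := by rw [e5]
  · exact (integrable_pow_mul_exp_neg_norm_sq 1 (by positivity)).const_mul _
  · refine Filter.Eventually.of_forall fun w z _ => ?_
    have h1 : HasDerivAt (fun z => z * conj w / (ε : ℂ)) (conj w / (ε : ℂ)) z := by
      simpa using ((hasDerivAt_id z).mul_const (conj w)).div_const (ε : ℂ)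
    have h2 := ((h1.cexp).mul_const ((Real.exp (-‖w‖ ^ 2 / ε) : ℝ) : ℂ)).mul_const (g w)
    refine h2.congr_deriv ?_
    simp only [F', szegoIntegrand]
    ring

/-- In polar coordinates the mean value property kills the integral over each circle. -/
theorem integral_radial_smul_sub_eq_zero {F : ℂ → ℂ} (hF : Differentiable ℂ F) (h : ℝ → ℝ) :
    ∫ y : ℂ, h ‖y‖ • (F y - F 0) = 0 := by
  rw [← Complex.integral_comp_polarCoord_symm, polarCoord_target]
  set f : ℝ × ℝ → ℂ := fun p =>
    p.1 • h ‖Complex.polarCoord.symm p‖ • (F (Complex.polarCoord.symm p) - F 0)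
  by_cases hi : IntegrableOn f (Set.Ioi 0 ×ˢ Set.Ioo (-Real.pi) Real.pi) volume
  · rw [Measure.volume_eq_prod] at hi ⊢
    rw [setIntegral_prod f hi]
    refine setIntegral_eq_zero_of_forall_eq_zero fun r hr => ?_
    have hr0 : (0 : ℝ) < r := hr
    have e : ∀ θ : ℝ, f (r, θ) = (r * h r) • (F (circleMap 0 r θ) - F 0) := by
      intro θ
      have e1 : Complex.polarCoord.symm (r, θ) = circleMap 0 r θ := by
        rw [Complex.polarCoord_symm_apply, circleMap, zero_add, Complex.exp_mul_I]
        push_cast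
        ring
      simp only [f]
      rw [e1, smul_smul, norm_circleMap_zero, abs_of_pos hr0]
    simp only [e]
    rw [integral_smul]
    have hG : Differentiable ℂ (fun y => F y - F 0) := hF.sub_const _
    have h1 : Real.circleAverage (fun y => F y - F 0) 0 r = 0 := by
      rw [DiffContOnCl.circleAverage hG.diffContOnCl, sub_self]
    rw [Real.circleAverage_eq_integral_add (-Real.pi)] at h1
    have h2 := (smul_eq_zero.1 h1).resolve_left (by positivity)
    rw [intervalIntegral.integral_comp_add_right (fun θ => F (circleMap 0 r θ) - F 0)] at h2
    rw [show (0 : ℝ) + -Real.pi = -Real.pi by ring,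
      show 2 * Real.pi + -Real.pi = Real.pi by ring,
      intervalIntegral.integral_of_le (by linarith [Real.pi_pos]),
      integral_Ioc_eq_integral_Ioo] at h2
    simp [h2]
  -- Without integrability the integral is `0` by convention, so no hypothesis on `h` is needed.
  · exact integral_undef hi

/-- With `w = z + y`, the exponent `z w̄ - |w|²` equals `-|y|² - z̄ y`: a radial Gaussian times a
function entire in `y`, so the mean value property evaluates the integral at `y = 0`. Weighted
boundedness suffices; `f_τ` is not in the Fock space. -/
theorem szego_eq_self {ε : ℝ} (hε : 0 < ε) {g : ℂ → ℂ} (hg : Differentiable ℂ g)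
    {M : ℝ} (hM : ∀ w, gauss ε w * ‖g w‖ ≤ M) (z : ℂ) : szego ε g z = g z := by
  have hεc : (ε : ℂ) ≠ 0 := by exact_mod_cast hε.ne'
  set F : ℂ → ℂ := fun y => Complex.exp (-conj z * y / (ε : ℂ)) * g (z + y)
  have hF : Differentiable ℂ F := by
    refine Differentiable.mul ?_ (hg.comp (differentiable_id.const_add z))
    exact Complex.differentiable_exp.comp ((differentiable_id.const_mul _).div_const _)
  have e : ∀ y, szegoIntegrand ε z g (z + y) = Real.exp (-‖y‖ ^ 2 / ε) • F y := by
    intro y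
    simp only [szegoIntegrand, F, Complex.real_smul]
    rw [← mul_assoc, Complex.ofReal_exp, Complex.ofReal_exp, ← Complex.exp_add, ← Complex.exp_add]
    congr 2
    push_cast
    rw [← Complex.mul_conj', ← Complex.mul_conj', map_add]
    field_simp
    ring
  have hint : Integrable (fun y => szegoIntegrand ε z g (z + y)) :=
    (integrable_szegoIntegrand hε z hg.continuous hM).comp_add_left z
  have hgi : Integrable (fun y : ℂ => Real.exp (-‖y‖ ^ 2 / ε)) := by
    refine (integrable_pow_mul_exp_neg_norm_sq 0 (a := 1 / ε) (by positivity)).congr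
      (Filter.Eventually.of_forall fun y => ?_)
    simp only [pow_zero, one_mul]
    congr 1
    ring
  have hval : ∫ y : ℂ, Real.exp (-‖y‖ ^ 2 / ε) = Real.pi * ε := by
    have h := GaussianFourier.integral_rexp_neg_mul_sq_norm (V := ℂ) (b := 1 / ε) (by positivity)
    rw [Complex.finrank_real_complex] at h
    norm_num at h
    rw [← h]
    congr 1
    ext y
    congr 1
    field_simp
  have h0 := integral_radial_smul_sub_eq_zero hF (fun r => Real.exp (-r ^ 2 / ε))
  simp only [e] at hint
  have h1 : ∫ y : ℂ, Real.exp (-‖y‖ ^ 2 / ε) • F y = (Real.pi * ε : ℝ) • F 0 := by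
    simp only [smul_sub] at h0
    rw [integral_sub hint (hgi.smul_const _), integral_smul_const, hval, sub_eq_zero] at h0
    exact h0
  rw [szego_eq, ← integral_add_left_eq_self _ z]
  simp only [e]
  rw [h1]
  have hpi : ((Real.pi * ε : ℝ) : ℂ) ≠ 0 := by
    exact_mod_cast (mul_pos Real.pi_pos hε).ne'
  simp only [F, Complex.real_smul]
  field_simp
  simp

/-- Symmetry of the projector by Fubini, since the kernel is Hermitian. Only `a` decays; `b` is
merely bounded, as the application to the periodic nonlinear term requires. -/
theorem integral_conj_mul_szego {ε : ℝ} (hε : 0 < ε) {a b : ℂ → ℂ} (ha : Continuous a)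
    (hb : Continuous b) {M N : ℝ} (hM : ∀ z, gauss ε z * ‖a z‖ * (1 + ‖z‖ ^ 2) ^ 2 ≤ M)
    (hN : ∀ z, gauss ε z * ‖b z‖ ≤ N) :
    ∫ z, (gauss ε z ^ 2 : ℝ) * conj (a z) * szego ε b z
      = ∫ w, (gauss ε w ^ 2 : ℝ) * conj (szego ε a w) * b w := by
  have hgc := continuous_gauss ε
  have hconj := Complex.continuous_conj
  have hN0 : 0 ≤ N := le_trans (mul_nonneg (gauss_pos _ _).le (norm_nonneg _)) (hN 0)
  set K : ℂ → ℂ → ℂ := fun z w =>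
    (gauss ε z ^ 2 : ℝ) * conj (a z) * szegoIntegrand ε z b w
  have hK' : ∀ z w, K z w = (gauss ε w ^ 2 : ℝ) * conj (szegoIntegrand ε w a z) * b w := by
    intro z w
    simp only [K, szegoIntegrand, map_mul, Complex.conj_ofReal, gauss_sq, ← Complex.exp_conj,
      map_div₀, Complex.conj_conj]
    rw [mul_comm z (conj w)]
    ring
  have hA : Integrable (fun z => gauss ε z * ‖a z‖) := by
    refine (integrable_inv_one_add_norm_sq_sq.const_mul M).mono'
      (hgc.mul ha.norm).aestronglyMeasurable (Filter.Eventually.of_forall fun z => ?_)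
    rw [Real.norm_of_nonneg (mul_nonneg (gauss_pos _ _).le (norm_nonneg _)), ← div_eq_mul_inv,
      le_div_iff₀ (by positivity)]
    exact hM z
  have hG : Integrable (fun y : ℂ => Real.exp (-‖y‖ ^ 2 / (2 * ε))) := by
    simpa using integrable_exp_neg_norm_sub_sq hε 0
  -- The double integrand is dominated by that of the convolution of the integrable `gauss · |a|`
  -- with an integrable Gaussian.
  have hconv := (hA.convolution_integrand (ContinuousLinearMap.mul ℝ ℝ) hG).swap
  have hi : Integrable (Function.uncurry K) (volume.prod volume) := by
    refine (hconv.const_mul N).mono' ?_ (Filter.Eventually.of_forall fun p => ?_)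
    · refine Continuous.aestronglyMeasurable ?_
      simp only [K, szegoIntegrand, Function.uncurry_def]
      fun_prop
    · obtain ⟨z, w⟩ := p
      simp only [Function.uncurry_apply_pair, Function.comp_apply, Prod.swap_prod_mk, K,
        ContinuousLinearMap.mul_apply']
      rw [norm_mul, norm_mul, RCLike.norm_conj, Complex.norm_real,
        Real.norm_of_nonneg (by positivity)]
      calc gauss ε z ^ 2 * ‖a z‖ * ‖szegoIntegrand ε z b w‖
          = gauss ε z * ‖a z‖ * (gauss ε z * ‖szegoIntegrand ε z b w‖) := by ring
        _ = gauss ε z * ‖a z‖ * (Real.exp (-‖z - w‖ ^ 2 / (2 * ε)) * (gauss ε w * ‖b w‖)) := by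
            rw [gauss_mul_norm_szegoIntegrand hε]
        _ ≤ gauss ε z * ‖a z‖ * (Real.exp (-‖z - w‖ ^ 2 / (2 * ε)) * N) := by
            have := gauss_pos ε z
            gcongr
            exact hN w
        _ = _ := by
            rw [norm_sub_rev]
            ring
  have hL : ∀ z, (gauss ε z ^ 2 : ℝ) * conj (a z) * szego ε b z
      = 1 / ((Real.pi * ε : ℝ) : ℂ) * ∫ w, K z w := by
    intro z
    simp only [K]
    rw [integral_const_mul, szego_eq]
    ring
  have hR : ∀ w, (gauss ε w ^ 2 : ℝ) * conj (szego ε a w) * b w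
      = 1 / ((Real.pi * ε : ℝ) : ℂ) * ∫ z, K z w := by
    intro w
    simp only [hK']
    rw [integral_mul_const, integral_const_mul, szego_eq, map_mul, map_div₀, map_one,
      Complex.conj_ofReal, integral_conj]
    ring
  simp only [hL, hR]
  rw [integral_const_mul, integral_const_mul, integral_integral_swap hi]

/-! ### The algebra of compactly supported Hölder profiles. -/

/-- Compactly supported functions that are Hölder continuous with exponent `1/2`. -/
def CompHolder (φ : ℂ → ℂ) : Prop :=
  ∃ K R : ℝ, 0 ≤ K ∧ 0 ≤ R ∧ (∀ z w, ‖φ z - φ w‖ ≤ K * √‖z - w‖) ∧ ∀ z, R ≤ ‖z‖ → φ z = 0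

namespace CompHolder

variable {φ ψ : ℂ → ℂ}

theorem bounded (h : CompHolder φ) : ∃ B : ℝ, 0 ≤ B ∧ ∀ z, ‖φ z‖ ≤ B := by
  obtain ⟨K, R, hK, hR, h1, h2⟩ := h
  -- A point of the disc is within `2R` of the real point `R`, where `φ` vanishes.
  refine ⟨K * √(2 * R), by positivity, fun z => ?_⟩
  rcases le_total R ‖z‖ with hz | hz
  · rw [h2 z hz, norm_zero]
    positivity
  · have hRn : ‖(R : ℂ)‖ = R := by rw [Complex.norm_real, Real.norm_of_nonneg hR]
    have h3 := h1 z (R : ℂ)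
    rw [h2 _ hRn.ge, sub_zero] at h3
    refine h3.trans ?_
    gcongr
    refine (norm_sub_le _ _).trans ?_
    rw [hRn]
    linarith

theorem continuous (h : CompHolder φ) : Continuous φ := by
  obtain ⟨K, R, hK, hR, h1, h2⟩ := h
  rw [continuous_iff_continuousAt]
  intro z
  rw [ContinuousAt, tendsto_iff_norm_sub_tendsto_zero]
  refine squeeze_zero (fun w => norm_nonneg _) (fun w => h1 w z) ?_
  have : Continuous (fun w : ℂ => K * √‖w - z‖) := by fun_prop
  simpa using this.tendsto z

theorem mul (h : CompHolder φ) (h' : CompHolder ψ) : CompHolder (fun z => φ z * ψ z) := by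
  obtain ⟨B, hB, hBφ⟩ := h.bounded
  obtain ⟨B', hB', hBψ⟩ := h'.bounded
  obtain ⟨K, R, hK, hR, h1, h2⟩ := h
  obtain ⟨K', R', hK', hR', h1', h2'⟩ := h'
  refine ⟨K * B' + B * K', R, by positivity, hR, fun z w => ?_, fun z hz => by simp [h2 z hz]⟩
  calc ‖φ z * ψ z - φ w * ψ w‖ = ‖(φ z - φ w) * ψ z + φ w * (ψ z - ψ w)‖ := by
        congr 1
        ring
    _ ≤ ‖φ z - φ w‖ * ‖ψ z‖ + ‖φ w‖ * ‖ψ z - ψ w‖ := by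
        rw [← norm_mul, ← norm_mul]
        exact norm_add_le _ _
    _ ≤ (K * √‖z - w‖) * B' + B * (K' * √‖z - w‖) := by
        gcongr
        exacts [h1 z w, hBψ z, hBφ w, h1' z w]
    _ = _ := by ring

theorem star (h : CompHolder φ) : CompHolder (fun z => conj (φ z)) := by
  obtain ⟨K, R, hK, hR, h1, h2⟩ := h
  refine ⟨K, R, hK, hR, fun z w => ?_, fun z hz => by simp [h2 z hz]⟩
  rw [← map_sub, RCLike.norm_conj]
  exact h1 z w

theorem const_mul (c : ℂ) (h : CompHolder φ) : CompHolder (fun z => c * φ z) := by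
  obtain ⟨K, R, hK, hR, h1, h2⟩ := h
  refine ⟨‖c‖ * K, R, by positivity, hR, fun z w => ?_, fun z hz => by simp [h2 z hz]⟩
  rw [← mul_sub, norm_mul, mul_assoc]
  gcongr
  exact h1 z w

theorem add (h : CompHolder φ) (h' : CompHolder ψ) : CompHolder (fun z => φ z + ψ z) := by
  obtain ⟨K, R, hK, hR, h1, h2⟩ := h
  obtain ⟨K', R', hK', hR', h1', h2'⟩ := h'
  refine ⟨K + K', max R R', by positivity, le_max_of_le_left hR, fun z w => ?_, fun z hz => ?_⟩
  · rw [add_sub_add_comm, add_mul]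
    exact (norm_add_le _ _).trans (add_le_add (h1 z w) (h1' z w))
  · simp only
    rw [h2 z ((le_max_left _ _).trans hz), h2' z ((le_max_right _ _).trans hz), add_zero]

/-- The factor `|z|²` is Lipschitz on the disc containing the support, and there `|z - w| ≤ √(2R)
√|z - w|`. -/
theorem norm_sq_mul (h : CompHolder φ) : CompHolder (fun z => (‖z‖ : ℂ) ^ 2 * φ z) := by
  obtain ⟨B, hB, hBφ⟩ := h.bounded
  obtain ⟨K, R, hK, hR, h1, h2⟩ := h
  have key : ∀ z w : ℂ, ‖z‖ ≤ R → ‖(‖z‖ : ℂ) ^ 2 * φ z - (‖w‖ : ℂ) ^ 2 * φ w‖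
      ≤ (R ^ 2 * K + 2 * R * √(2 * R) * B) * √‖z - w‖ := by
    intro z w hz
    have e1 : ‖((‖z‖ : ℂ) ^ 2 - (‖w‖ : ℂ) ^ 2) * φ w‖ ≤ 2 * R * √(2 * R) * √‖z - w‖ * B := by
      rcases le_total R ‖w‖ with hw | hw
      · rw [h2 w hw, mul_zero, norm_zero]
        positivity
      · have hzw : ‖z - w‖ ≤ 2 * R := (norm_sub_le _ _).trans (by linarith)
        rw [norm_mul]
        have e2 : ‖(‖z‖ : ℂ) ^ 2 - (‖w‖ : ℂ) ^ 2‖ = |‖z‖ - ‖w‖| * (‖z‖ + ‖w‖) := by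
          rw [← Complex.ofReal_pow, ← Complex.ofReal_pow, ← Complex.ofReal_sub, Complex.norm_real,
            Real.norm_eq_abs, sq_sub_sq, abs_mul, abs_of_nonneg (by positivity : 0 ≤ ‖z‖ + ‖w‖),
            mul_comm]
        have e3 : ‖z - w‖ ≤ √(2 * R) * √‖z - w‖ := by
          conv_lhs => rw [← Real.mul_self_sqrt (norm_nonneg (z - w))]
          gcongr
        rw [e2]
        calc |‖z‖ - ‖w‖| * (‖z‖ + ‖w‖) * ‖φ w‖ ≤ (√(2 * R) * √‖z - w‖) * (2 * R) * B := by
              gcongr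
              · exact (abs_norm_sub_norm_le z w).trans e3
              · linarith
              · exact hBφ w
          _ = _ := by ring
    have e4 : ‖(‖z‖ : ℂ) ^ 2 * (φ z - φ w)‖ ≤ R ^ 2 * (K * √‖z - w‖) := by
      rw [norm_mul, norm_pow, Complex.norm_real, norm_norm]
      gcongr
      exact h1 z w
    calc ‖(‖z‖ : ℂ) ^ 2 * φ z - (‖w‖ : ℂ) ^ 2 * φ w‖
        = ‖(‖z‖ : ℂ) ^ 2 * (φ z - φ w) + ((‖z‖ : ℂ) ^ 2 - (‖w‖ : ℂ) ^ 2) * φ w‖ := by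
          congr 1
          ring
      _ ≤ R ^ 2 * (K * √‖z - w‖) + 2 * R * √(2 * R) * √‖z - w‖ * B :=
          (norm_add_le _ _).trans (add_le_add e4 e1)
      _ = _ := by ring
  refine ⟨R ^ 2 * K + 2 * R * √(2 * R) * B, R, by positivity, hR, fun z w => ?_,
    fun z hz => by simp [h2 z hz]⟩
  rcases le_total ‖z‖ R with hz | hz
  · exact key z w hz
  · rcases le_total ‖w‖ R with hw | hw
    · rw [norm_sub_rev, norm_sub_rev z w]
      exact key w z hw
    · simp only [h2 z hz, h2 w hw, mul_zero, sub_zero, norm_zero]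
      positivity

theorem hasCompactSupport (h : CompHolder φ) : HasCompactSupport φ := by
  obtain ⟨K, R, hK, hR, h1, h2⟩ := h
  refine HasCompactSupport.intro (isCompact_closedBall (0 : ℂ) R) fun z hz => h2 z ?_
  rw [Metric.mem_closedBall, dist_zero_right, not_le] at hz
  exact hz.le

theorem integrable (h : CompHolder φ) : Integrable φ :=
  h.continuous.integrable_of_hasCompactSupport h.hasCompactSupport

/-- The increments of a compactly supported Hölder function, with a weight that exploits the
compactness of the support. -/
theorem weighted_increment (h : CompHolder φ) (k : ℕ) : ∃ C : ℝ, 0 ≤ C ∧ ∀ z y : ℂ,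
    ‖φ (z + y) - φ z‖ * (1 + ‖z‖ ^ 2) ^ k ≤ C * √‖y‖ * (1 + ‖y‖ ^ 2) ^ k := by
  obtain ⟨K, R, hK, hR, h1, h2⟩ := h
  refine ⟨K * (2 * (1 + R ^ 2)) ^ k, by positivity, fun z y => ?_⟩
  have h3 := h1 (z + y) z
  rw [add_sub_cancel_left] at h3
  -- A nonzero increment forces `z` or `z + y` into the disc of radius `R`, and either case gives
  -- this comparison of weights.
  have main : (1 + ‖z‖ ^ 2) ≤ 2 * (1 + R ^ 2) * (1 + ‖y‖ ^ 2) →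
      ‖φ (z + y) - φ z‖ * (1 + ‖z‖ ^ 2) ^ k
        ≤ K * (2 * (1 + R ^ 2)) ^ k * √‖y‖ * (1 + ‖y‖ ^ 2) ^ k := by
    intro h4
    calc ‖φ (z + y) - φ z‖ * (1 + ‖z‖ ^ 2) ^ k
        ≤ (K * √‖y‖) * (2 * (1 + R ^ 2) * (1 + ‖y‖ ^ 2)) ^ k := by gcongr
      _ = _ := by rw [mul_pow]; ring
  rcases le_total ‖z‖ R with hz | hz
  · apply main
    have : ‖z‖ ^ 2 ≤ R ^ 2 := by gcongr
    nlinarith [sq_nonneg ‖y‖, mul_nonneg (sq_nonneg R) (sq_nonneg ‖y‖)]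
  · rcases le_total ‖z + y‖ R with hw | hw
    · apply main
      have e : ‖z‖ ≤ R + ‖y‖ := by
        have := norm_sub_le (z + y) y
        rw [add_sub_cancel_right] at this
        linarith
      have : ‖z‖ ^ 2 ≤ (R + ‖y‖) ^ 2 := by gcongr
      nlinarith [sq_nonneg (R - ‖y‖), mul_nonneg (sq_nonneg R) (sq_nonneg ‖y‖)]
    · rw [h2 z hz, h2 _ hw, sub_zero, norm_zero, zero_mul]
      positivity

end CompHolder

/-! ### Families with rapid weighted decay, and how the operations act on them. -/

/-- Families of continuous functions that, with the Gaussian factor `exp (-|z|²/(2ε))`, decay faster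
than any power of `|z|`, with constants of the order of `p ε` as `ε` tends to `0`. -/
def Decays (p : ℝ → ℝ) (g : ℝ → ℂ → ℂ) : Prop :=
  (∀ᶠ ε in 𝓝[>] (0 : ℝ), Continuous (g ε)) ∧
    ∀ k : ℕ, ∃ M : ℝ, ∀ᶠ ε in 𝓝[>] (0 : ℝ), ∀ z,
      gauss ε z * ‖g ε z‖ * (1 + ‖z‖ ^ 2) ^ k ≤ M * p ε

/-- Families of continuous functions that, with the Gaussian factor `exp (-|z|²/(2ε))`, are
uniformly bounded as `ε` tends to `0`. -/
def UnifBdd (g : ℝ → ℂ → ℂ) : Prop :=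
  (∀ᶠ ε in 𝓝[>] (0 : ℝ), Continuous (g ε)) ∧
    ∃ M : ℝ, ∀ᶠ ε in 𝓝[>] (0 : ℝ), ∀ z, gauss ε z * ‖g ε z‖ ≤ M

theorem eventually_pos_le_one : ∀ᶠ ε in 𝓝[>] (0 : ℝ), 0 < ε ∧ ε ≤ 1 :=
  (Ioc_mem_nhdsGT one_pos : Set.Ioc (0 : ℝ) 1 ∈ 𝓝[>] (0 : ℝ))

namespace Decays

variable {p q : ℝ → ℝ} {g h : ℝ → ℂ → ℂ}

theorem congr (hg : Decays p g) (e : ∀ᶠ ε in 𝓝[>] (0 : ℝ), ∀ z, g ε z = h ε z) : Decays p h := by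
  refine ⟨?_, fun k => ?_⟩
  · filter_upwards [hg.1, e] with ε h1 h2
    rwa [show h ε = g ε from funext fun z => (h2 z).symm]
  · obtain ⟨M, hM⟩ := hg.2 k
    refine ⟨M, ?_⟩
    filter_upwards [hM, e] with ε h1 h2 z
    rw [← h2]
    exact h1 z

theorem add (hg : Decays p g) (hh : Decays p h) : Decays p (fun ε z => g ε z + h ε z) := by
  refine ⟨?_, fun k => ?_⟩
  · filter_upwards [hg.1, hh.1] with ε h1 h2 using h1.add h2
  · obtain ⟨M, hM⟩ := hg.2 k
    obtain ⟨N, hN⟩ := hh.2 k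
    refine ⟨M + N, ?_⟩
    filter_upwards [hM, hN] with ε h1 h2 z
    have := gauss_pos ε z
    calc gauss ε z * ‖g ε z + h ε z‖ * (1 + ‖z‖ ^ 2) ^ k
        ≤ gauss ε z * (‖g ε z‖ + ‖h ε z‖) * (1 + ‖z‖ ^ 2) ^ k := by
          gcongr
          exact norm_add_le _ _
      _ = gauss ε z * ‖g ε z‖ * (1 + ‖z‖ ^ 2) ^ k + gauss ε z * ‖h ε z‖ * (1 + ‖z‖ ^ 2) ^ k := by
          ring
      _ ≤ (M + N) * p ε := by
          rw [add_mul]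
          exact add_le_add (h1 z) (h2 z)

theorem mul_coeff {r : ℝ → ℝ} {c : ℝ → ℂ} (hg : Decays p g)
    (hc : ∃ C : ℝ, ∀ᶠ ε in 𝓝[>] (0 : ℝ), ‖c ε‖ ≤ C * r ε) :
    Decays (fun ε => r ε * p ε) (fun ε z => c ε * g ε z) := by
  obtain ⟨C, hC⟩ := hc
  refine ⟨?_, fun k => ?_⟩
  · filter_upwards [hg.1] with ε h1 using continuous_const.mul h1
  · obtain ⟨M, hM⟩ := hg.2 k
    refine ⟨C * M, ?_⟩
    filter_upwards [hM, hC] with ε h1 h2 z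
    have := gauss_pos ε z
    calc gauss ε z * ‖c ε * g ε z‖ * (1 + ‖z‖ ^ 2) ^ k
        = ‖c ε‖ * (gauss ε z * ‖g ε z‖ * (1 + ‖z‖ ^ 2) ^ k) := by
          rw [norm_mul]
          ring
      _ ≤ (C * r ε) * (M * p ε) :=
          mul_le_mul h2 (h1 z) (by positivity) ((norm_nonneg _).trans h2)
      _ = _ := by ring

theorem const_mul (c : ℂ) (hg : Decays p g) : Decays p (fun ε z => c * g ε z) := by
  have := hg.mul_coeff (r := fun _ => 1) (c := fun _ => c)
    ⟨‖c‖, Eventually.of_forall fun ε => by simp⟩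
  simpa using this

theorem sub (hg : Decays p g) (hh : Decays p h) : Decays p (fun ε z => g ε z - h ε z) :=
  (hg.add (hh.const_mul (-1))).congr (Eventually.of_forall fun ε z => by ring)

theorem mono (hg : Decays p g) (hp : ∀ᶠ ε in 𝓝[>] (0 : ℝ), 0 ≤ p ε ∧ p ε ≤ q ε) :
    Decays q g := by
  refine ⟨hg.1, fun k => ?_⟩
  obtain ⟨M, hM⟩ := hg.2 k
  refine ⟨|M|, ?_⟩
  filter_upwards [hM, hp] with ε h1 h2 z
  calc _ ≤ M * p ε := h1 z
    _ ≤ |M| * q ε := mul_le_mul (le_abs_self _) h2.2 h2.1 (abs_nonneg _)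

theorem norm_sq_mul (hg : Decays p g) : Decays p (fun ε z => (‖z‖ : ℂ) ^ 2 * g ε z) := by
  refine ⟨?_, fun k => ?_⟩
  · filter_upwards [hg.1] with ε h1
    exact Continuous.mul (by fun_prop) h1
  · obtain ⟨M, hM⟩ := hg.2 (k + 1)
    refine ⟨M, ?_⟩
    filter_upwards [hM] with ε h1 z
    have := gauss_pos ε z
    refine le_trans ?_ (h1 z)
    rw [norm_mul, norm_pow, Complex.norm_real, norm_norm]
    calc gauss ε z * (‖z‖ ^ 2 * ‖g ε z‖) * (1 + ‖z‖ ^ 2) ^ k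
        = gauss ε z * ‖g ε z‖ * ((1 + ‖z‖ ^ 2) ^ k * ‖z‖ ^ 2) := by ring
      _ ≤ gauss ε z * ‖g ε z‖ * ((1 + ‖z‖ ^ 2) ^ k * (1 + ‖z‖ ^ 2)) := by
          gcongr
          linarith
      _ = _ := by rw [pow_succ (1 + ‖z‖ ^ 2) k]

/-- The uniform bound contained in the decay estimates. -/
theorem exists_bound (hg : Decays p g) :
    ∃ M : ℝ, ∀ᶠ ε in 𝓝[>] (0 : ℝ), ∀ z, gauss ε z * ‖g ε z‖ ≤ M * p ε := by
  obtain ⟨M, hM⟩ := hg.2 0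
  refine ⟨M, ?_⟩
  filter_upwards [hM] with ε h1 z
  simpa using h1 z

/-- Polynomial weights pass through a Gaussian convolution: moving from `z` to `z + √ε y` costs a
power of `1 + |y|²`, which the Gaussian absorbs. -/
theorem szego (hg : Decays p g) : Decays p (fun ε => szego ε (g ε)) := by
  refine ⟨?_, fun k => ?_⟩
  · obtain ⟨M, hM⟩ := hg.exists_bound
    filter_upwards [hg.1, hM, eventually_pos_le_one] with ε h1 h2 h3
    exact (differentiable_szego h3.1 h1 h2).continuous
  · obtain ⟨M, hM⟩ := hg.2 k
    set I : ℝ := ∫ y : ℂ, (1 + ‖y‖ ^ 2) ^ k * Real.exp (-‖y‖ ^ 2 / 2)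
    refine ⟨1 / Real.pi * (M * 2 ^ k * I), ?_⟩
    filter_upwards [hM, eventually_pos_le_one] with ε h1 hε z
    have hz : (0 : ℝ) < 1 + ‖z‖ ^ 2 := by positivity
    have hMp : 0 ≤ M * p ε := le_trans (by have := gauss_pos ε 0; positivity) (h1 0)
    set c : ℝ := M * p ε * 2 ^ k / (1 + ‖z‖ ^ 2) ^ k
    have hH : ∀ y : ℂ, gauss ε (z + (Real.sqrt ε) • y) * ‖g ε (z + (Real.sqrt ε) • y)‖
        ≤ c * (1 + ‖y‖ ^ 2) ^ k := by
      intro y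
      set w := z + (Real.sqrt ε) • y with hw
      -- Peetre's inequality; `ε ≤ 1` lets `√ε |y|` be replaced by `|y|`.
      have hzw : 1 + ‖z‖ ^ 2 ≤ 2 * (1 + ‖y‖ ^ 2) * (1 + ‖w‖ ^ 2) := by
        have e1 : ‖z‖ ≤ ‖w‖ + ‖y‖ := by
          have e2 : z = w - (Real.sqrt ε) • y := by rw [hw]; abel
          have e3 : ‖(Real.sqrt ε) • y‖ ≤ ‖y‖ := by
            rw [norm_smul, Real.norm_of_nonneg (Real.sqrt_nonneg _)]
            have : Real.sqrt ε ≤ 1 := Real.sqrt_le_one.2 hε.2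
            nlinarith [norm_nonneg y]
          calc ‖z‖ ≤ ‖w‖ + ‖(Real.sqrt ε) • y‖ := by
                conv_lhs => rw [e2]
                exact norm_sub_le _ _
            _ ≤ _ := by gcongr
        have : ‖z‖ ^ 2 ≤ (‖w‖ + ‖y‖) ^ 2 := by gcongr
        nlinarith [sq_nonneg (‖w‖ - ‖y‖), mul_nonneg (sq_nonneg ‖w‖) (sq_nonneg ‖y‖)]
      have hwp : (0 : ℝ) < 1 + ‖w‖ ^ 2 := by positivity
      have e4 : (1 + ‖z‖ ^ 2) ^ k ≤ 2 ^ k * (1 + ‖y‖ ^ 2) ^ k * (1 + ‖w‖ ^ 2) ^ k := by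
        rw [← mul_pow, ← mul_pow]
        gcongr
      have e5 := h1 w
      have e6 : c * (1 + ‖y‖ ^ 2) ^ k
          = M * p ε * (2 ^ k * (1 + ‖y‖ ^ 2) ^ k) / (1 + ‖z‖ ^ 2) ^ k := by
        simp only [c]
        ring
      rw [e6, le_div_iff₀ (by positivity)]
      have := gauss_pos ε w
      calc gauss ε w * ‖g ε w‖ * (1 + ‖z‖ ^ 2) ^ k
          ≤ gauss ε w * ‖g ε w‖ * (2 ^ k * (1 + ‖y‖ ^ 2) ^ k * (1 + ‖w‖ ^ 2) ^ k) := by gcongr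
        _ = gauss ε w * ‖g ε w‖ * (1 + ‖w‖ ^ 2) ^ k * (2 ^ k * (1 + ‖y‖ ^ 2) ^ k) := by ring
        _ ≤ M * p ε * (2 ^ k * (1 + ‖y‖ ^ 2) ^ k) := by gcongr
    have e7 : ∀ y : ℂ, Real.exp (-‖y‖ ^ 2 / 2) * (c * (1 + ‖y‖ ^ 2) ^ k)
        = c * ((1 + ‖y‖ ^ 2) ^ k * Real.exp (-‖y‖ ^ 2 / 2)) := fun y => by ring
    have key := gauss_mul_norm_szego_le hε.1 z (g ε) _ hH (by
      simp only [e7]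
      exact (integrable_pow_mul_gaussian k).const_mul c)
    simp only [e7] at key
    rw [integral_const_mul] at key
    calc gauss ε z * ‖LLL.szego ε (g ε) z‖ * (1 + ‖z‖ ^ 2) ^ k
        ≤ 1 / Real.pi * (c * I) * (1 + ‖z‖ ^ 2) ^ k := by gcongr
      _ = 1 / Real.pi * (M * 2 ^ k * I) * p ε := by
          simp only [c]
          field_simp

/-- The cubic nonlinearity is Lipschitz for the decay bounds. -/
theorem cubic_sub (hg : Decays (fun _ => 1) g) (hh : Decays (fun _ => 1) h)
    (hgh : Decays q (fun ε z => g ε z - h ε z)) :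
    Decays q (fun ε z => (Real.exp (-‖z‖ ^ 2 / ε) : ℂ) * (‖g ε z‖ ^ 2 : ℂ) * g ε z
      - (Real.exp (-‖z‖ ^ 2 / ε) : ℂ) * (‖h ε z‖ ^ 2 : ℂ) * h ε z) := by
  refine ⟨?_, fun k => ?_⟩
  · filter_upwards [hg.1, hh.1] with ε h1 h2
    fun_prop
  · obtain ⟨A, hA⟩ := hg.exists_bound
    obtain ⟨B, hB⟩ := hh.exists_bound
    obtain ⟨M, hM⟩ := hgh.2 k
    refine ⟨(A ^ 2 + (A + B) * B) * M, ?_⟩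
    filter_upwards [hA, hB, hM] with ε h1 h2 h3 z
    have hγ := gauss_pos ε z
    have ha := h1 z
    have hb := h2 z
    rw [mul_one] at ha hb
    have e1 : |‖g ε z‖ - ‖h ε z‖| ≤ ‖g ε z - h ε z‖ := abs_norm_sub_norm_le _ _
    have e2 : ‖(‖g ε z‖ ^ 2 : ℂ) * g ε z - (‖h ε z‖ ^ 2 : ℂ) * h ε z‖
        ≤ (‖g ε z‖ ^ 2 + (‖g ε z‖ + ‖h ε z‖) * ‖h ε z‖) * ‖g ε z - h ε z‖ := by
      have e3 : (‖g ε z‖ ^ 2 : ℂ) * g ε z - (‖h ε z‖ ^ 2 : ℂ) * h ε z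
          = (‖g ε z‖ ^ 2 : ℝ) * (g ε z - h ε z)
            + (((‖g ε z‖ + ‖h ε z‖) * (‖g ε z‖ - ‖h ε z‖) : ℝ) : ℂ) * h ε z := by
        push_cast
        ring
      rw [e3]
      refine (norm_add_le _ _).trans ?_
      rw [norm_mul, norm_mul, Complex.norm_real, Complex.norm_real, Real.norm_eq_abs,
        Real.norm_eq_abs, abs_mul, abs_of_nonneg (by positivity : 0 ≤ ‖g ε z‖ ^ 2),
        abs_of_nonneg (by positivity : 0 ≤ ‖g ε z‖ + ‖h ε z‖)]
      have : (‖g ε z‖ + ‖h ε z‖) * |‖g ε z‖ - ‖h ε z‖| * ‖h ε z‖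
          ≤ (‖g ε z‖ + ‖h ε z‖) * ‖g ε z - h ε z‖ * ‖h ε z‖ := by gcongr
      linarith
    have e4 : (Real.exp (-‖z‖ ^ 2 / ε) : ℂ) * (‖g ε z‖ ^ 2 : ℂ) * g ε z
        - (Real.exp (-‖z‖ ^ 2 / ε) : ℂ) * (‖h ε z‖ ^ 2 : ℂ) * h ε z
        = ((gauss ε z ^ 2 : ℝ) : ℂ) *
          ((‖g ε z‖ ^ 2 : ℂ) * g ε z - (‖h ε z‖ ^ 2 : ℂ) * h ε z) := by
      rw [gauss_sq]
      ring
    rw [e4, norm_mul, Complex.norm_real, Real.norm_of_nonneg (by positivity)]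
    have hA0 : 0 ≤ A := le_trans (by positivity) ha
    have hB0 : 0 ≤ B := le_trans (by positivity) hb
    calc gauss ε z * (gauss ε z ^ 2 * ‖(‖g ε z‖ ^ 2 : ℂ) * g ε z - (‖h ε z‖ ^ 2 : ℂ) * h ε z‖) *
          (1 + ‖z‖ ^ 2) ^ k
        ≤ gauss ε z * (gauss ε z ^ 2 * ((‖g ε z‖ ^ 2 + (‖g ε z‖ + ‖h ε z‖) * ‖h ε z‖) *
          ‖g ε z - h ε z‖)) * (1 + ‖z‖ ^ 2) ^ k := by gcongr
      _ = ((gauss ε z * ‖g ε z‖) ^ 2 + (gauss ε z * ‖g ε z‖ + gauss ε z * ‖h ε z‖) *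
          (gauss ε z * ‖h ε z‖)) * (gauss ε z * ‖g ε z - h ε z‖ * (1 + ‖z‖ ^ 2) ^ k) := by ring
      _ ≤ (A ^ 2 + (A + B) * B) *
          (gauss ε z * ‖g ε z - h ε z‖ * (1 + ‖z‖ ^ 2) ^ k) := by gcongr
      _ ≤ (A ^ 2 + (A + B) * B) * (M * q ε) :=
          mul_le_mul_of_nonneg_left (h3 z) (by positivity)
      _ = _ := by ring

end Decays

theorem CompHolder.decays_mul {φ : ℂ → ℂ} {g : ℝ → ℂ → ℂ} (hφ : CompHolder φ) (hg : UnifBdd g) :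
    Decays (fun _ => 1) (fun ε z => φ z * g ε z) := by
  refine ⟨?_, fun k => ?_⟩
  · filter_upwards [hg.1] with ε h1 using hφ.continuous.mul h1
  · obtain ⟨B, hB, hBφ⟩ := hφ.bounded
    obtain ⟨K, R, hK, hR, h1, h2⟩ := hφ
    obtain ⟨M, hM⟩ := hg.2
    refine ⟨B * M * (1 + R ^ 2) ^ k, ?_⟩
    filter_upwards [hM] with ε h3 z
    have hγ := gauss_pos ε z
    have hM0 : 0 ≤ M := le_trans (by positivity) (h3 z)
    rw [mul_one]
    rcases le_total R ‖z‖ with hz | hz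
    · rw [h2 z hz, zero_mul, norm_zero, mul_zero, zero_mul]
      positivity
    · rw [norm_mul]
      calc gauss ε z * (‖φ z‖ * ‖g ε z‖) * (1 + ‖z‖ ^ 2) ^ k
          = ‖φ z‖ * (gauss ε z * ‖g ε z‖) * (1 + ‖z‖ ^ 2) ^ k := by ring
        _ ≤ B * M * (1 + R ^ 2) ^ k := by
            gcongr
            exacts [hBφ z, h3 z]

/-- The commutator at `z` is the projection of `(φ - φ(z)) g`. In the rescaled variable the
increment of `φ` is at most a constant times `√(√ε |y|)`, whence the power `ε^(1/4)`; compact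
support supplies the polynomial weights. -/
theorem CompHolder.szego_commutator {φ : ℂ → ℂ} {g : ℝ → ℂ → ℂ} (hφ : CompHolder φ)
    (hg : UnifBdd g) : Decays (fun ε => ε ^ (1 / 4 : ℝ))
      (fun ε z => szego ε (fun w => φ w * g ε w) z - φ z * szego ε (g ε) z) := by
  obtain ⟨B, hB, hBφ⟩ := hφ.bounded
  obtain ⟨hgc, M, hM⟩ := hg
  refine ⟨?_, fun k => ?_⟩
  · obtain ⟨N, hN⟩ := (hφ.decays_mul ⟨hgc, M, hM⟩).exists_bound
    filter_upwards [hgc, hM, hN, eventually_pos_le_one] with ε h1 h2 h3 hε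
    exact (differentiable_szego hε.1 (hφ.continuous.mul h1) h3).continuous.sub
      (hφ.continuous.mul (differentiable_szego hε.1 h1 h2).continuous)
  · obtain ⟨C, hC, hinc⟩ := hφ.weighted_increment k
    set I : ℝ := ∫ y : ℂ, (1 + ‖y‖ ^ 2) ^ (k + 1) * Real.exp (-‖y‖ ^ 2 / 2)
    refine ⟨1 / Real.pi * (C * M * I), ?_⟩
    filter_upwards [hgc, hM, eventually_pos_le_one] with ε h1 h2 hε z
    have hM0 : 0 ≤ M := le_trans (by have := gauss_pos ε 0; positivity) (h2 0)
    have hz : (0 : ℝ) < 1 + ‖z‖ ^ 2 := by positivity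
    have e0 : szego ε (fun w => φ w * g ε w) z - φ z * szego ε (g ε) z
        = szego ε (fun w => (φ w - φ z) * g ε w) z := by
      have e1 : ∀ w, gauss ε w * ‖φ w * g ε w‖ ≤ B * M := by
        intro w
        rw [norm_mul]
        have := gauss_pos ε w
        calc gauss ε w * (‖φ w‖ * ‖g ε w‖) = ‖φ w‖ * (gauss ε w * ‖g ε w‖) := by ring
          _ ≤ B * M := by
            gcongr
            exacts [hBφ w, h2 w]
      have e2 : ∀ w, gauss ε w * ‖φ z * g ε w‖ ≤ B * M := by
        intro w
        rw [norm_mul]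
        have := gauss_pos ε w
        calc gauss ε w * (‖φ z‖ * ‖g ε w‖) = ‖φ z‖ * (gauss ε w * ‖g ε w‖) := by ring
          _ ≤ B * M := by
            gcongr
            exacts [hBφ z, h2 w]
      have e3 := szego_sub hε.1 (g := fun w => φ w * g ε w) (h := fun w => φ z * g ε w)
        (hφ.continuous.mul h1) (continuous_const.mul h1) e1 e2 z
      rw [← szego_const_mul, ← e3]
      congr 1
      ext w
      ring
    rw [e0]
    set δ : ℝ := ε ^ (1 / 4 : ℝ) with hδ
    have hδ0 : 0 ≤ δ := Real.rpow_nonneg hε.1.le _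
    have hs1 : Real.sqrt ε ≤ 1 := Real.sqrt_le_one.2 hε.2
    have hsδ : √(Real.sqrt ε) = δ := by
      rw [Real.sqrt_eq_rpow, Real.sqrt_eq_rpow, ← Real.rpow_mul hε.1.le, hδ]
      norm_num
    set c : ℝ := C * δ * M / (1 + ‖z‖ ^ 2) ^ k
    have hH : ∀ y : ℂ, gauss ε (z + (Real.sqrt ε) • y) *
        ‖(φ (z + (Real.sqrt ε) • y) - φ z) * g ε (z + (Real.sqrt ε) • y)‖
        ≤ c * (1 + ‖y‖ ^ 2) ^ (k + 1) := by
      intro y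
      have e3 := hinc z ((Real.sqrt ε) • y)
      have hn : ‖(Real.sqrt ε) • y‖ = Real.sqrt ε * ‖y‖ := by
        rw [norm_smul, Real.norm_of_nonneg (Real.sqrt_nonneg _)]
      rw [hn, Real.sqrt_mul (Real.sqrt_nonneg _), hsδ] at e3
      have e4 : √‖y‖ ≤ 1 + ‖y‖ ^ 2 := by
        rw [Real.sqrt_le_left (by positivity)]
        nlinarith [sq_nonneg (‖y‖ - 1), sq_nonneg (‖y‖ ^ 2), norm_nonneg y]
      have e5 : 1 + (Real.sqrt ε * ‖y‖) ^ 2 ≤ 1 + ‖y‖ ^ 2 := by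
        have : Real.sqrt ε * ‖y‖ ≤ ‖y‖ := by nlinarith [norm_nonneg y]
        gcongr
      have e6 : ‖φ (z + (Real.sqrt ε) • y) - φ z‖ * (1 + ‖z‖ ^ 2) ^ k
          ≤ C * (δ * (1 + ‖y‖ ^ 2)) * (1 + ‖y‖ ^ 2) ^ k := by
        refine e3.trans ?_
        gcongr
      have e7 : c * (1 + ‖y‖ ^ 2) ^ (k + 1)
          = C * (δ * (1 + ‖y‖ ^ 2)) * (1 + ‖y‖ ^ 2) ^ k * M / (1 + ‖z‖ ^ 2) ^ k := by
        simp only [c]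
        ring
      rw [e7, le_div_iff₀ (by positivity), norm_mul]
      set w := z + (Real.sqrt ε) • y
      have := gauss_pos ε w
      calc gauss ε w * (‖φ w - φ z‖ * ‖g ε w‖) * (1 + ‖z‖ ^ 2) ^ k
          = ‖φ w - φ z‖ * (1 + ‖z‖ ^ 2) ^ k * (gauss ε w * ‖g ε w‖) := by ring
        _ ≤ C * (δ * (1 + ‖y‖ ^ 2)) * (1 + ‖y‖ ^ 2) ^ k * M := by
            gcongr
            exact h2 w
    have e8 : ∀ y : ℂ, Real.exp (-‖y‖ ^ 2 / 2) * (c * (1 + ‖y‖ ^ 2) ^ (k + 1))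
        = c * ((1 + ‖y‖ ^ 2) ^ (k + 1) * Real.exp (-‖y‖ ^ 2 / 2)) := fun y => by ring
    have key := gauss_mul_norm_szego_le hε.1 z (fun w => (φ w - φ z) * g ε w) _ hH (by
      simp only [e8]
      exact (integrable_pow_mul_gaussian (k + 1)).const_mul c)
    simp only [e8] at key
    rw [integral_const_mul] at key
    calc gauss ε z * ‖szego ε (fun w => (φ w - φ z) * g ε w) z‖ * (1 + ‖z‖ ^ 2) ^ k
        ≤ 1 / Real.pi * (c * I) * (1 + ‖z‖ ^ 2) ^ k := by gcongr
      _ = 1 / Real.pi * (C * M * I) * δ := by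
          simp only [c]
          field_simp

/-! ### Integrals and Fock norms of decaying families. -/

namespace Decays

variable {p q : ℝ → ℝ} {g h : ℝ → ℂ → ℂ} {W : ℂ → ℝ} {C : ℝ} {j : ℕ}

theorem integrable_mul_pow (hg : Decays p g) (hW : Continuous W)
    (hWb : ∀ z, |W z| ≤ C * (1 + ‖z‖ ^ 2) ^ j) (n : ℕ) :
    ∀ᶠ ε in 𝓝[>] (0 : ℝ), Integrable (fun z => W z * (gauss ε z * ‖g ε z‖) ^ (n + 1)) := by
  obtain ⟨A, hA⟩ := hg.exists_bound
  -- `j` powers absorb the growth of `W` and two give integrability. One factor carries the decay;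
  -- the other `n` are only bounded.
  obtain ⟨M, hM⟩ := hg.2 (j + 2)
  filter_upwards [hg.1, hA, hM] with ε h1 h2 h3
  have hgc := continuous_gauss ε
  refine (integrable_inv_one_add_norm_sq_sq.const_mul (C * (A * p ε) ^ n * (M * p ε))).mono'
    (hW.mul ((hgc.mul h1.norm).pow _)).aestronglyMeasurable (Eventually.of_forall fun z => ?_)
  have hγ := gauss_pos ε z
  have hA0 : 0 ≤ A * p ε := le_trans (by positivity) (h2 z)
  have hW0 : 0 ≤ C * (1 + ‖z‖ ^ 2) ^ j := (abs_nonneg _).trans (hWb z)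
  have hC0 : 0 ≤ C := nonneg_of_mul_nonneg_left hW0 (by positivity)
  have h2z := h2 z
  generalize A * p ε = X at *
  rw [norm_mul, Real.norm_eq_abs, norm_pow, norm_mul, norm_norm, Real.norm_of_nonneg hγ.le,
    ← div_eq_mul_inv, le_div_iff₀ (by positivity)]
  calc |W z| * (gauss ε z * ‖g ε z‖) ^ (n + 1) * (1 + ‖z‖ ^ 2) ^ 2
      ≤ (C * (1 + ‖z‖ ^ 2) ^ j) * (X ^ n * (gauss ε z * ‖g ε z‖)) *
        (1 + ‖z‖ ^ 2) ^ 2 := by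
        rw [pow_succ]
        gcongr
        exact hWb z
    _ = C * X ^ n * (gauss ε z * ‖g ε z‖ * (1 + ‖z‖ ^ 2) ^ (j + 2)) := by ring
    _ ≤ C * X ^ n * (M * p ε) := mul_le_mul_of_nonneg_left (h3 z) (by positivity)

/-- Replaces a family by its leading profile inside weighted integrals, through `|a^(n+1) - b^(n+1)|
≤ (n+1) max(|a|,|b|)^n |a - b|`. -/
theorem integral_mul_pow_sub (hg : Decays (fun _ => 1) g) (hh : Decays (fun _ => 1) h)
    (hgh : Decays q (fun ε z => g ε z - h ε z)) (hW : Continuous W)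
    (hWb : ∀ z, |W z| ≤ C * (1 + ‖z‖ ^ 2) ^ j) (n : ℕ) :
    ∃ D : ℝ, ∀ᶠ ε in 𝓝[>] (0 : ℝ),
      |(∫ z, W z * (gauss ε z * ‖g ε z‖) ^ (n + 1)) - ∫ z, W z * (gauss ε z * ‖h ε z‖) ^ (n + 1)|
        ≤ D * q ε := by
  obtain ⟨A, hA⟩ := hg.exists_bound
  obtain ⟨B, hB⟩ := hh.exists_bound
  obtain ⟨M, hM⟩ := hgh.2 (j + 2)
  set I : ℝ := ∫ y : ℂ, ((1 + ‖y‖ ^ 2) ^ 2)⁻¹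
  refine ⟨C * (n + 1 : ℕ) * (max A B) ^ n * M * I, ?_⟩
  filter_upwards [hg.integrable_mul_pow hW hWb n, hh.integrable_mul_pow hW hWb n, hA, hB, hM]
    with ε h1 h2 h3 h4 h5
  rw [← integral_sub h1 h2, ← Real.norm_eq_abs]
  have hb : ∀ z, ‖W z * (gauss ε z * ‖g ε z‖) ^ (n + 1) - W z * (gauss ε z * ‖h ε z‖) ^ (n + 1)‖
      ≤ C * (n + 1 : ℕ) * (max A B) ^ n * M * q ε * ((1 + ‖z‖ ^ 2) ^ 2)⁻¹ := by
    intro z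
    have hγ := gauss_pos ε z
    have ha := h3 z
    have hb := h4 z
    rw [mul_one] at ha hb
    have hA0 : 0 ≤ A := le_trans (by positivity) ha
    have hW0 : 0 ≤ C * (1 + ‖z‖ ^ 2) ^ j := (abs_nonneg _).trans (hWb z)
    have hC0 : 0 ≤ C := nonneg_of_mul_nonneg_left hW0 (by positivity)
    have hAB : 0 ≤ max A B := le_max_of_le_left hA0
    have e1 := abs_pow_sub_pow_le (gauss ε z * ‖g ε z‖) (gauss ε z * ‖h ε z‖) (n + 1)
    rw [Nat.add_sub_cancel] at e1
    have e2 : |gauss ε z * ‖g ε z‖ - gauss ε z * ‖h ε z‖| ≤ gauss ε z * ‖g ε z - h ε z‖ := by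
      rw [← mul_sub, abs_mul, abs_of_pos hγ]
      gcongr
      exact abs_norm_sub_norm_le _ _
    have e3 : max |gauss ε z * ‖g ε z‖| |gauss ε z * ‖h ε z‖| ≤ max A B := by
      rw [abs_of_nonneg (by positivity), abs_of_nonneg (by positivity)]
      exact max_le_max ha hb
    rw [← mul_sub, norm_mul, Real.norm_eq_abs, Real.norm_eq_abs, ← div_eq_mul_inv,
      le_div_iff₀ (by positivity)]
    calc |W z| * |(gauss ε z * ‖g ε z‖) ^ (n + 1) - (gauss ε z * ‖h ε z‖) ^ (n + 1)| *
          (1 + ‖z‖ ^ 2) ^ 2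
        ≤ (C * (1 + ‖z‖ ^ 2) ^ j) * (gauss ε z * ‖g ε z - h ε z‖ * (n + 1 : ℕ) *
          (max A B) ^ n) * (1 + ‖z‖ ^ 2) ^ 2 := by
          gcongr
          · exact hWb z
          · refine e1.trans ?_
            gcongr
      _ = C * (n + 1 : ℕ) * (max A B) ^ n *
          (gauss ε z * ‖g ε z - h ε z‖ * (1 + ‖z‖ ^ 2) ^ (j + 2)) := by ring
      _ ≤ C * (n + 1 : ℕ) * (max A B) ^ n * (M * q ε) :=
          mul_le_mul_of_nonneg_left (h5 z) (by positivity)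
      _ = _ := by ring
  refine (norm_integral_le_of_norm_le (integrable_inv_one_add_norm_sq_sq.const_mul _)
    (Eventually.of_forall hb)).trans_eq ?_
  rw [integral_const_mul]
  ring

end Decays

theorem fockDensity_natCast (ε : ℝ) (m : ℕ) (f : ℂ → ℂ) (z : ℂ) :
    fockDensity ε m f z = (1 + ‖z‖ ^ 2) ^ m * (gauss ε z * ‖f z‖) ^ 2 := by
  rw [fockDensity, Real.rpow_natCast, ← gauss_sq]
  ring

theorem fockDensity_zero (ε : ℝ) (f : ℂ → ℂ) (z : ℂ) :
    fockDensity ε 0 f z = (gauss ε z * ‖f z‖) ^ 2 := by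
  simpa using fockDensity_natCast ε 0 f z

namespace Decays

variable {p : ℝ → ℝ} {g : ℝ → ℂ → ℂ}

theorem integrable_fockDensity (hg : Decays p g) (m : ℕ) :
    ∀ᶠ ε in 𝓝[>] (0 : ℝ), Integrable (fockDensity ε m (g ε)) := by
  have h := hg.integrable_mul_pow (W := fun z => (1 + ‖z‖ ^ 2) ^ m) (C := 1) (j := m)
    (by fun_prop) (fun z => by rw [one_mul, abs_of_nonneg (by positivity)]) 1
  filter_upwards [h] with ε hε
  refine hε.congr (Eventually.of_forall fun z => ?_)
  simp only [fockDensity_natCast]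

theorem fockNorm_le (hg : Decays p g) (hp : ∀ᶠ ε in 𝓝[>] (0 : ℝ), 0 ≤ p ε) :
    ∃ C : ℝ, ∀ᶠ ε in 𝓝[>] (0 : ℝ), fockNorm ε 0 (g ε) ≤ C * p ε := by
  -- One power of the weight is enough, since the density is quadratic.
  obtain ⟨M, hM⟩ := hg.2 1
  set I : ℝ := ∫ y : ℂ, ((1 + ‖y‖ ^ 2) ^ 2)⁻¹
  have hI : 0 ≤ I := integral_nonneg fun y => by positivity
  refine ⟨|M| * √I, ?_⟩
  filter_upwards [hM, hp] with ε h1 h2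
  have e : ∫ z, fockDensity ε 0 (g ε) z ≤ (|M| * p ε) ^ 2 * I := by
    rw [← integral_const_mul]
    refine integral_mono_of_nonneg (Eventually.of_forall fun z => ?_)
      (integrable_inv_one_add_norm_sq_sq.const_mul _) (Eventually.of_forall fun z => ?_)
    · simp only [fockDensity_zero, Pi.zero_apply]
      positivity
    · simp only [fockDensity_zero]
      rw [← div_eq_mul_inv, le_div_iff₀ (by positivity), ← mul_pow]
      have hγ := gauss_pos ε z
      have h3 := h1 z
      rw [pow_one] at h3
      have : M * p ε ≤ |M| * p ε := by gcongr; exact le_abs_self M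
      exact pow_le_pow_left₀ (by positivity) (h3.trans this) 2
  rw [fockNorm]
  refine (Real.sqrt_le_sqrt e).trans_eq ?_
  rw [Real.sqrt_mul (by positivity), Real.sqrt_sq (by positivity)]
  ring

end Decays

/-! ### Averaging of periodic weights -/

section Averaging

variable {φ : ℂ → ℂ}

/-- The cap `L` on `‖ω‖` makes the constant uniform over all periods at scales `ε ≤ 1`. -/
theorem CompHolder.integral_translate_sub_le (hφ : CompHolder φ) (L : ℝ) :
    ∃ C : ℝ, 0 ≤ C ∧ ∀ ω : ℂ, ‖ω‖ ≤ L → ∀ (B : ℝ) (P : ℂ → ℝ), (∀ z, |P z| ≤ B) →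
      ∀ s ∈ Set.Icc (0 : ℝ) 1,
      ‖∫ z, (φ (z + s * ω) - φ z) * (P (z + s * ω) : ℂ)‖ ≤ C * B * √‖ω‖ := by
  obtain ⟨C, hC, h⟩ := hφ.weighted_increment 2
  set I : ℝ := ∫ y : ℂ, ((1 + ‖y‖ ^ 2) ^ 2)⁻¹
  have hI : 0 ≤ I := integral_nonneg fun y => by positivity
  refine ⟨C * (1 + L ^ 2) ^ 2 * I, by positivity, fun ω hω B P hP s hs => ?_⟩
  have hB : 0 ≤ B := (abs_nonneg _).trans (hP 0)
  have hsω : ‖(s : ℂ) * ω‖ ≤ ‖ω‖ := by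
    rw [norm_mul, Complex.norm_real, Real.norm_of_nonneg hs.1]
    nlinarith [norm_nonneg ω, hs.2]
  refine (norm_integral_le_of_norm_le (integrable_inv_one_add_norm_sq_sq.const_mul
    (C * √‖ω‖ * (1 + L ^ 2) ^ 2 * B)) (Eventually.of_forall fun z => ?_)).trans_eq ?_
  · rw [norm_mul, Complex.norm_real, Real.norm_eq_abs, ← div_eq_mul_inv,
      le_div_iff₀ (by positivity)]
    calc ‖φ (z + s * ω) - φ z‖ * |P (z + s * ω)| * (1 + ‖z‖ ^ 2) ^ 2
        = ‖φ (z + s * ω) - φ z‖ * (1 + ‖z‖ ^ 2) ^ 2 * |P (z + s * ω)| := by ring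
      _ ≤ (C * √‖(s : ℂ) * ω‖ * (1 + ‖(s : ℂ) * ω‖ ^ 2) ^ 2) * B := by
          gcongr ?_ * ?_
          exacts [h z _, hP _]
      _ ≤ _ := by
          gcongr
          exact hsω.trans hω
  · rw [integral_const_mul]
    ring

/-- The average of `P` along the segment `[z, z + ω]`. -/
noncomputable def segAverage (ω : ℂ) (P : ℂ → ℝ) (z : ℂ) : ℝ := ∫ s in (0 : ℝ)..1, P (z + s * ω)

theorem continuous_segAverage (ω : ℂ) {P : ℂ → ℝ} (hP : Continuous P) :
    Continuous (segAverage ω P) := by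
  unfold segAverage
  exact intervalIntegral.continuous_parametric_intervalIntegral_of_continuous'
    (by fun_prop) _ _

theorem abs_segAverage_le (ω : ℂ) {P : ℂ → ℝ} {B : ℝ} (hP : ∀ z, |P z| ≤ B) (z : ℂ) :
    |segAverage ω P z| ≤ B := by
  have := intervalIntegral.norm_integral_le_of_norm_le_const (a := 0) (b := 1) (C := B)
    (f := fun s : ℝ => P (z + s * ω)) (fun s _ => hP _)
  simpa [segAverage] using this

/-- By translation invariance `∫ φ P` is the integral of the translates of both factors, so
averaging `P` along a segment costs only increments of `φ`. Periodicity plays no role yet. -/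
theorem CompHolder.integral_sub_segAverage_le (hφ : CompHolder φ) (L : ℝ) :
    ∃ C : ℝ, 0 ≤ C ∧ ∀ ω : ℂ, ‖ω‖ ≤ L → ∀ (B : ℝ) (P : ℂ → ℝ), Continuous P → (∀ z, |P z| ≤ B) →
      ‖(∫ z, φ z * (P z : ℂ)) - ∫ z, φ z * (segAverage ω P z : ℂ)‖ ≤ C * B * √‖ω‖ := by
  obtain ⟨C, hC, h⟩ := hφ.integral_translate_sub_le L
  refine ⟨C, hC, fun ω hω B P hPc hP => ?_⟩
  have hφc := hφ.continuous
  have hB : 0 ≤ B := (abs_nonneg _).trans (hP 0)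
  have hint : ∀ (χ : ℂ → ℂ), Integrable χ → ∀ s : ℝ,
      Integrable (fun z => χ z * (P (z + s * ω) : ℂ)) := by
    intro χ hχ s
    refine hχ.mul_bdd (c := B) (Continuous.aestronglyMeasurable (by fun_prop))
      (Eventually.of_forall fun z => ?_)
    rw [Complex.norm_real]
    exact hP _
  have hswap : ∫ z, φ z * (segAverage ω P z : ℂ)
      = ∫ s in (0 : ℝ)..1, ∫ z, φ z * (P (z + s * ω) : ℂ) := by
    have e1 : ∀ z, φ z * (segAverage ω P z : ℂ)
        = ∫ s in Set.Ioc (0 : ℝ) 1, φ z * (P (z + s * ω) : ℂ) := by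
      intro z
      rw [segAverage, ← intervalIntegral.integral_ofReal, ← intervalIntegral.integral_const_mul,
        intervalIntegral.integral_of_le zero_le_one]
    simp only [e1]
    rw [intervalIntegral.integral_of_le zero_le_one]
    refine integral_integral_swap ?_
    have h1 : Integrable (fun _ : ℝ => (1 : ℂ)) (volume.restrict (Set.Ioc (0 : ℝ) 1)) := by
      simp
    refine ((hφ.integrable.mul_prod h1).norm.const_mul B).mono'
      (Continuous.aestronglyMeasurable ?_) (Eventually.of_forall fun p => ?_)
    · simp only [Function.uncurry_def]
      fun_prop
    · simp only [Function.uncurry_def]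
      rw [norm_mul, norm_mul, norm_one, mul_one, Complex.norm_real, mul_comm]
      gcongr
      exact hP _
  have hconst : ∫ z, φ z * (P z : ℂ) = ∫ _s in (0 : ℝ)..1, ∫ z, φ z * (P z : ℂ) := by
    simp
  have hdiff : ∀ s : ℝ, (∫ z, φ z * (P z : ℂ)) - ∫ z, φ z * (P (z + s * ω) : ℂ)
      = ∫ z, (φ (z + s * ω) - φ z) * (P (z + s * ω) : ℂ) := by
    intro s
    rw [← integral_add_right_eq_self (fun z => φ z * (P z : ℂ)) ((s : ℂ) * ω),
      ← integral_sub _ (hint φ hφ.integrable s)]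
    · congr 1
      ext z
      ring
    · exact hint _ (hφ.integrable.comp_add_right _) s
  have hcont : Continuous fun s : ℝ => ∫ z, φ z * (P (z + s * ω) : ℂ) := by
    refine continuous_of_dominated (bound := fun z => ‖φ z‖ * B)
      (fun s => (hint φ hφ.integrable s).aestronglyMeasurable)
      (fun s => Eventually.of_forall fun z => ?_) (hφ.integrable.norm.mul_const B)
      (Eventually.of_forall fun z => by fun_prop)
    rw [norm_mul, Complex.norm_real]
    gcongr
    exact hP _
  rw [hswap, hconst, ← intervalIntegral.integral_sub (by simp) (hcont.intervalIntegrable _ _)]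
  simp only [hdiff]
  have := intervalIntegral.norm_integral_le_of_norm_le_const (a := 0) (b := 1)
    (C := C * B * √‖ω‖)
    (f := fun s : ℝ => ∫ z, (φ (z + s * ω) - φ z) * (P (z + s * ω) : ℂ)) (fun s hs => by
      rw [Set.uIoc_of_le zero_le_one] at hs
      exact h ω hω B P hP s ⟨hs.1.le, hs.2⟩)
  simpa using this

theorem integral_periodic_shift {E : Type*} [NormedAddCommGroup E] [NormedSpace ℝ E] {f : ℝ → E} (hf : Function.Periodic f 1) (a : ℝ) :
    ∫ s in (0 : ℝ)..1, f (a + s) = ∫ s in (0 : ℝ)..1, f s := by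
  rw [intervalIntegral.integral_comp_add_left]
  have := hf.intervalIntegral_add_eq a 0
  simpa using this

theorem exists_real_coords {τ : ℂ} (hτ : 0 < τ.im) {κ : ℝ} (hκ : κ ≠ 0) (z : ℂ) :
    ∃ a b : ℝ, z = κ * (a + b * τ) := by
  refine ⟨z.re / κ - z.im / κ / τ.im * τ.re, z.im / κ / τ.im, ?_⟩
  apply Complex.ext
  · simp
    field_simp
  · simp
    field_simp

/-- The average over the two periods is the cell average, at any base point. -/
theorem segAverage_segAverage_eq {ε : ℝ} (hε : 0 < ε) {τ : ℂ} (hτ : 0 < τ.im) {P : ℂ → ℝ}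
    (h1 : ∀ z, P (z + (√(Real.pi * ε / τ.im) : ℂ)) = P z)
    (h2 : ∀ z, P (z + (√(Real.pi * ε / τ.im) : ℂ) * τ) = P z) (z : ℂ) :
    segAverage (√(Real.pi * ε / τ.im) : ℂ) (segAverage ((√(Real.pi * ε / τ.im) : ℂ) * τ) P) z
      = cellAverage ε τ P := by
  have hpi := Real.pi_pos
  have hκ : √(Real.pi * ε / τ.im) ≠ 0 := (Real.sqrt_pos.2 (by positivity)).ne'
  obtain ⟨a, b, hab⟩ := exists_real_coords hτ hκ z
  set κ := √(Real.pi * ε / τ.im)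
  simp only [segAverage, cellAverage]
  have e1 : ∀ s : ℝ, ∫ t in (0 : ℝ)..1, P (z + s * κ + t * (κ * τ))
      = ∫ t in (0 : ℝ)..1, P (κ * (((a + s : ℝ) : ℂ) + t * τ)) := by
    intro s
    rw [← integral_periodic_shift (f := fun t : ℝ => P (κ * (((a + s : ℝ) : ℂ) + t * τ))) ?_ b]
    · congr 1
      ext t
      rw [hab]
      congr 1
      push_cast
      ring
    · intro t
      simp only
      rw [← h2 (κ * (((a + s : ℝ) : ℂ) + t * τ))]
      congr 1
      push_cast
      ring
  simp only [e1]
  refine integral_periodic_shift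
    (f := fun s : ℝ => ∫ t in (0 : ℝ)..1, P (κ * ((s : ℂ) + t * τ))) ?_ a
  intro s
  simp only
  congr 1
  ext t
  rw [← h1 (κ * ((s : ℂ) + t * τ))]
  congr 1
  push_cast
  ring

/-- Averaging along one period and then along the other turns `P` into its cell average exactly.
Each pass costs the square root of a period length, of order `ε^(1/4)`; the plane need not be cut
into cells. -/
theorem CompHolder.averaging (hφ : CompHolder φ) {τ : ℂ} (hτ : 0 < τ.im) :
    ∃ C : ℝ, ∀ (B ε : ℝ), 0 < ε → ε ≤ 1 → ∀ P : ℂ → ℝ, Continuous P → (∀ z, |P z| ≤ B) →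
      (∀ z, P (z + (√(Real.pi * ε / τ.im) : ℂ)) = P z) →
      (∀ z, P (z + (√(Real.pi * ε / τ.im) : ℂ) * τ) = P z) →
      ‖(∫ z, φ z * (P z : ℂ)) - (cellAverage ε τ P : ℂ) * ∫ z, φ z‖
        ≤ C * B * ε ^ (1 / 4 : ℝ) := by
  have hpi := Real.pi_pos
  set Λ : ℝ := √(Real.pi / τ.im)
  have hΛ : 0 ≤ Λ := Real.sqrt_nonneg _
  obtain ⟨C, hC, h⟩ := hφ.integral_sub_segAverage_le (Λ * (1 + ‖τ‖))
  refine ⟨2 * C * √(Λ * (1 + ‖τ‖)), fun B ε hε hε1 P hPc hP h1 h2 => ?_⟩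
  have hB : 0 ≤ B := (abs_nonneg _).trans (hP 0)
  have hs1 : √ε ≤ 1 := Real.sqrt_le_one.2 hε1
  have hκ : √(Real.pi * ε / τ.im) = Λ * √ε := by
    rw [← Real.sqrt_mul (by positivity)]
    congr 1
    ring
  have hsδ : √(√ε) = ε ^ (1 / 4 : ℝ) := by
    rw [Real.sqrt_eq_rpow, Real.sqrt_eq_rpow, ← Real.rpow_mul hε.le]
    norm_num
  set κ := √(Real.pi * ε / τ.im)
  have hκ0 : 0 ≤ κ := Real.sqrt_nonneg _
  have n1 : ‖(κ : ℂ)‖ ≤ Λ * (1 + ‖τ‖) * √ε := by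
    rw [Complex.norm_real, Real.norm_of_nonneg hκ0, hκ]
    have : Λ * √ε * 1 ≤ Λ * √ε * (1 + ‖τ‖) := by
      gcongr
      linarith [norm_nonneg τ]
    linarith
  have n2 : ‖(κ : ℂ) * τ‖ ≤ Λ * (1 + ‖τ‖) * √ε := by
    rw [norm_mul, Complex.norm_real, Real.norm_of_nonneg hκ0, hκ]
    have : Λ * √ε * ‖τ‖ ≤ Λ * √ε * (1 + ‖τ‖) := by
      gcongr
      linarith
    linarith
  have bd : ∀ ω : ℂ, ‖ω‖ ≤ Λ * (1 + ‖τ‖) * √ε → ‖ω‖ ≤ Λ * (1 + ‖τ‖) ∧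
      √‖ω‖ ≤ √(Λ * (1 + ‖τ‖)) * ε ^ (1 / 4 : ℝ) := by
    intro ω hω
    refine ⟨hω.trans (mul_le_of_le_one_right (by positivity) hs1), ?_⟩
    rw [← hsδ, ← Real.sqrt_mul (by positivity)]
    exact Real.sqrt_le_sqrt hω
  set Q := segAverage ((κ : ℂ) * τ) P
  have t1 := h _ (bd _ n2).1 B P hPc hP
  have t2 := h _ (bd _ n1).1 B Q (continuous_segAverage _ hPc) (abs_segAverage_le _ hP)
  have e : ∫ z, φ z * (segAverage (κ : ℂ) Q z : ℂ) = (cellAverage ε τ P : ℂ) * ∫ z, φ z := by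
    have e1 : ∀ z, φ z * (segAverage (κ : ℂ) Q z : ℂ) = (cellAverage ε τ P : ℂ) * φ z := by
      intro z
      rw [segAverage_segAverage_eq hε hτ h1 h2, mul_comm]
    simp only [e1]
    exact integral_const_mul _ _
  rw [← e]
  calc ‖(∫ z, φ z * (P z : ℂ)) - ∫ z, φ z * (segAverage (κ : ℂ) Q z : ℂ)‖
      ≤ ‖(∫ z, φ z * (P z : ℂ)) - ∫ z, φ z * (Q z : ℂ)‖
        + ‖(∫ z, φ z * (Q z : ℂ)) - ∫ z, φ z * (segAverage (κ : ℂ) Q z : ℂ)‖ :=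
        norm_sub_le_norm_sub_add_norm_sub _ _ _
    _ ≤ C * B * (√(Λ * (1 + ‖τ‖)) * ε ^ (1 / 4 : ℝ))
        + C * B * (√(Λ * (1 + ‖τ‖)) * ε ^ (1 / 4 : ℝ)) := by
        refine add_le_add (t1.trans ?_) (t2.trans ?_)
        · gcongr
          exact (bd _ n2).2
        · gcongr
          exact (bd _ n1).2
    _ = _ := by ring

end Averaging

/-! ### The theta function -/

/-- The half-integer characteristic amounts to a shift by `1/2 + τ/2` and an exponential factor; the
quasi-periods and convergence are inherited from `jacobiTheta₂`. -/
theorem theta_eq_jacobiTheta₂ (v τ : ℂ) :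
    theta v τ = 1 / Complex.I *
      (Complex.exp (Real.pi * Complex.I * τ / 4 + Real.pi * Complex.I * v) *
        jacobiTheta₂ (v + 1 / 2 + τ / 2) τ) := by
  rw [theta, jacobiTheta₂, ← tsum_mul_left (a := Complex.exp _)]
  congr 1
  refine tsum_congr fun n => ?_
  rw [jacobiTheta₂_term, ← Complex.exp_add]
  have e : (-1 : ℂ) ^ n = Complex.exp (n * (Real.pi * Complex.I)) := by
    rw [Complex.exp_int_mul, Complex.exp_pi_mul_I]
  rw [e, ← Complex.exp_add, ← Complex.exp_add]
  congr 1
  ring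

theorem differentiable_theta {τ : ℂ} (hτ : 0 < τ.im) : Differentiable ℂ (fun v => theta v τ) := by
  have h : (fun v => theta v τ) = fun v => 1 / Complex.I *
      (Complex.exp (Real.pi * Complex.I * τ / 4 + Real.pi * Complex.I * v) *
        jacobiTheta₂ (v + 1 / 2 + τ / 2) τ) := funext fun v => theta_eq_jacobiTheta₂ v τ
  rw [h]
  have h2 : Differentiable ℂ (fun z => jacobiTheta₂ z τ) :=
    fun z => differentiableAt_jacobiTheta₂_fst z hτ
  have h3 : Differentiable ℂ (fun v : ℂ => jacobiTheta₂ (v + 1 / 2 + τ / 2) τ) :=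
    h2.comp (by fun_prop : Differentiable ℂ (fun v : ℂ => v + 1 / 2 + τ / 2))
  fun_prop

theorem theta_add_one (v τ : ℂ) : theta (v + 1) τ = -theta v τ := by
  rw [theta_eq_jacobiTheta₂, theta_eq_jacobiTheta₂,
    show v + 1 + 1 / 2 + τ / 2 = (v + 1 / 2 + τ / 2) + 1 by ring, jacobiTheta₂_add_left,
    show Real.pi * Complex.I * τ / 4 + Real.pi * Complex.I * (v + 1)
      = Real.pi * Complex.I * τ / 4 + Real.pi * Complex.I * v + Real.pi * Complex.I by ring,
    Complex.exp_add _ (Real.pi * Complex.I), Complex.exp_pi_mul_I]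
  ring

theorem theta_add_tau (v τ : ℂ) : theta (v + τ) τ
    = -Complex.exp (-(Real.pi * Complex.I * τ) - 2 * Real.pi * Complex.I * v) * theta v τ := by
  rw [theta_eq_jacobiTheta₂, theta_eq_jacobiTheta₂,
    show v + τ + 1 / 2 + τ / 2 = (v + 1 / 2 + τ / 2) + τ by ring, jacobiTheta₂_add_left']
  have e : Complex.exp (Real.pi * Complex.I * τ / 4 + Real.pi * Complex.I * (v + τ)) *
      Complex.exp (-Real.pi * Complex.I * (τ + 2 * (v + 1 / 2 + τ / 2)))
      = -Complex.exp (-(Real.pi * Complex.I * τ) - 2 * Real.pi * Complex.I * v) *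
        Complex.exp (Real.pi * Complex.I * τ / 4 + Real.pi * Complex.I * v) := by
    rw [neg_mul (Complex.exp _), ← Complex.exp_add, ← Complex.exp_add,
      ← Complex.exp_sub_pi_mul_I]
    congr 1
    ring
  rw [← mul_assoc (Complex.exp _) (Complex.exp _), e]
  ring

/-- Entire functions with the quasi-periods of the theta function. -/
structure ThetaLike (τ : ℂ) (g : ℂ → ℂ) : Prop where
  differentiable : Differentiable ℂ g
  add_one : ∀ v, g (v + 1) = -g v
  add_tau : ∀ v, g (v + τ)
    = -Complex.exp (-(Real.pi * Complex.I * τ) - 2 * Real.pi * Complex.I * v) * g v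

theorem thetaLike_theta {τ : ℂ} (hτ : 0 < τ.im) : ThetaLike τ (fun v => theta v τ) :=
  ⟨differentiable_theta hτ, fun v => theta_add_one v τ, fun v => theta_add_tau v τ⟩

/-- Cauchy's theorem on a rectangle of width one: the vertical sides cancel by periodicity. A
horizontal translation is absorbed by periodicity. -/
theorem integral_periodic_translate {p : ℂ → ℂ} (hp : Differentiable ℂ p)
    (h1 : ∀ v, p (v + 1) = p v) (w : ℂ) :
    ∫ x in (0 : ℝ)..1, p (x + w) = ∫ x in (0 : ℝ)..1, p x := by
  have h := Complex.integral_boundary_rect_eq_zero_of_differentiableOn p 0 (1 + w.im * Complex.I)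
    hp.differentiableOn
  have e1 : ∀ y : ℝ, p (((1 : ℝ) : ℂ) + y * Complex.I) = p (((0 : ℝ) : ℂ) + y * Complex.I) := by
    intro y
    rw [← h1 (((0 : ℝ) : ℂ) + y * Complex.I)]
    congr 1
    push_cast
    ring
  simp only [Complex.zero_re, Complex.zero_im, Complex.add_re, Complex.one_re, Complex.mul_re,
    Complex.ofReal_re, Complex.I_re, mul_zero, Complex.ofReal_im, Complex.I_im, mul_one, sub_self,
    add_zero, Complex.add_im, Complex.one_im, Complex.mul_im, zero_add, e1, add_sub_cancel_right]
    at h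
  have h2 : ∫ x in (0 : ℝ)..1, p (x + w) = ∫ x in (0 : ℝ)..1, p (x + w.im * Complex.I) := by
    rw [← integral_periodic_shift (f := fun x : ℝ => p (x + w.im * Complex.I)) ?_ w.re]
    · congr 1
      ext x
      congr 1
      conv_lhs => rw [← Complex.re_add_im w]
      push_cast
      ring
    · intro x
      simp only
      rw [← h1 (x + w.im * Complex.I)]
      congr 1
      push_cast
      ring
  rw [h2]
  simpa using (sub_eq_zero.1 h).symm

/-- The Fourier coefficients of `exp (-π i v) g v`, where `g` is antiperiodic. -/
noncomputable def thetaCoeff (g : ℂ → ℂ) (n : ℤ) : ℂ :=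
  ∫ x in (0 : ℝ)..1, Complex.exp (-(2 * n + 1) * Real.pi * Complex.I * x) * g x

/-- Moving the contour by `τ` turns the second quasi-period into a first-order recurrence with a
factor that never vanishes, so one coefficient determines all. -/
theorem ThetaLike.thetaCoeff_succ {τ : ℂ} {g : ℂ → ℂ} (hg : ThetaLike τ g) (n : ℤ) :
    thetaCoeff g n
      = -Complex.exp (-(2 * n + 2) * Real.pi * Complex.I * τ) * thetaCoeff g (n + 1) := by
  set p : ℂ → ℂ := fun v => Complex.exp (-(2 * n + 1) * Real.pi * Complex.I * v) * g v
  have hp : Differentiable ℂ p := by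
    have := hg.differentiable
    simp only [p]
    fun_prop
  have hp1 : ∀ v, p (v + 1) = p v := by
    intro v
    simp only [p]
    rw [hg.add_one, show -(2 * (n : ℂ) + 1) * Real.pi * Complex.I * (v + 1)
      = -(2 * (n : ℂ) + 1) * Real.pi * Complex.I * v + (n : ℂ) * (-(2 * Real.pi * Complex.I))
        + -(Real.pi * Complex.I) by ring, Complex.exp_add, Complex.exp_add,
      Complex.exp_neg_pi_mul_I, Complex.exp_int_mul, Complex.exp_neg, Complex.exp_two_pi_mul_I]
    simp
  have h := integral_periodic_translate hp hp1 τ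
  have e : ∀ x : ℝ, p (x + τ) = -Complex.exp (-(2 * n + 2) * Real.pi * Complex.I * τ) *
      (Complex.exp (-(2 * ((n + 1 : ℤ) : ℂ) + 1) * Real.pi * Complex.I * x) * g x) := by
    intro x
    simp only [p]
    rw [hg.add_tau]
    have e2 : Complex.exp (-(2 * (n : ℂ) + 1) * Real.pi * Complex.I * (x + τ)) *
        Complex.exp (-(Real.pi * Complex.I * τ) - 2 * Real.pi * Complex.I * x)
        = Complex.exp (-(2 * n + 2) * Real.pi * Complex.I * τ) *
          Complex.exp (-(2 * ((n + 1 : ℤ) : ℂ) + 1) * Real.pi * Complex.I * x) := by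
      rw [← Complex.exp_add, ← Complex.exp_add]
      congr 1
      push_cast
      ring
    linear_combination (-g x) * e2
  simp only [e] at h
  rw [intervalIntegral.integral_const_mul] at h
  exact h.symm

theorem ThetaLike.thetaCoeff_eq_zero {τ : ℂ} {g : ℂ → ℂ} (hg : ThetaLike τ g)
    (h0 : thetaCoeff g 0 = 0) (n : ℤ) : thetaCoeff g n = 0 := by
  induction n using Int.induction_on with
  | zero => exact h0
  | succ n ih =>
    rw [hg.thetaCoeff_succ, mul_eq_zero] at ih
    exact ih.resolve_left (neg_ne_zero.2 (Complex.exp_ne_zero _))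
  | pred n ih =>
    rw [hg.thetaCoeff_succ, sub_add_cancel, ih, mul_zero]

/-- With all Fourier coefficients zero, `g` vanishes on the real line, hence everywhere by the
identity theorem. -/
theorem ThetaLike.eq_zero {τ : ℂ} {g : ℂ → ℂ} (hg : ThetaLike τ g)
    (h0 : thetaCoeff g 0 = 0) : g = 0 := by
  have : Fact ((0 : ℝ) < 1) := ⟨one_pos⟩
  have hd := hg.differentiable
  set f : ℝ → ℂ := fun x => Complex.exp (-(Real.pi * Complex.I * x)) * g x with hf
  have hfc : Continuous f := by
    have := hd.continuous
    fun_prop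
  have hfp : Function.Periodic f 1 := by
    intro x
    simp only [hf]
    push_cast
    rw [hg.add_one, mul_add, neg_add, Complex.exp_add, mul_one, Complex.exp_neg_pi_mul_I]
    ring
  let F : C(AddCircle (1 : ℝ), ℂ) :=
    ⟨hfp.lift, continuous_coinduced_dom.mpr hfc⟩
  have hF : ∀ x : ℝ, F (x : AddCircle (1 : ℝ)) = f x := fun x => hfp.lift_coe x
  have hcoef : ∀ n, fourierCoeff F n = 0 := by
    intro n
    rw [fourierCoeff_eq_intervalIntegral _ n 0]
    have e : ∀ x : ℝ, fourier (-n) (x : AddCircle (1 : ℝ)) • F (x : AddCircle (1 : ℝ))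
        = Complex.exp (-(2 * n + 1) * Real.pi * Complex.I * x) * g x := by
      intro x
      rw [hF, fourier_coe_apply, smul_eq_mul]
      simp only [hf]
      rw [← mul_assoc, ← Complex.exp_add]
      congr 2
      push_cast
      ring
    simp only [e, zero_add]
    have := hg.thetaCoeff_eq_zero h0 n
    rw [thetaCoeff] at this
    rw [this, smul_zero]
  have hreal : ∀ x : ℝ, g x = 0 := by
    intro x
    have h1 := has_pointwise_sum_fourier_series_of_summable (f := F)
      (by rw [show fourierCoeff F = fun _ => 0 from funext hcoef]; exact summable_zero) x
    simp only [hcoef, zero_smul] at h1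
    have h2 := h1.unique hasSum_zero
    rw [hF] at h2
    exact (mul_eq_zero.1 h2).resolve_left (Complex.exp_ne_zero _)
  have han : AnalyticOnNhd ℂ g Set.univ := fun z _ => hd.analyticAt z
  refine han.eq_of_frequently_eq (z₀ := 0) (g := 0) (fun z _ => analyticAt_const) ?_
  have ht : Tendsto (fun x : ℝ => (x : ℂ)) (𝓝[≠] 0) (𝓝[≠] 0) := by
    refine tendsto_nhdsWithin_of_tendsto_nhds_of_eventually_within _ ?_ ?_
    · have := Complex.continuous_ofReal.tendsto (0 : ℝ)
      rw [Complex.ofReal_zero] at this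
      exact this.mono_left nhdsWithin_le_nhds
    · filter_upwards [self_mem_nhdsWithin] with x hx
      simpa using hx
  exact ht.frequently (Frequently.of_forall fun x => hreal x)

/-- The integral over a real period keeps only the term `n = 0`, which is `1`. -/
theorem exists_jacobiTheta₂_ne_zero {τ : ℂ} (hτ : 0 < τ.im) : ∃ z, jacobiTheta₂ z τ ≠ 0 := by
  by_contra! h0
  have hs := intervalIntegral.hasSum_integral_of_dominated_convergence (μ := volume) (a := 0)
    (b := 1) (F := fun (n : ℤ) (x : ℝ) => jacobiTheta₂_term n x τ)
    (f := fun x : ℝ => jacobiTheta₂ x τ)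
    (fun n _ => ‖jacobiTheta₂_term n 0 τ‖)
    (fun n => by
      unfold jacobiTheta₂_term
      exact Continuous.aestronglyMeasurable (by fun_prop))
    (fun n => Eventually.of_forall fun t _ => by
      rw [norm_jacobiTheta₂_term, norm_jacobiTheta₂_term]
      simp)
    (Eventually.of_forall fun t _ => ((summable_jacobiTheta₂_term_iff 0 τ).2 hτ).norm)
    (by simp)
    (Eventually.of_forall fun t _ => hasSum_jacobiTheta₂_term t hτ)
  simp only [h0, intervalIntegral.integral_zero] at hs
  have hterm : ∀ n : ℤ, n ≠ 0 → ∫ x in (0 : ℝ)..1, jacobiTheta₂_term n x τ = 0 := by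
    intro n hn
    have e : ∀ x : ℝ, jacobiTheta₂_term n x τ
        = Complex.exp ((2 * Real.pi * Complex.I * n) * x) *
          Complex.exp (Real.pi * Complex.I * n ^ 2 * τ) := by
      intro x
      rw [jacobiTheta₂_term, Complex.exp_add]
    have hc : (2 * Real.pi * Complex.I * n : ℂ) ≠ 0 := by
      have : (n : ℂ) ≠ 0 := by exact_mod_cast hn
      simp [Real.pi_ne_zero, this]
    simp only [e]
    rw [intervalIntegral.integral_mul_const, integral_exp_mul_complex hc]
    have : Complex.exp (2 * Real.pi * Complex.I * n * (1 : ℝ)) = 1 := by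
      rw [Complex.exp_eq_one_iff]
      exact ⟨n, by push_cast; ring⟩
    rw [this]
    simp
  have h2 := hs.unique (hasSum_single 0 hterm)
  simp [jacobiTheta₂_term] at h2

theorem exists_theta_ne_zero {τ : ℂ} (hτ : 0 < τ.im) : ∃ v, theta v τ ≠ 0 := by
  obtain ⟨z, hz⟩ := exists_jacobiTheta₂_ne_zero hτ
  refine ⟨z - 1 / 2 - τ / 2, ?_⟩
  rw [theta_eq_jacobiTheta₂]
  have : z - 1 / 2 - τ / 2 + 1 / 2 + τ / 2 = z := by ring
  rw [this]
  simp [hz]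

/-- Entire functions with the quasi-periods of the theta function are multiples of it. -/
theorem ThetaLike.exists_eq_const_mul {τ : ℂ} (hτ : 0 < τ.im) {g : ℂ → ℂ} (hg : ThetaLike τ g) :
    ∃ c : ℂ, ∀ v, g v = c * theta v τ := by
  have hθ := thetaLike_theta hτ
  have hθ0 : thetaCoeff (fun v => theta v τ) 0 ≠ 0 := by
    intro h
    obtain ⟨v, hv⟩ := exists_theta_ne_zero hτ
    exact hv (congrFun (hθ.eq_zero h) v)
  -- This ratio cancels the zeroth Fourier coefficient of `g - c Θ`.
  set c : ℂ := thetaCoeff g 0 / thetaCoeff (fun v => theta v τ) 0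
  have hd : ThetaLike τ (fun v => g v - c * theta v τ) := by
    refine ⟨hg.differentiable.sub (hθ.differentiable.const_mul c), fun v => ?_, fun v => ?_⟩
    · rw [hg.add_one, hθ.add_one]
      ring
    · rw [hg.add_tau, hθ.add_tau]
      ring
  have hi : ∀ f : ℂ → ℂ, Differentiable ℂ f → IntervalIntegrable
      (fun x : ℝ => Complex.exp (-(2 * ((0 : ℤ) : ℂ) + 1) * Real.pi * Complex.I * x) * f x)
      volume 0 1 := by
    intro f hf
    have := hf.continuous
    exact Continuous.intervalIntegrable (by fun_prop) _ _
  have h0 : thetaCoeff (fun v => g v - c * theta v τ) 0 = 0 := by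
    have e : thetaCoeff (fun v => g v - c * theta v τ) 0
        = thetaCoeff g 0 - c * thetaCoeff (fun v => theta v τ) 0 := by
      simp only [thetaCoeff]
      rw [← intervalIntegral.integral_const_mul, ← intervalIntegral.integral_sub
        (hi _ hg.differentiable) ((hi _ hθ.differentiable).const_mul c)]
      congr 1
      ext x
      ring
    rw [e, div_mul_cancel₀ _ hθ0, sub_self]
  refine ⟨c, fun v => ?_⟩
  exact sub_eq_zero.1 (congrFun (hd.eq_zero h0) v)

/-! ### Quasi-periodic functions at scale `ε` -/

/-- The length of the first period of the lattice at scale `ε`. -/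
noncomputable def latticeScale (ε : ℝ) (τ : ℂ) : ℝ := √(Real.pi * ε / τ.im)

/-- Quasi-periodicity with respect to the magnetic translation by `ω`. -/
def QuasiPeriodic (ε : ℝ) (ω a : ℂ) (F : ℂ → ℂ) : Prop :=
  ∀ z, F (z + ω) = a * Complex.exp (conj ω * z / (ε : ℂ)) * F z

section

variable {ε : ℝ} {τ : ℂ}

theorem latticeScale_pos (hε : 0 < ε) (hτ : 0 < τ.im) : 0 < latticeScale ε τ :=
  Real.sqrt_pos.2 (div_pos (mul_pos Real.pi_pos hε) hτ)

theorem latticeScale_sq_mul_im (hε : 0 < ε) (hτ : 0 < τ.im) :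
    latticeScale ε τ ^ 2 * τ.im = Real.pi * ε := by
  rw [latticeScale, Real.sq_sqrt (div_pos (mul_pos Real.pi_pos hε) hτ).le]
  field_simp

theorem sqrt_im_div (ε : ℝ) (τ : ℂ) : √(τ.im / (Real.pi * ε)) = (latticeScale ε τ)⁻¹ := by
  rw [latticeScale, ← Real.sqrt_inv, inv_div]

theorem quasiPeriodic_latticeF_one (hε : 0 < ε) (hτ : 0 < τ.im) :
    QuasiPeriodic ε (latticeScale ε τ)
      (-Complex.exp ((latticeScale ε τ : ℂ) ^ 2 / (2 * ε))) (latticeF ε τ) := by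
  intro z
  have hκ : (latticeScale ε τ : ℂ) ≠ 0 := by exact_mod_cast (latticeScale_pos hε hτ).ne'
  have hε' : (ε : ℂ) ≠ 0 := by exact_mod_cast hε.ne'
  rw [latticeF, latticeF, sqrt_im_div, Complex.ofReal_inv, mul_add, inv_mul_cancel₀ hκ,
    theta_add_one, Complex.conj_ofReal]
  have e : Complex.exp ((z + latticeScale ε τ) ^ 2 / (2 * (ε : ℂ)))
      = Complex.exp ((latticeScale ε τ : ℂ) ^ 2 / (2 * ε)) *
        Complex.exp (latticeScale ε τ * z / (ε : ℂ)) * Complex.exp (z ^ 2 / (2 * (ε : ℂ))) := by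
    rw [← Complex.exp_add, ← Complex.exp_add]
    congr 1
    field_simp
    ring
  rw [e]
  ring

/-- The area condition `κ² τ_I = πε` on the lattice scale `κ` is what makes the theta multiplier the
one of a magnetic translation by `κτ`. -/
theorem latticeScale_identity (hε : 0 < ε) (hτ : 0 < τ.im) :
    (latticeScale ε τ : ℂ) * τ / ε - 2 * Real.pi * Complex.I * (latticeScale ε τ : ℂ)⁻¹
      = latticeScale ε τ * conj τ / ε := by
  have hκ : (latticeScale ε τ : ℂ) ≠ 0 := by exact_mod_cast (latticeScale_pos hε hτ).ne'
  have hε' : (ε : ℂ) ≠ 0 := by exact_mod_cast hε.ne'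
  have h1 : (latticeScale ε τ : ℂ) ^ 2 * τ.im = Real.pi * ε := by
    exact_mod_cast latticeScale_sq_mul_im hε hτ
  have h2 : τ - conj τ = 2 * τ.im * Complex.I := by
    rw [Complex.sub_conj]
    push_cast
    ring
  field_simp
  linear_combination (latticeScale ε τ : ℂ) ^ 2 * h2 + 2 * Complex.I * h1

theorem quasiPeriodic_latticeF_tau (hε : 0 < ε) (hτ : 0 < τ.im) :
    QuasiPeriodic ε (latticeScale ε τ * τ)
      (-Complex.exp ((latticeScale ε τ * τ) ^ 2 / (2 * ε) - Real.pi * Complex.I * τ))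
      (latticeF ε τ) := by
  intro z
  have hκ : (latticeScale ε τ : ℂ) ≠ 0 := by exact_mod_cast (latticeScale_pos hε hτ).ne'
  have hε' : (ε : ℂ) ≠ 0 := by exact_mod_cast hε.ne'
  rw [latticeF, latticeF, sqrt_im_div, Complex.ofReal_inv, mul_add, inv_mul_cancel_left₀ hκ,
    theta_add_tau, map_mul, Complex.conj_ofReal]
  have e : Complex.exp ((z + latticeScale ε τ * τ) ^ 2 / (2 * (ε : ℂ))) *
      Complex.exp (-(Real.pi * Complex.I * τ)
        - 2 * Real.pi * Complex.I * ((latticeScale ε τ : ℂ)⁻¹ * z))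
      = Complex.exp ((latticeScale ε τ * τ) ^ 2 / (2 * ε) - Real.pi * Complex.I * τ) *
        Complex.exp (latticeScale ε τ * conj τ * z / (ε : ℂ)) *
        Complex.exp (z ^ 2 / (2 * (ε : ℂ))) := by
    rw [← Complex.exp_add, ← Complex.exp_add, ← Complex.exp_add]
    congr 1
    have h := latticeScale_identity hε hτ
    have h3 : (z + latticeScale ε τ * τ) ^ 2 / (2 * (ε : ℂ)) = z ^ 2 / (2 * (ε : ℂ))
        + (latticeScale ε τ : ℂ) * τ / ε * z + (latticeScale ε τ * τ) ^ 2 / (2 * ε) := by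
      field_simp
      ring
    rw [h3]
    linear_combination z * h
  linear_combination (-theta ((latticeScale ε τ : ℂ)⁻¹ * z) τ) * e

theorem norm_multiplier_one (ε : ℝ) (τ : ℂ) :
    ‖-Complex.exp ((latticeScale ε τ : ℂ) ^ 2 / (2 * ε))‖
      = Real.exp (‖(latticeScale ε τ : ℂ)‖ ^ 2 / (2 * ε)) := by
  rw [norm_neg, Complex.norm_exp, Complex.norm_real, Real.norm_eq_abs, sq_abs]
  congr 1
  rw [show (latticeScale ε τ : ℂ) ^ 2 / (2 * ε) = ((latticeScale ε τ ^ 2 / (2 * ε) : ℝ) : ℂ) by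
    push_cast; ring, Complex.ofReal_re]

/-- Together with `norm_multiplier_one`, this is the modulus for which the Gaussian times `|F|`
becomes periodic (`QuasiPeriodic.gauss_mul_norm`). -/
theorem norm_multiplier_tau (hε : 0 < ε) (hτ : 0 < τ.im) :
    ‖-Complex.exp ((latticeScale ε τ * τ) ^ 2 / (2 * ε) - Real.pi * Complex.I * τ)‖
      = Real.exp (‖latticeScale ε τ * τ‖ ^ 2 / (2 * ε)) := by
  rw [norm_neg, Complex.norm_exp, norm_mul, Complex.norm_real, mul_pow ‖latticeScale ε τ‖,
    Real.norm_eq_abs, sq_abs]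
  congr 1
  have h := latticeScale_sq_mul_im hε hτ
  have e : ((latticeScale ε τ * τ) ^ 2 / (2 * ε) - Real.pi * Complex.I * τ).re
      = latticeScale ε τ ^ 2 * (τ.re ^ 2 - τ.im ^ 2) / (2 * ε) + Real.pi * τ.im := by
    rw [show (latticeScale ε τ * τ) ^ 2 / (2 * (ε : ℂ))
      = ((latticeScale ε τ ^ 2 / (2 * ε) : ℝ) : ℂ) * τ ^ 2 by push_cast; ring, Complex.sub_re,
      Complex.re_ofReal_mul]
    simp [sq]
    ring
  rw [e, ← Complex.normSq_eq_norm_sq, Complex.normSq_apply]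
  field_simp
  linear_combination (-2 * τ.im) * h

theorem QuasiPeriodic.gauss_mul_norm {ω a : ℂ} {F : ℂ → ℂ} (h : QuasiPeriodic ε ω a F)
    (ha : ‖a‖ = Real.exp (‖ω‖ ^ 2 / (2 * ε))) (hε : 0 < ε) (z : ℂ) :
    gauss ε (z + ω) * ‖F (z + ω)‖ = gauss ε z * ‖F z‖ := by
  rw [h z, norm_mul, norm_mul, ha, Complex.norm_exp, Complex.div_ofReal_re, gauss, gauss,
    ← mul_assoc, ← mul_assoc, ← Real.exp_add, ← Real.exp_add]
  congr 2
  rw [← Complex.normSq_eq_norm_sq, ← Complex.normSq_eq_norm_sq, ← Complex.normSq_eq_norm_sq,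
    Complex.normSq_add, mul_comm (conj ω)]
  field_simp
  ring

/-- The projector commutes with magnetic translations: shifting both arguments of the kernel by `ω`
reproduces the multiplier. -/
theorem QuasiPeriodic.szego {ω a : ℂ} {F : ℂ → ℂ} (h : QuasiPeriodic ε ω a F) (hε : 0 < ε) :
    QuasiPeriodic ε ω a (szego ε F) := by
  intro z
  have hε' : (ε : ℂ) ≠ 0 := by exact_mod_cast hε.ne'
  rw [szego_eq, szego_eq, ← integral_add_right_eq_self _ ω]
  have e : ∀ w, szegoIntegrand ε (z + ω) F (w + ω)
      = a * Complex.exp (conj ω * z / (ε : ℂ)) * szegoIntegrand ε z F w := by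
    intro w
    simp only [szegoIntegrand]
    rw [h w]
    have e2 : Complex.exp ((z + ω) * conj (w + ω) / (ε : ℂ)) *
        (Real.exp (-‖w + ω‖ ^ 2 / ε) : ℂ) * Complex.exp (conj ω * w / (ε : ℂ))
        = Complex.exp (conj ω * z / (ε : ℂ)) * Complex.exp (z * conj w / (ε : ℂ)) *
          (Real.exp (-‖w‖ ^ 2 / ε) : ℂ) := by
      rw [Complex.ofReal_exp, Complex.ofReal_exp, ← Complex.exp_add, ← Complex.exp_add,
        ← Complex.exp_add, ← Complex.exp_add]
      congr 1
      push_cast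
      rw [← Complex.mul_conj', ← Complex.mul_conj', map_add]
      field_simp
      ring
    linear_combination (a * F w) * e2
  simp only [e]
  rw [integral_const_mul]
  ring

theorem differentiable_latticeF (ε : ℝ) (hτ : 0 < τ.im) :
    Differentiable ℂ (latticeF ε τ) := by
  have h := differentiable_theta hτ
  have h2 : Differentiable ℂ (fun z : ℂ => theta ((√(τ.im / (Real.pi * ε)) : ℂ) * z) τ) :=
    h.comp (by fun_prop : Differentiable ℂ fun z : ℂ => (√(τ.im / (Real.pi * ε)) : ℂ) * z)
  have e : latticeF ε τ = fun z => Complex.exp (z ^ 2 / (2 * (ε : ℂ))) *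
      theta ((√(τ.im / (Real.pi * ε)) : ℂ) * z) τ := rfl
  rw [e]
  fun_prop

/-- Entire functions with the quasi-periods of `f_τ` are multiples of it. -/
theorem exists_eq_const_mul_latticeF (hε : 0 < ε) (hτ : 0 < τ.im) {F : ℂ → ℂ}
    (hF : Differentiable ℂ F)
    (h1 : QuasiPeriodic ε (latticeScale ε τ)
      (-Complex.exp ((latticeScale ε τ : ℂ) ^ 2 / (2 * ε))) F)
    (h2 : QuasiPeriodic ε (latticeScale ε τ * τ)
      (-Complex.exp ((latticeScale ε τ * τ) ^ 2 / (2 * ε) - Real.pi * Complex.I * τ)) F) :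
    ∃ c : ℂ, ∀ z, F z = c * latticeF ε τ z := by
  have hκ : (latticeScale ε τ : ℂ) ≠ 0 := by exact_mod_cast (latticeScale_pos hε hτ).ne'
  have hε' : (ε : ℂ) ≠ 0 := by exact_mod_cast hε.ne'
  set κ : ℂ := (latticeScale ε τ : ℂ) with hκd
  -- Dividing by `exp (z²/(2ε))` and rescaling to periods `1` and `τ` undoes the passage from `Θ` to
  -- `f_τ`.
  set g : ℂ → ℂ := fun v => Complex.exp (-((κ * v) ^ 2 / (2 * ε))) * F (κ * v)
  have hg : ThetaLike τ g := by
    refine ⟨?_, fun v => ?_, fun v => ?_⟩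
    · have : Differentiable ℂ (fun v : ℂ => F (κ * v)) :=
        hF.comp (by fun_prop : Differentiable ℂ fun v : ℂ => κ * v)
      simp only [g]
      fun_prop
    · simp only [g]
      rw [mul_add, mul_one, h1 (κ * v), hκd, Complex.conj_ofReal, ← hκd]
      have e : Complex.exp (-((κ * v + κ) ^ 2 / (2 * ε))) * (Complex.exp (κ ^ 2 / (2 * ε)) *
          Complex.exp (κ * (κ * v) / ε)) = Complex.exp (-((κ * v) ^ 2 / (2 * ε))) := by
        rw [← Complex.exp_add, ← Complex.exp_add]
        congr 1
        field_simp
        ring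
      linear_combination (-F (κ * v)) * e
    · simp only [g]
      rw [mul_add, h2 (κ * v), map_mul, hκd, Complex.conj_ofReal, ← hκd]
      have e : Complex.exp (-((κ * v + κ * τ) ^ 2 / (2 * ε))) *
          (Complex.exp ((κ * τ) ^ 2 / (2 * ε) - Real.pi * Complex.I * τ) *
          Complex.exp (κ * conj τ * (κ * v) / ε))
          = Complex.exp (-(Real.pi * Complex.I * τ) - 2 * Real.pi * Complex.I * v) *
            Complex.exp (-((κ * v) ^ 2 / (2 * ε))) := by
        rw [← Complex.exp_add, ← Complex.exp_add, ← Complex.exp_add]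
        congr 1
        have h := latticeScale_identity hε hτ
        rw [← hκd] at h
        have h3 : (κ * v + κ * τ) ^ 2 / (2 * (ε : ℂ)) = (κ * v) ^ 2 / (2 * (ε : ℂ))
            + κ * τ / ε * (κ * v) + (κ * τ) ^ 2 / (2 * ε) := by
          field_simp
          ring
        have h4 : κ⁻¹ * (κ * v) = v := inv_mul_cancel_left₀ hκ v
        rw [h3]
        linear_combination (-(κ * v)) * h - 2 * Real.pi * Complex.I * h4
      linear_combination (-F (κ * v)) * e
  obtain ⟨c, hc⟩ := hg.exists_eq_const_mul hτ
  refine ⟨c, fun z => ?_⟩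
  have h := hc (κ⁻¹ * z)
  simp only [g, mul_inv_cancel_left₀ hκ] at h
  rw [latticeF, sqrt_im_div, Complex.ofReal_inv, ← hκd]
  have e : Complex.exp (z ^ 2 / (2 * (ε : ℂ))) * Complex.exp (-(z ^ 2 / (2 * (ε : ℂ)))) = 1 := by
    rw [← Complex.exp_add, add_neg_cancel, Complex.exp_zero]
  linear_combination Complex.exp (z ^ 2 / (2 * (ε : ℂ))) * h - F z * e

theorem norm_latticeU (ε : ℝ) (τ z : ℂ) :
    ‖latticeU ε τ z‖ = gauss ε z * ‖latticeF ε τ z‖ := by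
  rw [latticeU, norm_mul, Complex.norm_real, Real.norm_of_nonneg (Real.exp_pos _).le, gauss]

theorem norm_latticeU_add_one (hε : 0 < ε) (hτ : 0 < τ.im) (z : ℂ) :
    ‖latticeU ε τ (z + latticeScale ε τ)‖ = ‖latticeU ε τ z‖ := by
  rw [norm_latticeU, norm_latticeU]
  exact (quasiPeriodic_latticeF_one hε hτ).gauss_mul_norm (norm_multiplier_one ε τ) hε z

theorem norm_latticeU_add_tau (hε : 0 < ε) (hτ : 0 < τ.im) (z : ℂ) :
    ‖latticeU ε τ (z + latticeScale ε τ * τ)‖ = ‖latticeU ε τ z‖ := by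
  rw [norm_latticeU, norm_latticeU]
  exact (quasiPeriodic_latticeF_tau hε hτ).gauss_mul_norm (norm_multiplier_tau hε hτ) hε z

theorem continuous_latticeU (ε : ℝ) (hτ : 0 < τ.im) : Continuous (latticeU ε τ) := by
  have h := (differentiable_latticeF ε hτ).continuous
  have e : latticeU ε τ = fun z => (Real.exp (-‖z‖ ^ 2 / (2 * ε)) : ℂ) * latticeF ε τ z := rfl
  rw [e]
  fun_prop

theorem exists_cell_point (hε : 0 < ε) (hτ : 0 < τ.im) (z : ℂ) :
    ∃ s ∈ Set.Icc (0 : ℝ) 1, ∃ t ∈ Set.Icc (0 : ℝ) 1,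
      ‖latticeU ε τ z‖ = ‖latticeU ε τ (latticeScale ε τ * (s + t * τ))‖ := by
  obtain ⟨a, b, hab⟩ := exists_real_coords hτ (latticeScale_pos hε hτ).ne' z
  refine ⟨Int.fract a, ⟨Int.fract_nonneg a, (Int.fract_lt_one a).le⟩,
    Int.fract b, ⟨Int.fract_nonneg b, (Int.fract_lt_one b).le⟩, ?_⟩
  have p1 : Function.Periodic (fun z => ‖latticeU ε τ z‖) (latticeScale ε τ : ℂ) :=
    norm_latticeU_add_one hε hτ
  have p2 : Function.Periodic (fun z => ‖latticeU ε τ z‖) (latticeScale ε τ * τ) :=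
    norm_latticeU_add_tau hε hτ
  have e : (latticeScale ε τ : ℂ) * ((Int.fract a : ℝ) + (Int.fract b : ℝ) * τ)
      = z - ⌊a⌋ * (latticeScale ε τ : ℂ) - ⌊b⌋ * (latticeScale ε τ * τ) := by
    rw [hab, Int.fract, Int.fract]
    push_cast
    ring
  rw [e]
  exact ((p2.sub_int_mul_eq ⌊b⌋).trans (p1.sub_int_mul_eq ⌊a⌋)).symm

/-- Uniform in `ε`: scaling reduces to `ε = 1`, and periodicity to a compact cell. -/
theorem exists_norm_latticeU_le (hτ : 0 < τ.im) :
    ∃ B : ℝ, ∀ ε : ℝ, 0 < ε → ∀ z, ‖latticeU ε τ z‖ ≤ B := by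
  have hc : Continuous fun p : ℝ × ℝ =>
      ‖latticeU 1 τ (latticeScale 1 τ * ((p.1 : ℂ) + p.2 * τ))‖ := by
    have := continuous_latticeU 1 hτ
    fun_prop
  obtain ⟨B, hB⟩ := ((isCompact_Icc (a := (0 : ℝ)) (b := 1)).prod
    (isCompact_Icc (a := (0 : ℝ)) (b := 1))).exists_bound_of_continuousOn hc.continuousOn
  refine ⟨B, fun ε hε z => ?_⟩
  have hs : (√ε : ℂ) ≠ 0 := by exact_mod_cast (Real.sqrt_pos.2 hε).ne'
  rw [show z = (√ε : ℂ) * ((√ε : ℂ)⁻¹ * z) by rw [mul_inv_cancel_left₀ hs], latticeU_scale hε]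
  obtain ⟨s, hs, t, ht, e⟩ := exists_cell_point one_pos hτ ((√ε : ℂ)⁻¹ * z)
  rw [e]
  simpa using hB (s, t) ⟨hs, ht⟩

/-- The average of `|u_τ|ⁿ` over a period cell. -/
noncomputable def latticeMoment (τ : ℂ) (n : ℕ) : ℝ :=
  cellAverage 1 τ (fun z => ‖latticeU 1 τ z‖ ^ n)

theorem cellAverage_latticeU_pow (hε : 0 < ε) (τ : ℂ) (n : ℕ) :
    cellAverage ε τ (fun z => ‖latticeU ε τ z‖ ^ n) = latticeMoment τ n := by
  have key : ∀ w : ℂ, (√(Real.pi * ε / τ.im) : ℂ) * w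
      = (√ε : ℂ) * ((√(Real.pi * 1 / τ.im) : ℂ) * w) := by
    intro w
    rw [← mul_assoc, ← Complex.ofReal_mul, ← Real.sqrt_mul hε.le]
    congr 3
    ring
  simp only [latticeMoment, cellAverage, key, latticeU_scale hε]

theorem hexB_eq : hexB = latticeMoment hexTau 4 / latticeMoment hexTau 2 ^ 2 := rfl

/-- A point where `Θ ≠ 0` is moved into the closed cell by periodicity; the integrand is continuous
and nonnegative. -/
theorem latticeMoment_pos (hτ : 0 < τ.im) (n : ℕ) : 0 < latticeMoment τ n := by
  obtain ⟨v, hv⟩ := exists_theta_ne_zero hτ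
  have hκ : (latticeScale 1 τ : ℂ) ≠ 0 := by exact_mod_cast (latticeScale_pos one_pos hτ).ne'
  have hU : latticeU 1 τ (latticeScale 1 τ * v) ≠ 0 := by
    rw [latticeU, latticeF, sqrt_im_div, Complex.ofReal_inv, inv_mul_cancel_left₀ hκ]
    refine mul_ne_zero ?_ (mul_ne_zero (Complex.exp_ne_zero _) hv)
    exact_mod_cast (Real.exp_pos _).ne'
  obtain ⟨s, hs, t, ht, e⟩ := exists_cell_point one_pos hτ (latticeScale 1 τ * v)
  have hpos : 0 < ‖latticeU 1 τ (latticeScale 1 τ * (s + t * τ))‖ ^ n := by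
    rw [← e]
    exact pow_pos (norm_pos_iff.2 hU) n
  have hU := continuous_latticeU 1 hτ
  refine intervalIntegral.integral_pos one_pos ?_ (fun x _ => ?_) ⟨s, hs, ?_⟩
  · exact (intervalIntegral.continuous_parametric_intervalIntegral_of_continuous'
      (by fun_prop) _ _).continuousOn
  · exact intervalIntegral.integral_nonneg zero_le_one fun _ _ => by positivity
  · refine intervalIntegral.integral_pos one_pos (by fun_prop) (fun x _ => by positivity)
      ⟨t, ht, hpos⟩

/-! ### The nonlinear term and its exact eigenvalue relation. -/

/-- The nonlinear term of the Euler-Lagrange equation. -/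
noncomputable def cubicTerm (ε : ℝ) (f : ℂ → ℂ) (w : ℂ) : ℂ :=
  (Real.exp (-‖w‖ ^ 2 / ε) : ℂ) * (‖f w‖ ^ 2 : ℂ) * f w

theorem cubicTerm_eq (ε : ℝ) (f : ℂ → ℂ) (w : ℂ) :
    cubicTerm ε f w = (((gauss ε w * ‖f w‖) ^ 2 : ℝ) : ℂ) * f w := by
  rw [cubicTerm, ← gauss_sq]
  push_cast
  ring

theorem gauss_mul_norm_cubicTerm (ε : ℝ) (f : ℂ → ℂ) (w : ℂ) :
    gauss ε w * ‖cubicTerm ε f w‖ = (gauss ε w * ‖f w‖) ^ 3 := by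
  have := gauss_pos ε w
  rw [cubicTerm_eq, norm_mul, Complex.norm_real, Real.norm_of_nonneg (by positivity)]
  ring

theorem continuous_cubicTerm (ε : ℝ) {f : ℂ → ℂ} (hf : Continuous f) :
    Continuous (cubicTerm ε f) := by
  unfold cubicTerm
  fun_prop

theorem QuasiPeriodic.cubicTerm {ω a : ℂ} {F : ℂ → ℂ} (h : QuasiPeriodic ε ω a F)
    (ha : ‖a‖ = Real.exp (‖ω‖ ^ 2 / (2 * ε))) (hε : 0 < ε) :
    QuasiPeriodic ε ω a (cubicTerm ε F) := by
  intro z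
  rw [cubicTerm_eq, cubicTerm_eq, h.gauss_mul_norm ha hε, h z]
  ring

/-- The factor `|u_τ|²` is periodic, so the cubic term keeps the quasi-periods of `f_τ`. Projection
preserves them and restores holomorphy, and uniqueness leaves only a multiple of `f_τ`. -/
theorem exists_szego_cubicTerm_latticeF (hε : 0 < ε) (hτ : 0 < τ.im) :
    ∃ c : ℂ, ∀ z, LLL.szego ε (LLL.cubicTerm ε (latticeF ε τ)) z = c * latticeF ε τ z := by
  obtain ⟨B, hB⟩ := exists_norm_latticeU_le hτ
  have h1 := quasiPeriodic_latticeF_one hε hτ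
  have h2 := quasiPeriodic_latticeF_tau hε hτ
  refine exists_eq_const_mul_latticeF hε hτ ?_
    ((h1.cubicTerm (norm_multiplier_one ε τ) hε).szego hε)
    ((h2.cubicTerm (norm_multiplier_tau hε hτ) hε).szego hε)
  refine differentiable_szego hε
    (continuous_cubicTerm ε (differentiable_latticeF ε hτ).continuous) (M := B ^ 3) fun w => ?_
  rw [gauss_mul_norm_cubicTerm, ← norm_latticeU]
  exact pow_le_pow_left₀ (norm_nonneg _) (hB ε hε w) 3

end

/-! ### Asymptotics of the eigenvalue. -/

section

variable {τ : ℂ} {φ : ℂ → ℂ}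

theorem unifBdd_latticeF (hτ : 0 < τ.im) : UnifBdd (fun ε => latticeF ε τ) := by
  obtain ⟨B, hB⟩ := exists_norm_latticeU_le hτ
  refine ⟨Eventually.of_forall fun ε => (differentiable_latticeF ε hτ).continuous, B, ?_⟩
  filter_upwards [eventually_pos_le_one] with ε hε z
  rw [← norm_latticeU]
  exact hB ε hε.1 z

theorem CompHolder.average_latticeU (hφ : CompHolder φ) (hτ : 0 < τ.im) (n : ℕ) :
    ∃ C : ℝ, ∀ᶠ ε in 𝓝[>] (0 : ℝ),
      ‖(∫ z, φ z * ((gauss ε z * ‖latticeF ε τ z‖) ^ n : ℝ)) - (latticeMoment τ n : ℂ) * ∫ z, φ z‖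
        ≤ C * ε ^ (1 / 4 : ℝ) := by
  obtain ⟨B, hB⟩ := exists_norm_latticeU_le hτ
  obtain ⟨C, hC⟩ := hφ.averaging hτ
  refine ⟨C * B ^ n, ?_⟩
  filter_upwards [eventually_pos_le_one] with ε hε
  have h := hC (B ^ n) ε hε.1 hε.2 (fun z => ‖latticeU ε τ z‖ ^ n)
    ((continuous_latticeU ε hτ).norm.pow n) (fun z => ?_) (fun z => ?_) (fun z => ?_)
  · rw [cellAverage_latticeU_pow hε.1] at h
    simpa only [norm_latticeU] using h
  · rw [abs_of_nonneg (by positivity)]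
    exact pow_le_pow_left₀ (norm_nonneg _) (hB ε hε.1 z) n
  · exact congrArg (· ^ n) (norm_latticeU_add_one hε.1 hτ z)
  · exact congrArg (· ^ n) (norm_latticeU_add_tau hε.1 hτ z)

theorem rpow_quarter_le_one {ε : ℝ} (hε : 0 < ε ∧ ε ≤ 1) :
    0 ≤ ε ^ (1 / 4 : ℝ) ∧ ε ^ (1 / 4 : ℝ) ≤ 1 :=
  ⟨Real.rpow_nonneg hε.1.le _, Real.rpow_le_one hε.1.le hε.2 (by norm_num)⟩

theorem tendsto_const_mul_rpow_quarter (C : ℝ) :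
    Tendsto (fun ε : ℝ => C * ε ^ (1 / 4 : ℝ)) (𝓝[>] 0) (𝓝 0) := by
  have h : Tendsto (fun ε : ℝ => ε ^ (1 / 4 : ℝ)) (𝓝[>] 0) (𝓝 0) := by
    have := (Real.continuousAt_rpow_const 0 (1 / 4 : ℝ) (Or.inr (by norm_num))).tendsto
    rw [Real.zero_rpow (by norm_num)] at this
    exact this.mono_left nhdsWithin_le_nhds
  simpa using h.const_mul C

/-- The commutator estimate for the lattice function, which is reproduced by the projector. -/
theorem CompHolder.szego_mul_latticeF_sub (hφ : CompHolder φ) (hτ : 0 < τ.im) :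
    Decays (fun ε => ε ^ (1 / 4 : ℝ))
      (fun ε z => szego ε (fun w => φ w * latticeF ε τ w) z - φ z * latticeF ε τ z) := by
  obtain ⟨B, hB⟩ := exists_norm_latticeU_le hτ
  refine (hφ.szego_commutator (unifBdd_latticeF hτ)).congr ?_
  filter_upwards [eventually_pos_le_one] with ε hε z
  rw [szego_eq_self hε.1 (differentiable_latticeF ε hτ) (M := B)]
  intro w
  rw [← norm_latticeU]
  exact hB ε hε.1 w

/-- Testing the eigenvalue relation of `f_τ` against a compactly supported profile. -/
theorem CompHolder.test_eigenvalue (hφ : CompHolder φ) (hτ : 0 < τ.im) {c : ℝ → ℂ}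
    (hc : ∀ ε, 0 < ε → ∀ z, szego ε (cubicTerm ε (latticeF ε τ)) z = c ε * latticeF ε τ z) :
    ∃ C : ℝ, ∀ᶠ ε in 𝓝[>] (0 : ℝ),
      ‖c ε * (∫ z, φ z * ((gauss ε z * ‖latticeF ε τ z‖) ^ 2 : ℝ))
        - ∫ z, φ z * ((gauss ε z * ‖latticeF ε τ z‖) ^ 4 : ℝ)‖ ≤ C * ε ^ (1 / 4 : ℝ) := by
  obtain ⟨B, hB⟩ := exists_norm_latticeU_le hτ
  have hB0 : 0 ≤ B := (norm_nonneg _).trans (hB 1 one_pos 0)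
  have hψ := hφ.star
  have hD := hψ.szego_mul_latticeF_sub hτ
  have ha := hψ.decays_mul (unifBdd_latticeF hτ)
  obtain ⟨M, hM⟩ := hD.2 2
  obtain ⟨N, hN⟩ := ha.2 2
  set I : ℝ := ∫ y : ℂ, ((1 + ‖y‖ ^ 2) ^ 2)⁻¹
  refine ⟨M * B ^ 3 * I, ?_⟩
  filter_upwards [hD.1, hM, hN, eventually_pos_le_one] with ε hDc hM hN hε
  have hfc := (differentiable_latticeF ε hτ).continuous
  have hgc := continuous_gauss ε
  have hφc := hφ.continuous
  have hconj := Complex.continuous_conj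
  set f := latticeF ε τ
  set D : ℂ → ℂ := fun z => szego ε (fun w => conj (φ w) * f w) z - conj (φ z) * f z
  have hHb : ∀ w, gauss ε w * ‖cubicTerm ε f w‖ ≤ B ^ 3 := by
    intro w
    rw [gauss_mul_norm_cubicTerm, ← norm_latticeU]
    exact pow_le_pow_left₀ (norm_nonneg _) (hB ε hε.1 w) 3
  -- Symmetry moves the projector from the cubic term to `φ̄ f_τ`, where the commutator estimate
  -- applies; `D` is the resulting error.
  have key := integral_conj_mul_szego hε.1 (a := fun w => conj (φ w) * f w) (b := cubicTerm ε f)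
    (by fun_prop) (continuous_cubicTerm ε hfc) hN hHb
  have hL : ∀ z, ((gauss ε z ^ 2 : ℝ) : ℂ) * conj (conj (φ z) * f z) * szego ε (cubicTerm ε f) z
      = c ε * (φ z * ((gauss ε z * ‖f z‖) ^ 2 : ℝ)) := by
    intro z
    rw [hc ε hε.1 z, map_mul, Complex.conj_conj]
    push_cast
    linear_combination (c ε * φ z * (gauss ε z : ℂ) ^ 2) * Complex.conj_mul' (f z)
  have hR : ∀ z, ((gauss ε z ^ 2 : ℝ) : ℂ) * conj (szego ε (fun w => conj (φ w) * f w) z) *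
      cubicTerm ε f z = φ z * ((gauss ε z * ‖f z‖) ^ 4 : ℝ)
        + ((gauss ε z ^ 2 : ℝ) : ℂ) * conj (D z) * cubicTerm ε f z := by
    intro z
    simp only [D, map_sub, map_mul, Complex.conj_conj]
    rw [cubicTerm_eq]
    push_cast
    linear_combination (φ z * (gauss ε z : ℂ) ^ 4 * (‖f z‖ : ℂ) ^ 2) * Complex.conj_mul' (f z)
  have hb : ∀ z, ‖((gauss ε z ^ 2 : ℝ) : ℂ) * conj (D z) * cubicTerm ε f z‖
      ≤ M * ε ^ (1 / 4 : ℝ) * B ^ 3 * ((1 + ‖z‖ ^ 2) ^ 2)⁻¹ := by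
    intro z
    have hγ := gauss_pos ε z
    rw [norm_mul, norm_mul, RCLike.norm_conj, Complex.norm_real, Real.norm_of_nonneg (by positivity),
      ← div_eq_mul_inv, le_div_iff₀ (by positivity)]
    calc gauss ε z ^ 2 * ‖D z‖ * ‖cubicTerm ε f z‖ * (1 + ‖z‖ ^ 2) ^ 2
        = (gauss ε z * ‖D z‖ * (1 + ‖z‖ ^ 2) ^ 2) * (gauss ε z * ‖cubicTerm ε f z‖) := by ring
      _ ≤ (M * ε ^ (1 / 4 : ℝ)) * B ^ 3 :=
          mul_le_mul (hM z) (hHb z) (by positivity) (le_trans (by positivity) (hM z))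
  have hint1 : Integrable (fun z => φ z * ((gauss ε z * ‖f z‖) ^ 4 : ℝ)) := by
    refine Continuous.integrable_of_hasCompactSupport (by fun_prop) ?_
    exact hφ.hasCompactSupport.mul_right
  have hint2 : Integrable (fun z => ((gauss ε z ^ 2 : ℝ) : ℂ) * conj (D z) * cubicTerm ε f z) := by
    refine (integrable_inv_one_add_norm_sq_sq.const_mul _).mono' ?_ (Eventually.of_forall hb)
    have := continuous_cubicTerm ε hfc
    exact Continuous.aestronglyMeasurable (by fun_prop)
  simp only [hL, hR] at key
  rw [integral_const_mul, integral_add hint1 hint2] at key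
  rw [key, add_sub_cancel_left]
  refine (norm_integral_le_of_norm_le (integrable_inv_one_add_norm_sq_sq.const_mul _)
    (Eventually.of_forall hb)).trans_eq ?_
  rw [integral_const_mul]
  ring

/-- One probe of integral one suffices: the two sides of the tested relation average to `c ε · m₂`
and `m₄`, and `m₂ > 0` allows division. -/
theorem eigenvalue_asymptotics (hφ : CompHolder φ) (h1 : ∫ z, φ z = 1) (hτ : 0 < τ.im) {c : ℝ → ℂ}
    (hc : ∀ ε, 0 < ε → ∀ z, szego ε (cubicTerm ε (latticeF ε τ)) z = c ε * latticeF ε τ z) :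
    ∃ C : ℝ, ∀ᶠ ε in 𝓝[>] (0 : ℝ),
      ‖c ε - ((latticeMoment τ 4 / latticeMoment τ 2 : ℝ) : ℂ)‖ ≤ C * ε ^ (1 / 4 : ℝ) := by
  obtain ⟨C, hC⟩ := hφ.test_eigenvalue hτ hc
  obtain ⟨C2, hC2⟩ := hφ.average_latticeU hτ 2
  obtain ⟨C4, hC4⟩ := hφ.average_latticeU hτ 4
  have hm := latticeMoment_pos hτ 2
  set m := latticeMoment τ 2
  set m4 := latticeMoment τ 4
  have hm' : (m : ℂ) ≠ 0 := by exact_mod_cast hm.ne'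
  refine ⟨2 / m * (C + C4 + |m4 / m| * C2), ?_⟩
  filter_upwards [hC, hC2, hC4,
    (tendsto_const_mul_rpow_quarter C2).eventually (gt_mem_nhds (half_pos hm))] with ε h h2 h4 hs
  set A : ℂ := ∫ z, φ z * ((gauss ε z * ‖latticeF ε τ z‖) ^ 2 : ℝ)
  set A4 : ℂ := ∫ z, φ z * ((gauss ε z * ‖latticeF ε τ z‖) ^ 4 : ℝ)
  rw [h1, mul_one] at h2 h4
  have e : (c ε - ((m4 / m : ℝ) : ℂ)) * A
      = (c ε * A - A4) + (A4 - m4) - ((m4 / m : ℝ) : ℂ) * (A - m) := by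
    push_cast
    field_simp
    ring
  have hA : m / 2 ≤ ‖A‖ := by
    have h3 := norm_sub_norm_le (m : ℂ) A
    rw [Complex.norm_real, Real.norm_of_nonneg hm.le, norm_sub_rev] at h3
    linarith
  have e2 : ‖c ε - ((m4 / m : ℝ) : ℂ)‖ * ‖A‖
      ≤ (C + C4 + |m4 / m| * C2) * ε ^ (1 / 4 : ℝ) := by
    rw [← norm_mul, e]
    refine (norm_sub_le _ _).trans ?_
    refine (add_le_add (norm_add_le _ _) le_rfl).trans ?_
    rw [norm_mul, Complex.norm_real, Real.norm_eq_abs]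
    have : |m4 / m| * ‖A - m‖ ≤ |m4 / m| * (C2 * ε ^ (1 / 4 : ℝ)) := by gcongr
    linarith
  have e3 : ‖c ε - ((m4 / m : ℝ) : ℂ)‖ * (m / 2) ≤ ‖c ε - ((m4 / m : ℝ) : ℂ)‖ * ‖A‖ := by gcongr
  calc ‖c ε - ((m4 / m : ℝ) : ℂ)‖ = 2 / m * (‖c ε - ((m4 / m : ℝ) : ℂ)‖ * (m / 2)) := by
        field_simp
    _ ≤ 2 / m * ((C + C4 + |m4 / m| * C2) * ε ^ (1 / 4 : ℝ)) :=
        mul_le_mul_of_nonneg_left (e3.trans e2) (by positivity)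
    _ = _ := by ring

end

/-! ### The Thomas-Fermi problem -/

section

variable {b β G : ℝ}

theorem potential_ge (β : ℝ) (z : ℂ) : -β ^ 2 ≤ potential β z := by
  rw [potential]
  nlinarith [sq_nonneg (‖z‖ ^ 2 / 2 - β)]

theorem densityTF_eq (b β G μ : ℝ) (z : ℂ) :
    densityTF b β G μ z = max ((μ - potential β z) / (b * G)) 0 := by
  rw [densityTF, potential]
  congr 2
  ring

theorem continuous_densityTF (b β G : ℝ) :
    Continuous (fun p : ℝ × ℂ => densityTF b β G p.1 p.2) := by
  unfold densityTF
  fun_prop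

theorem continuous_potential (β : ℝ) : Continuous (potential β) := by
  unfold potential
  fun_prop

/-- Beyond this radius the quartic part of the potential dominates. Uniformity over `|μ| ≤ A` gives
continuity of the mass in `μ`. -/
theorem densityTF_eq_zero (hbG : 0 < b * G) {μ A : ℝ} (hμ : |μ| ≤ A) {z : ℂ}
    (hz : 4 * (|β| + A + 1) ≤ ‖z‖) : densityTF b β G μ z = 0 := by
  rw [densityTF]
  refine max_eq_right (div_nonpos_of_nonpos_of_nonneg ?_ hbG.le)
  have hA : 0 ≤ A := (abs_nonneg _).trans hμ
  have h1 : 1 ≤ ‖z‖ := by linarith [abs_nonneg β]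
  have h2 : 4 * (|β| + A + 1) ≤ ‖z‖ ^ 2 := by nlinarith
  have h3 : (1 : ℝ) ≤ ‖z‖ ^ 2 := by nlinarith
  have h4 : β * ‖z‖ ^ 2 ≤ |β| * ‖z‖ ^ 2 := by gcongr; exact le_abs_self β
  have h5 : μ ≤ A * ‖z‖ ^ 2 := ((le_abs_self μ).trans hμ).trans (le_mul_of_one_le_right hA h3)
  nlinarith

theorem continuous_mass_densityTF (hbG : 0 < b * G) :
    Continuous fun μ : ℝ => ∫ z : ℂ, densityTF b β G μ z := by
  rw [continuous_iff_continuousAt]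
  intro μ₀
  refine (continuousOn_integral_of_compact_support
    (f := fun μ z => densityTF b β G μ z) (s := Set.Icc (μ₀ - 1) (μ₀ + 1))
    (isCompact_closedBall (0 : ℂ) (4 * (|β| + (|μ₀| + 1) + 1)))
    (continuous_densityTF b β G).continuousOn ?_).continuousAt
    (Icc_mem_nhds (by linarith) (by linarith))
  intro μ z hμ hz
  rw [Metric.mem_closedBall, dist_zero_right, not_le] at hz
  refine densityTF_eq_zero hbG ?_ hz.le
  rw [abs_le]
  constructor <;> cases abs_cases μ₀ <;> linarith [hμ.1, hμ.2]

theorem mass_densityTF_eq_zero (hbG : 0 < b * G) {μ : ℝ} (hμ : μ ≤ -β ^ 2) :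
    ∫ z : ℂ, densityTF b β G μ z = 0 := by
  have : ∀ z : ℂ, densityTF b β G μ z = 0 := by
    intro z
    rw [densityTF_eq]
    refine max_eq_right (div_nonpos_of_nonpos_of_nonneg ?_ hbG.le)
    linarith [potential_ge β z]
  simp [this]

theorem integrable_densityTF (hbG : 0 < b * G) (μ : ℝ) : Integrable (densityTF b β G μ) := by
  refine Continuous.integrable_of_hasCompactSupport
    ((continuous_densityTF b β G).comp (by fun_prop : Continuous fun z : ℂ => (μ, z))) ?_
  refine HasCompactSupport.intro (isCompact_closedBall (0 : ℂ) (4 * (|β| + |μ| + 1)))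
    fun z hz => ?_
  rw [Metric.mem_closedBall, dist_zero_right, not_le] at hz
  exact densityTF_eq_zero hbG le_rfl hz.le

theorem one_le_mass_densityTF (hbG : 0 < b * G) :
    1 ≤ ∫ z : ℂ, densityTF b β G (|β| + 1 / 4 + b * G) z := by
  -- For this `μ` the density is at least `1` on the unit disc, whose area is `π > 1`.
  set μ := |β| + 1 / 4 + b * G
  have hi := integrable_densityTF (β := β) hbG μ
  have h1 : ∫ z in Metric.ball (0 : ℂ) 1, (1 : ℝ)
      ≤ ∫ z in Metric.ball (0 : ℂ) 1, densityTF b β G μ z := by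
    refine setIntegral_mono_on (by simp [Complex.volume_ball]) hi.integrableOn
      measurableSet_ball fun z hz => ?_
    rw [Metric.mem_ball, dist_zero_right] at hz
    rw [densityTF]
    refine le_max_of_le_left ?_
    rw [one_le_div hbG]
    have h2 : ‖z‖ ^ 2 ≤ 1 := pow_le_one₀ (norm_nonneg _) hz.le
    have h4 : ‖z‖ ^ 4 ≤ 1 := pow_le_one₀ (norm_nonneg _) hz.le
    have h5 : -|β| ≤ β * ‖z‖ ^ 2 := by
      have := neg_abs_le β
      nlinarith [abs_nonneg β, sq_nonneg ‖z‖]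
    simp only [μ]
    linarith
  have h2 : ∫ z in Metric.ball (0 : ℂ) 1, densityTF b β G μ z ≤ ∫ z, densityTF b β G μ z :=
    setIntegral_le_integral hi (Eventually.of_forall fun z => le_max_right _ _)
  have h3 : ∫ z in Metric.ball (0 : ℂ) 1, (1 : ℝ) = Real.pi := by
    simp [Measure.real, Complex.volume_ball]
  linarith [Real.pi_gt_three]

/-- The mass is continuous in `μ`, zero at `-β²` and at least one further on, so the value one is
attained. The set of such `μ` is closed and bounded below, so its infimum belongs to it; uniqueness
is not needed. -/
theorem integral_rhoTF (hbG : 0 < b * G) : ∫ z, rhoTF b β G z = 1 := by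
  set S : Set ℝ := {μ | ∫ z : ℂ, densityTF b β G μ z = 1}
  have hcont := continuous_mass_densityTF (β := β) hbG
  have hne : S.Nonempty := by
    have hle : -β ^ 2 ≤ |β| + 1 / 4 + b * G := by nlinarith [sq_nonneg β, abs_nonneg β]
    obtain ⟨μ, -, hμ⟩ := intermediate_value_Icc hle hcont.continuousOn
      (show (1 : ℝ) ∈ Set.Icc _ _ from
        ⟨by rw [mass_densityTF_eq_zero hbG le_rfl]; exact zero_le_one, one_le_mass_densityTF hbG⟩)
    exact ⟨μ, hμ⟩
  have hbdd : BddBelow S := by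
    refine ⟨-β ^ 2, fun μ hμ => ?_⟩
    by_contra! h
    have h1 : ∫ z : ℂ, densityTF b β G μ z = 1 := hμ
    rw [mass_densityTF_eq_zero hbG h.le] at h1
    exact zero_ne_one h1
  have hcl : IsClosed S := isClosed_eq hcont continuous_const
  exact hcl.csInf_mem hne hbdd

theorem rhoTF_eq_zero (hbG : 0 < b * G) {z : ℂ} (hz : 4 * (|β| + |muTF b β G| + 1) ≤ ‖z‖) :
    rhoTF b β G z = 0 := densityTF_eq_zero hbG le_rfl hz

theorem rhoTF_nonneg (b β G : ℝ) (z : ℂ) : 0 ≤ rhoTF b β G z := le_max_right _ _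

/-- The Euler-Lagrange equation of the Thomas-Fermi problem. -/
theorem rhoTF_mul_eq (hbG : 0 < b * G) (z : ℂ) :
    rhoTF b β G z * (potential β z + b * G * rhoTF b β G z - muTF b β G) = 0 := by
  rw [rhoTF, densityTF_eq]
  rcases le_total ((muTF b β G - potential β z) / (b * G)) 0 with h | h
  · rw [max_eq_right h, zero_mul]
  · rw [max_eq_left h, mul_div_cancel₀ _ hbG.ne']
    ring

theorem muTF_le (hbG : 0 < b * G) (z : ℂ) :
    muTF b β G ≤ potential β z + b * G * rhoTF b β G z := by
  rw [rhoTF, densityTF_eq]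
  have h := le_max_left ((muTF b β G - potential β z) / (b * G)) 0
  rw [div_le_iff₀ hbG] at h
  linarith

theorem continuous_rhoTF (b β G : ℝ) : Continuous (rhoTF b β G) :=
  (continuous_densityTF b β G).comp (by fun_prop : Continuous fun z : ℂ => (muTF b β G, z))

theorem hasCompactSupport_rhoTF (hbG : 0 < b * G) : HasCompactSupport (rhoTF b β G) := by
  refine HasCompactSupport.intro (isCompact_closedBall (0 : ℂ) (4 * (|β| + |muTF b β G| + 1)))
    fun z hz => ?_
  rw [Metric.mem_closedBall, dist_zero_right, not_le] at hz
  exact rhoTF_eq_zero hbG hz.le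

/-- With `r = ρ^TF_b` and `V` the potential, the energy minus `μ` times the mass exceeds its value
at `r` by the integral of `ρ (V + bG r - μ) + (bG/2)(ρ - r)²`, and both terms are nonnegative. -/
theorem groundEnergyTF_eq (hbG : 0 < b * G) :
    groundEnergyTF b β G = energyTF b β G (rhoTF b β G) := by
  have hρc := continuous_rhoTF b β G
  have hρs := hasCompactSupport_rhoTF (β := β) hbG
  have hVc := continuous_potential β
  have hρi : Integrable (rhoTF b β G) := hρc.integrable_of_hasCompactSupport hρs
  have hEi : Integrable (energyDensityTF b β G (rhoTF b β G)) := by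
    have e : energyDensityTF b β G (rhoTF b β G) = fun z =>
        (potential β z + b * G / 2 * rhoTF b β G z) * rhoTF b β G z := by
      ext z
      rw [energyDensityTF]
      ring
    rw [e]
    refine Continuous.integrable_of_hasCompactSupport (by fun_prop) ?_
    exact hρs.mul_left
  have hmass := integral_rhoTF (β := β) hbG
  refine IsLeast.csInf_eq ⟨⟨rhoTF b β G, rhoTF_nonneg b β G, hρi, ?_, hmass, hEi, rfl⟩, ?_⟩
  · refine Continuous.integrable_of_hasCompactSupport (by fun_prop) ?_
    exact hρs.mul_left
  · rintro E ⟨ρ, hρ0, hρ, -, hρ1, hρE, rfl⟩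
    have h1 : ∫ z, (energyDensityTF b β G (rhoTF b β G) z - muTF b β G * rhoTF b β G z)
        ≤ ∫ z, (energyDensityTF b β G ρ z - muTF b β G * ρ z) := by
      refine integral_mono (hEi.sub (hρi.const_mul _)) (hρE.sub (hρ.const_mul _)) fun z => ?_
      simp only [energyDensityTF]
      have h2 := rhoTF_mul_eq (β := β) hbG z
      have h3 := muTF_le (β := β) hbG z
      nlinarith [mul_nonneg (hρ0 z) (sub_nonneg.2 h3),
        mul_nonneg hbG.le (sq_nonneg (ρ z - rhoTF b β G z))]
    rw [integral_sub hEi (hρi.const_mul _), integral_sub hρE (hρ.const_mul _), integral_const_mul,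
      integral_const_mul, hmass, hρ1] at h1
    simpa [energyTF] using h1

end

/-! ### The ground state energy in the lowest Landau level -/

theorem energyLLL_eq (β G ε : ℝ) (f : ℂ → ℂ) :
    energyLLL β G ε f = ∫ z, (potential β z * (gauss ε z * ‖f z‖) ^ 2
      + G / 2 * (gauss ε z * ‖f z‖) ^ 4) := by
  rw [energyLLL]
  congr 1
  ext z
  have h : Real.exp (-2 * ‖z‖ ^ 2 / ε) = gauss ε z ^ 4 := by
    rw [show (4 : ℕ) = 2 * 2 from rfl, pow_mul, gauss_sq, ← Real.exp_nat_mul]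
    congr 1
    push_cast
    ring
  rw [h, ← gauss_sq]
  ring

/-- Bounds the admissible energies below, so that their infimum is a genuine lower bound. -/
theorem neg_sq_le_energyLLL {G : ℝ} (hG : 0 ≤ G) (β : ℝ) {ε : ℝ} {f : ℂ → ℂ}
    (h1 : fockNorm ε 0 f = 1) : -β ^ 2 ≤ energyLLL β G ε f := by
  rw [energyLLL_eq]
  have hm : ∫ z, fockDensity ε 0 f z = 1 := by
    rw [fockNorm, Real.sqrt_eq_one] at h1
    exact h1
  have hmi : Integrable (fockDensity ε 0 f) := by
    by_contra h
    rw [integral_undef h] at hm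
    exact zero_ne_one hm
  by_cases hi : Integrable (fun z => potential β z * (gauss ε z * ‖f z‖) ^ 2
      + G / 2 * (gauss ε z * ‖f z‖) ^ 4)
  · have h2 : ∫ z, -β ^ 2 * fockDensity ε 0 f z ≤ ∫ z, (potential β z * (gauss ε z * ‖f z‖) ^ 2
        + G / 2 * (gauss ε z * ‖f z‖) ^ 4) := by
      refine integral_mono (hmi.const_mul _) hi fun z => ?_
      simp only [fockDensity_zero]
      have h3 := mul_le_mul_of_nonneg_right (potential_ge β z) (sq_nonneg (gauss ε z * ‖f z‖))
      have h4 : 0 ≤ G / 2 * (gauss ε z * ‖f z‖) ^ 4 := by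
        have := gauss_pos ε z
        positivity
      linarith
    rwa [integral_const_mul, hm, mul_one] at h2
  -- A divergent energy integral has the value `0` here, which still respects the bound.
  · rw [integral_undef hi]
    nlinarith [sq_nonneg β]

theorem groundEnergyLLL_le {G : ℝ} (hG : 0 ≤ G) (β : ℝ) {ε : ℝ} {f : ℂ → ℂ}
    (hf1 : f ∈ fockSpace ε 1) (hf2 : f ∈ fockSpace ε 2) (h1 : fockNorm ε 0 f = 1) :
    groundEnergyLLL β G ε ≤ energyLLL β G ε f := by
  refine csInf_le ⟨-β ^ 2, ?_⟩ ⟨f, hf1, hf2, h1, rfl⟩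
  rintro E ⟨g, -, -, hg, rfl⟩
  exact neg_sq_le_energyLLL hG β hg

theorem hexTau_im_pos : 0 < hexTau.im := by
  rw [hexTau, show 2 * Complex.I * Real.pi / 3 = ((2 * Real.pi / 3 : ℝ) : ℂ) * Complex.I by
    push_cast; ring, Complex.exp_ofReal_mul_I_im]
  have := Real.pi_pos
  exact Real.sin_pos_of_pos_of_lt_pi (by positivity) (by linarith)

theorem hexB_pos : 0 < hexB := by
  rw [hexB_eq]
  exact div_pos (latticeMoment_pos hexTau_im_pos 4) (pow_pos (latticeMoment_pos hexTau_im_pos 2) 2)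

theorem CompHolder.of_holderWith {α : ℂ → ℂ} {K : ℝ≥0} (hα : HolderWith K (1 / 2) α) {R : ℝ}
    (hR : 0 ≤ R) (h0 : ∀ z, R ≤ ‖z‖ → α z = 0) : CompHolder α := by
  refine ⟨K, R, K.2, hR, fun z w => ?_, h0⟩
  have h := hα.dist_le z w
  rw [dist_eq_norm, dist_eq_norm] at h
  rw [Real.sqrt_eq_rpow]
  simpa using h

/-! ### Calculus of leading profiles. -/

section

variable {τ : ℂ} {φ : ℂ → ℂ}

theorem CompHolder.average_real {w : ℂ → ℝ} (hw : CompHolder (fun z => (w z : ℂ)))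
    (hτ : 0 < τ.im) (n : ℕ) :
    ∃ C : ℝ, ∀ᶠ ε in 𝓝[>] (0 : ℝ),
      |(∫ z, w z * (gauss ε z * ‖latticeF ε τ z‖) ^ n) - latticeMoment τ n * ∫ z, w z|
        ≤ C * ε ^ (1 / 4 : ℝ) := by
  obtain ⟨C, hC⟩ := hw.average_latticeU hτ n
  refine ⟨C, ?_⟩
  filter_upwards [hC] with ε h
  simp only [← Complex.ofReal_mul] at h
  rw [integral_complex_ofReal, integral_complex_ofReal, ← Complex.ofReal_mul, ← Complex.ofReal_sub,
    Complex.norm_real, Real.norm_eq_abs] at h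
  exact h

/-- The family `g` is the profile `φ` times `f_τ`, up to errors of order `ε ^ (1/4)`. -/
def HasProfile (τ : ℂ) (g : ℝ → ℂ → ℂ) (φ : ℂ → ℂ) : Prop :=
  Decays (fun ε => ε ^ (1 / 4 : ℝ)) (fun ε z => g ε z - φ z * latticeF ε τ z)

theorem eventually_quarter : ∀ᶠ ε in 𝓝[>] (0 : ℝ), 0 ≤ ε ^ (1 / 4 : ℝ) ∧ ε ^ (1 / 4 : ℝ) ≤ 1 := by
  filter_upwards [eventually_pos_le_one] with ε hε using rpow_quarter_le_one hε

namespace HasProfile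

variable {g h : ℝ → ℂ → ℂ} {φ ψ : ℂ → ℂ}

theorem decays (hg : HasProfile τ g φ) (hφ : CompHolder φ) (hτ : 0 < τ.im) :
    Decays (fun _ => 1) g :=
  ((Decays.mono (q := fun _ => 1) hg eventually_quarter).add
    (hφ.decays_mul (unifBdd_latticeF hτ))).congr (Eventually.of_forall fun ε z => by ring)

theorem add (hg : HasProfile τ g φ) (hh : HasProfile τ h ψ) :
    HasProfile τ (fun ε z => g ε z + h ε z) (fun z => φ z + ψ z) :=
  (Decays.add hg hh).congr (Eventually.of_forall fun ε z => by ring)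

theorem const_mul (c : ℂ) (hg : HasProfile τ g φ) :
    HasProfile τ (fun ε z => c * g ε z) (fun z => c * φ z) :=
  (Decays.const_mul c hg).congr (Eventually.of_forall fun ε z => by ring)

theorem norm_sq_mul (hg : HasProfile τ g φ) :
    HasProfile τ (fun ε z => (‖z‖ : ℂ) ^ 2 * g ε z) (fun z => (‖z‖ : ℂ) ^ 2 * φ z) :=
  (Decays.norm_sq_mul hg).congr (Eventually.of_forall fun ε z => by ring)

/-- The projection of the error keeps its size, and `Π_ε(φ f_τ)` differs from `φ f_τ` by the
commutator. -/
theorem szego (hg : HasProfile τ g φ) (hφ : CompHolder φ) (hτ : 0 < τ.im) :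
    HasProfile τ (fun ε => szego ε (g ε)) φ := by
  have h1 := Decays.szego hg
  have h2 := hφ.szego_mul_latticeF_sub hτ
  have hgd := hg.decays hφ hτ
  have hfd := hφ.decays_mul (unifBdd_latticeF hτ)
  obtain ⟨M, hM⟩ := hgd.exists_bound
  obtain ⟨N, hN⟩ := hfd.exists_bound
  refine (h1.add h2).congr ?_
  filter_upwards [hgd.1, hfd.1, hM, hN, eventually_pos_le_one] with ε c1 c2 b1 b2 hε z
  rw [szego_sub hε.1 c1 c2 b1 b2]
  ring

/-- Three errors of order `ε^(1/4)` add up: replacing `g` by `φ f_τ` (`d1`), taking `|φ|²φ` out of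
the projector (`d2`), and replacing the eigenvalue by its limit (`d3`). The function `χ` is only the
probe for the eigenvalue. -/
theorem szego_cubicTerm (hg : HasProfile τ g φ) (hφ : CompHolder φ) (hτ : 0 < τ.im) {χ : ℂ → ℂ}
    (hχ : CompHolder χ) (hχ1 : ∫ z, χ z = 1) :
    HasProfile τ (fun ε => LLL.szego ε (cubicTerm ε (g ε)))
      (fun z => ((latticeMoment τ 4 / latticeMoment τ 2 : ℝ) : ℂ) * (φ z * conj (φ z) * φ z)) := by
  set r : ℂ := ((latticeMoment τ 4 / latticeMoment τ 2 : ℝ) : ℂ)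
  obtain ⟨B, hB⟩ := exists_norm_latticeU_le hτ
  have hex : ∀ ε : ℝ, ∃ c : ℂ, 0 < ε →
      ∀ z, LLL.szego ε (cubicTerm ε (latticeF ε τ)) z = c * latticeF ε τ z := by
    intro ε
    by_cases hε : 0 < ε
    · obtain ⟨c, hc⟩ := exists_szego_cubicTerm_latticeF hε hτ
      exact ⟨c, fun _ => hc⟩
    · exact ⟨0, fun h => absurd h hε⟩
  choose c hc using hex
  obtain ⟨C, hC⟩ := eigenvalue_asymptotics hχ hχ1 hτ hc
  have hΦ : CompHolder (fun z => φ z * conj (φ z) * φ z) := (hφ.mul hφ.star).mul hφ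
  have hfd := hφ.decays_mul (unifBdd_latticeF hτ)
  have hgd := hg.decays hφ hτ
  have hcub : UnifBdd (fun ε => cubicTerm ε (latticeF ε τ)) := by
    refine ⟨Eventually.of_forall fun ε =>
      continuous_cubicTerm ε (differentiable_latticeF ε hτ).continuous, B ^ 3, ?_⟩
    filter_upwards [eventually_pos_le_one] with ε hε z
    rw [gauss_mul_norm_cubicTerm, ← norm_latticeU]
    exact pow_le_pow_left₀ (norm_nonneg _) (hB ε hε.1 z) 3
  have e1 : ∀ ε z, cubicTerm ε (fun z => φ z * latticeF ε τ z) z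
      = φ z * conj (φ z) * φ z * cubicTerm ε (latticeF ε τ) z := by
    intro ε z
    rw [cubicTerm, cubicTerm, norm_mul, Complex.ofReal_mul, mul_pow, Complex.mul_conj']
    ring
  have d1 := (Decays.cubic_sub hgd hfd hg).szego
  have d2 := hΦ.szego_commutator hcub
  have d3 := (hΦ.decays_mul (unifBdd_latticeF hτ)).mul_coeff
    (r := fun ε => ε ^ (1 / 4 : ℝ)) (c := fun ε => c ε - r) ⟨C, hC⟩
  simp only [mul_one] at d3
  obtain ⟨M, hM⟩ := hgd.exists_bound
  obtain ⟨N, hN⟩ := hfd.exists_bound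
  refine ((d1.add d2).add d3).congr ?_
  filter_upwards [hgd.1, hfd.1, hM, hN, eventually_pos_le_one] with ε c1 c2 b1 b2 hε z
  have b1' : ∀ w, gauss ε w * ‖cubicTerm ε (g ε) w‖ ≤ (M * 1) ^ 3 := fun w => by
    rw [gauss_mul_norm_cubicTerm]
    exact pow_le_pow_left₀ (mul_nonneg (gauss_pos _ _).le (norm_nonneg _)) (b1 w) 3
  have b2' : ∀ w, gauss ε w * ‖cubicTerm ε (fun z => φ z * latticeF ε τ z) w‖ ≤ (N * 1) ^ 3 :=
    fun w => by
      rw [gauss_mul_norm_cubicTerm]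
      exact pow_le_pow_left₀ (mul_nonneg (gauss_pos _ _).le (norm_nonneg _)) (b2 w) 3
  have h3 := szego_sub hε.1 (continuous_cubicTerm ε c1) (continuous_cubicTerm ε c2) b1' b2' z
  have h4 : LLL.szego ε (cubicTerm ε (fun z => φ z * latticeF ε τ z)) z = LLL.szego ε
      (fun w => φ w * conj (φ w) * φ w * cubicTerm ε (latticeF ε τ) w) z := by
    congr 1
    ext w
    exact e1 ε w
  have h5 : (fun w => (Real.exp (-‖w‖ ^ 2 / ε) : ℂ) * (‖g ε w‖ ^ 2 : ℂ) * g ε w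
      - (Real.exp (-‖w‖ ^ 2 / ε) : ℂ) * (‖φ w * latticeF ε τ w‖ ^ 2 : ℂ) * (φ w * latticeF ε τ w))
      = fun w => cubicTerm ε (g ε) w - cubicTerm ε (fun z => φ z * latticeF ε τ z) w := rfl
  rw [h5, h3, h4, hc ε hε.1 z]
  ring

end HasProfile

theorem abs_inv_sub_inv_sqrt_le {x m : ℝ} (hm : 0 < m) (hx : 0 ≤ x) (hxm : m / 2 ≤ x ^ 2) :
    |1 / x - 1 / √m| ≤ 1 / (√(m / 2) * m) * |x ^ 2 - m| := by
  have hs : 0 < √m := Real.sqrt_pos.2 hm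
  have hs2 : 0 < √(m / 2) := Real.sqrt_pos.2 (half_pos hm)
  have hx2 : √(m / 2) ≤ x := Real.sqrt_le_iff.2 ⟨hx, hxm⟩
  have hx0 : 0 < x := hs2.trans_le hx2
  have hsq : √m ^ 2 = m := Real.sq_sqrt hm.le
  have e : 1 / x - 1 / √m = -(x ^ 2 - m) * (1 / (x * (√m * (√m + x)))) := by
    field_simp
    rw [← hsq, Real.sqrt_sq hs.le]
    ring
  rw [e, abs_mul, abs_neg, mul_comm, abs_of_pos (by positivity)]
  gcongr
  nlinarith [mul_pos hs hx0]

end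

/-! ### The trial function -/

section

variable {τ : ℂ} {α : ℂ → ℂ}

theorem trial_eq (ε : ℝ) (α : ℂ → ℂ) (τ z : ℂ) : trial ε α τ z
    = ((1 / fockNorm ε 0 (projectedTrial ε α τ) : ℝ) : ℂ) * projectedTrial ε α τ z := by
  rw [trial]
  push_cast
  ring

theorem hasProfile_projectedTrial (hα : CompHolder α) (hτ : 0 < τ.im) :
    HasProfile τ (fun ε => projectedTrial ε α τ) α :=
  hα.szego_mul_latticeF_sub hτ

theorem fockNorm_sq (ε : ℝ) (f : ℂ → ℂ) :
    fockNorm ε 0 f ^ 2 = ∫ z, (gauss ε z * ‖f z‖) ^ 2 := by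
  rw [fockNorm, Real.sq_sqrt (integral_nonneg fun z => by rw [fockDensity_zero]; positivity)]
  simp only [fockDensity_zero]

theorem CompHolder.ofReal_norm_sq (hα : CompHolder α) :
    CompHolder (fun z => ((‖α z‖ ^ 2 : ℝ) : ℂ)) := by
  have h := hα.mul hα.star
  simpa only [Complex.mul_conj', ← Complex.ofReal_pow] using h

/-- The squared norm is close to `∫ |α|² |u_τ|²`, and averaging with `∫ |α|² = 1` leaves `m₂`. -/
theorem fockNorm_projectedTrial_sq (hα : CompHolder α) (h1 : ∫ z, ‖α z‖ ^ 2 = 1) (hτ : 0 < τ.im) :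
    ∃ C : ℝ, ∀ᶠ ε in 𝓝[>] (0 : ℝ),
      |fockNorm ε 0 (projectedTrial ε α τ) ^ 2 - latticeMoment τ 2| ≤ C * ε ^ (1 / 4 : ℝ) := by
  have hp := hasProfile_projectedTrial hα hτ
  obtain ⟨C, hC⟩ := (hp.decays hα hτ).integral_mul_pow_sub (hα.decays_mul (unifBdd_latticeF hτ)) hp
    (W := fun _ => 1) (C := 1) (j := 0) continuous_const (by simp) 1
  obtain ⟨C2, hC2⟩ := hα.ofReal_norm_sq.average_real hτ 2
  refine ⟨C + C2, ?_⟩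
  filter_upwards [hC, hC2] with ε h2 h3
  rw [h1, mul_one] at h3
  rw [fockNorm_sq]
  have e : ∀ z, (1 : ℝ) * (gauss ε z * ‖α z * latticeF ε τ z‖) ^ (1 + 1)
      = ‖α z‖ ^ 2 * (gauss ε z * ‖latticeF ε τ z‖) ^ 2 := by
    intro z
    rw [norm_mul]
    ring
  simp only [e] at h2
  simp only [one_mul] at h2
  rw [add_mul]
  exact (abs_sub_le _ _ _).trans (add_le_add h2 h3)

theorem eventually_half_moment_le (hα : CompHolder α) (h1 : ∫ z, ‖α z‖ ^ 2 = 1) (hτ : 0 < τ.im) :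
    ∀ᶠ ε in 𝓝[>] (0 : ℝ),
      latticeMoment τ 2 / 2 ≤ fockNorm ε 0 (projectedTrial ε α τ) ^ 2 := by
  obtain ⟨C, hC⟩ := fockNorm_projectedTrial_sq hα h1 hτ
  have hm := latticeMoment_pos hτ 2
  filter_upwards [hC, (tendsto_const_mul_rpow_quarter C).eventually (gt_mem_nhds (half_pos hm))]
    with ε h2 h3
  have := (abs_le.1 h2).1
  linarith

/-- With `N` the norm, the error splits into `1/N` times that of the projected profile (`d1`) and
`(1/N - 1/√m₂) α f_τ` (`d2`); `N` stays away from zero. -/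
theorem hasProfile_trial (hα : CompHolder α) (h1 : ∫ z, ‖α z‖ ^ 2 = 1) (hτ : 0 < τ.im) :
    HasProfile τ (fun ε => trial ε α τ)
      (fun z => ((1 / √(latticeMoment τ 2) : ℝ) : ℂ) * α z) := by
  obtain ⟨C, hC⟩ := fockNorm_projectedTrial_sq hα h1 hτ
  have hm := latticeMoment_pos hτ 2
  have hhalf := eventually_half_moment_le hα h1 hτ
  set m := latticeMoment τ 2
  set N : ℝ → ℝ := fun ε => fockNorm ε 0 (projectedTrial ε α τ)
  have hN : ∀ ε, 0 ≤ N ε := fun ε => Real.sqrt_nonneg _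
  have d1 := (hasProfile_projectedTrial hα hτ).mul_coeff (r := fun _ => 1)
    (c := fun ε => ((1 / N ε : ℝ) : ℂ)) ⟨1 / √(m / 2), by
      filter_upwards [hhalf] with ε h
      have : √(m / 2) ≤ N ε := Real.sqrt_le_iff.2 ⟨hN ε, h⟩
      have h0 : 0 < √(m / 2) := Real.sqrt_pos.2 (half_pos hm)
      rw [Complex.norm_real, Real.norm_of_nonneg (one_div_nonneg.2 (hN ε)), mul_one]
      gcongr⟩
  have d2 := (hα.decays_mul (unifBdd_latticeF hτ)).mul_coeff (r := fun ε => ε ^ (1 / 4 : ℝ))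
    (c := fun ε => ((1 / N ε - 1 / √m : ℝ) : ℂ)) ⟨1 / (√(m / 2) * m) * C, by
      filter_upwards [hhalf, hC] with ε h h2
      rw [Complex.norm_real, Real.norm_eq_abs, mul_assoc]
      refine (abs_inv_sub_inv_sqrt_le hm (hN ε) h).trans ?_
      gcongr⟩
  simp only [mul_one] at d2
  simp only [one_mul] at d1
  refine (d1.add d2).congr (Eventually.of_forall fun ε z => ?_)
  simp only [trial_eq, N]
  push_cast
  ring

theorem fockNorm_trial {ε : ℝ} (h : 0 < fockNorm ε 0 (projectedTrial ε α τ)) :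
    fockNorm ε 0 (trial ε α τ) = 1 := by
  have h2 : fockNorm ε 0 (trial ε α τ) ^ 2 = 1 := by
    rw [fockNorm_sq]
    have e : ∀ z, (gauss ε z * ‖trial ε α τ z‖) ^ 2
        = (1 / fockNorm ε 0 (projectedTrial ε α τ)) ^ 2 *
          (gauss ε z * ‖projectedTrial ε α τ z‖) ^ 2 := by
      intro z
      rw [trial_eq, norm_mul, Complex.norm_real, Real.norm_of_nonneg (by positivity)]
      ring
    simp only [e]
    rw [integral_const_mul, ← fockNorm_sq]
    field_simp
  exact (pow_eq_one_iff_of_nonneg (Real.sqrt_nonneg _) two_ne_zero).1 h2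

end

/-! ### The Euler-Lagrange remainder and the energy of the trial function. -/

section

variable {α : ℂ → ℂ} {β G : ℝ}

theorem CompHolder.ofReal_potential_mul {w : ℂ → ℝ} (hw : CompHolder (fun z => (w z : ℂ))) (β : ℝ) :
    CompHolder (fun z => ((potential β z * w z : ℝ) : ℂ)) := by
  have h := (hw.norm_sq_mul.const_mul (-β)).add (hw.norm_sq_mul.norm_sq_mul.const_mul (1 / 4))
  convert h using 2 with z
  rw [potential]
  push_cast
  ring

theorem CompHolder.ofReal_norm_pow_four (hα : CompHolder α) :
    CompHolder (fun z => ((‖α z‖ ^ 4 : ℝ) : ℂ)) := by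
  have h := hα.ofReal_norm_sq.mul hα.ofReal_norm_sq
  convert h using 2 with z
  push_cast
  ring

theorem abs_potential_le (β : ℝ) (z : ℂ) :
    |potential β z| ≤ (|β| + 1) * (1 + ‖z‖ ^ 2) ^ 2 := by
  rw [potential]
  refine (abs_add_le _ _).trans ?_
  rw [abs_mul, abs_mul, abs_neg, abs_of_nonneg (by positivity : (0 : ℝ) ≤ ‖z‖ ^ 2),
    abs_of_nonneg (by positivity : (0 : ℝ) ≤ ‖z‖ ^ 4), abs_of_pos (by norm_num : (0 : ℝ) < 1 / 4)]
  have h1 := abs_nonneg β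
  have h2 := sq_nonneg ‖z‖
  have h3 : ‖z‖ ^ 4 = (‖z‖ ^ 2) ^ 2 := by ring
  rw [h3]
  nlinarith [mul_nonneg h1 h2, mul_nonneg h1 (sq_nonneg (‖z‖ ^ 2))]

/-- The remainder in the Euler-Lagrange equation of the trial function. -/
theorem decays_eulerLagrange_trial (hG : 0 < G) (hα : CompHolder α)
    (hρ : ∀ z : ℂ, ‖α z‖ ^ 2 = rhoTF hexB β G z) (h1 : ∫ z, ‖α z‖ ^ 2 = 1) :
    Decays (fun ε => ε ^ (1 / 4 : ℝ)) (fun ε z => eulerLagrange β G ε (trial ε α hexTau) z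
      - (muTF hexB β G : ℂ) * trial ε α hexTau z) := by
  have hτ := hexTau_im_pos
  have hm := latticeMoment_pos hτ 2
  have hbG : 0 < hexB * G := mul_pos hexB_pos hG
  have hB := hexB_eq
  have ht := hasProfile_trial hα h1 hτ
  have hχ : ∫ z, ((‖α z‖ ^ 2 : ℝ) : ℂ) = 1 := by
    rw [integral_complex_ofReal, h1, Complex.ofReal_one]
  set m := latticeMoment hexTau 2
  set m4 := latticeMoment hexTau 4
  set c₀ : ℝ := 1 / √m
  have hc₀ : c₀ ^ 2 = 1 / m := by
    rw [div_pow, one_pow, Real.sq_sqrt hm.le]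
  set ψ : ℂ → ℂ := fun z => (c₀ : ℂ) * α z with hψd
  have hψ : CompHolder ψ := hα.const_mul _
  have hX := ht.norm_sq_mul.szego hψ.norm_sq_mul hτ
  have hY := hX.norm_sq_mul.szego hψ.norm_sq_mul.norm_sq_mul hτ
  have hZ := ht.szego_cubicTerm hψ hτ hα.ofReal_norm_sq hχ
  have hXs : Decays (fun ε => ε ^ (1 / 4 : ℝ)) (fun ε z => (1 / 4 * (ε : ℂ)) *
      szego ε (fun w => (‖w‖ : ℂ) ^ 2 * trial ε α hexTau w) z) := by
    refine ((hX.decays hψ.norm_sq_mul hτ).mul_coeff (r := fun ε => ε)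
      (c := fun ε => 1 / 4 * (ε : ℂ)) ⟨1 / 4, ?_⟩).mono ?_
    · filter_upwards [eventually_pos_le_one] with ε hε
      rw [norm_mul, Complex.norm_real, Real.norm_of_nonneg hε.1.le]
      norm_num
    · filter_upwards [eventually_pos_le_one] with ε hε
      rw [mul_one]
      refine ⟨hε.1.le, ?_⟩
      conv_lhs => rw [← Real.rpow_one ε]
      exact Real.rpow_le_rpow_of_exponent_ge hε.1 hε.2 (by norm_num)
  have htot := (((hX.const_mul (-(β : ℂ))).add (hY.const_mul (1 / 4))).add
    (hZ.const_mul (G : ℂ))).add (ht.const_mul (-(muTF hexB β G : ℂ)))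
  -- The profile of the defect is `α (V + bG ρ^TF_b - μ)/√m₂`, which vanishes: either `α = 0` or the
  -- Thomas-Fermi equation holds. Here `b = (m₄/m₂)(1/m₂)`.
  have hzero : ∀ z, -(β : ℂ) * ((‖z‖ : ℂ) ^ 2 * ψ z)
      + 1 / 4 * ((‖z‖ : ℂ) ^ 2 * ((‖z‖ : ℂ) ^ 2 * ψ z))
      + (G : ℂ) * (((m4 / m : ℝ) : ℂ) * (ψ z * conj (ψ z) * ψ z))
      + -(muTF hexB β G : ℂ) * ψ z = 0 := by
    intro z
    have e1 : ψ z * conj (ψ z) = ((1 / m * rhoTF hexB β G z : ℝ) : ℂ) := by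
      rw [Complex.mul_conj', hψd, norm_mul, Complex.norm_real, ← Complex.ofReal_pow, mul_pow,
        Real.norm_eq_abs, sq_abs, hc₀, hρ]
    have e2 : α z * ((potential β z + hexB * G * rhoTF hexB β G z - muTF hexB β G : ℝ) : ℂ)
        = 0 := by
      rcases mul_eq_zero.1 (rhoTF_mul_eq (β := β) hbG z) with h | h
      · rw [← hρ, sq_eq_zero_iff, norm_eq_zero] at h
        rw [h, zero_mul]
      · rw [h, Complex.ofReal_zero, mul_zero]
    have e3 : ((hexB : ℝ) : ℂ) = ((m4 / m : ℝ) : ℂ) * ((1 / m : ℝ) : ℂ) := by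
      rw [hB, ← Complex.ofReal_mul]
      congr 1
      field_simp
    rw [e1]
    simp only [hψd, potential] at e2 ⊢
    rw [Complex.ofReal_sub, Complex.ofReal_add, Complex.ofReal_mul, Complex.ofReal_mul, e3] at e2
    push_cast at e2 ⊢
    linear_combination (c₀ : ℂ) * e2
  refine (Decays.add htot hXs).congr (Eventually.of_forall fun ε z => ?_)
  simp only
  rw [hzero z, eulerLagrange]
  have e4 : (fun w => (Real.exp (-‖w‖ ^ 2 / ε) : ℂ) * (‖trial ε α hexTau w‖ ^ 2 : ℂ) *
      trial ε α hexTau w) = cubicTerm ε (trial ε α hexTau) := rfl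
  rw [e4]
  ring

theorem energyLLL_trial (hα : CompHolder α) (h1 : ∫ z, ‖α z‖ ^ 2 = 1) :
    ∃ C : ℝ, ∀ᶠ ε in 𝓝[>] (0 : ℝ), |energyLLL β G ε (trial ε α hexTau)
      - ∫ z : ℂ, (potential β z * ‖α z‖ ^ 2 + hexB * G / 2 * ‖α z‖ ^ 4)|
        ≤ C * ε ^ (1 / 4 : ℝ) := by
  have hτ := hexTau_im_pos
  have hm := latticeMoment_pos hτ 2
  have hB := hexB_eq
  have ht := hasProfile_trial hα h1 hτ
  have hPw := hα.ofReal_norm_sq.ofReal_potential_mul β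
  have h4w := hα.ofReal_norm_pow_four
  obtain ⟨C2, hC2⟩ := hPw.average_real hτ 2
  obtain ⟨C4, hC4⟩ := h4w.average_real hτ 4
  have hi2 : Integrable (fun z => potential β z * ‖α z‖ ^ 2) := by
    have := hPw.integrable.re
    simpa only [RCLike.re_eq_complex_re, Complex.ofReal_re] using this
  have hi4 : Integrable (fun z => ‖α z‖ ^ 4) := by
    have := h4w.integrable.re
    simpa only [RCLike.re_eq_complex_re, Complex.ofReal_re] using this
  set m := latticeMoment hexTau 2
  set m4 := latticeMoment hexTau 4
  set c₀ : ℝ := 1 / √m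
  have hc₀ : c₀ ^ 2 = 1 / m := by
    rw [div_pow, one_pow, Real.sq_sqrt hm.le]
  have hc₀p : 0 ≤ c₀ := by positivity
  have hψ : CompHolder (fun z => (c₀ : ℂ) * α z) := hα.const_mul _
  have htd := ht.decays hψ hτ
  have had := hψ.decays_mul (unifBdd_latticeF hτ)
  have hVc := continuous_potential β
  have hVb := abs_potential_le β
  have hGb : ∀ z : ℂ, |G / 2| ≤ |G / 2| * (1 + ‖z‖ ^ 2) ^ 0 := by simp
  obtain ⟨D2, hD2⟩ := htd.integral_mul_pow_sub had ht hVc hVb 1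
  obtain ⟨D4, hD4⟩ := htd.integral_mul_pow_sub had ht (W := fun _ => G / 2) continuous_const hGb 3
  refine ⟨D2 + D4 + 1 / m * C2 + |G / 2 * (1 / m) ^ 2| * C4, ?_⟩
  filter_upwards [hC2, hC4, hD2, hD4, htd.integrable_mul_pow hVc hVb 1,
    htd.integrable_mul_pow (W := fun _ => G / 2) continuous_const hGb 3] with ε c2 c4 d2 d4 i2 i4
  rw [energyLLL_eq]
  set f := latticeF ε hexTau
  set t := trial ε α hexTau
  rw [integral_add i2 i4, integral_add hi2 (hi4.const_mul _), integral_const_mul (hexB * G / 2)]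
  have e2 : ∀ z, potential β z * (gauss ε z * ‖(c₀ : ℂ) * α z * f z‖) ^ (1 + 1)
      = 1 / m * (potential β z * ‖α z‖ ^ 2 * (gauss ε z * ‖f z‖) ^ 2) := by
    intro z
    rw [norm_mul, norm_mul, Complex.norm_real, Real.norm_of_nonneg hc₀p, ← hc₀]
    ring
  have e4 : ∀ z, G / 2 * (gauss ε z * ‖(c₀ : ℂ) * α z * f z‖) ^ (3 + 1)
      = G / 2 * (1 / m) ^ 2 * (‖α z‖ ^ 4 * (gauss ε z * ‖f z‖) ^ 4) := by
    intro z
    rw [norm_mul, norm_mul, Complex.norm_real, Real.norm_of_nonneg hc₀p, ← hc₀]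
    ring
  simp only [e2, e4] at d2 d4
  rw [integral_const_mul (1 / m)] at d2
  rw [integral_const_mul (G / 2 * (1 / m) ^ 2)] at d4
  set T2 := ∫ z, potential β z * (gauss ε z * ‖t z‖) ^ (1 + 1)
  set T4 := ∫ z, G / 2 * (gauss ε z * ‖t z‖) ^ (3 + 1)
  set A2 := ∫ z, potential β z * ‖α z‖ ^ 2 * (gauss ε z * ‖f z‖) ^ 2
  set A4 := ∫ z, ‖α z‖ ^ 4 * (gauss ε z * ‖f z‖) ^ 4
  set I2 := ∫ z, potential β z * ‖α z‖ ^ 2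
  set I4 := ∫ z, ‖α z‖ ^ 4
  change |T2 + T4 - (I2 + hexB * G / 2 * I4)| ≤ _
  -- The first two differences replace the trial function by its profile; the last two average the
  -- periodic factors. The identity uses `b = m₄/m₂²`.
  have e5 : T2 + T4 - (I2 + hexB * G / 2 * I4) = (T2 - 1 / m * A2)
      + (T4 - G / 2 * (1 / m) ^ 2 * A4) + 1 / m * (A2 - m * I2)
      + G / 2 * (1 / m) ^ 2 * (A4 - m4 * I4) := by
    rw [hB]
    field_simp
    ring
  rw [e5]
  have f2 : |1 / m * (A2 - m * I2)| ≤ 1 / m * (C2 * ε ^ (1 / 4 : ℝ)) := by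
    rw [abs_mul, abs_of_pos (by positivity)]
    gcongr
  have f4 : |G / 2 * (1 / m) ^ 2 * (A4 - m4 * I4)|
      ≤ |G / 2 * (1 / m) ^ 2| * (C4 * ε ^ (1 / 4 : ℝ)) := by
    rw [abs_mul]
    gcongr
  refine (abs_add_le _ _).trans ((add_le_add ((abs_add_le _ _).trans (add_le_add
    ((abs_add_le _ _).trans (add_le_add d2 d4)) f2)) f4).trans_eq ?_)
  ring

theorem groundEnergyTF_eq_integral (hbG : 0 < hexB * G)
    (hρ : ∀ z : ℂ, ‖α z‖ ^ 2 = rhoTF hexB β G z) :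
    groundEnergyTF hexB β G
      = ∫ z : ℂ, (potential β z * ‖α z‖ ^ 2 + hexB * G / 2 * ‖α z‖ ^ 4) := by
  rw [groundEnergyTF_eq hbG, energyTF]
  congr 1
  ext z
  rw [energyDensityTF, ← hρ]
  ring

theorem Decays.mem_fockSpace {p : ℝ → ℝ} {g : ℝ → ℂ → ℂ} (hg : Decays p g)
    (hd : ∀ᶠ ε in 𝓝[>] (0 : ℝ), Differentiable ℂ (g ε)) (m : ℕ) :
    ∀ᶠ ε in 𝓝[>] (0 : ℝ), g ε ∈ fockSpace ε m := by
  filter_upwards [hd, hg.integrable_fockDensity m] with ε h1 h2 using ⟨h1, h2⟩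

theorem eventually_differentiable_szego {p : ℝ → ℝ} {g : ℝ → ℂ → ℂ} (hg : Decays p g) :
    ∀ᶠ ε in 𝓝[>] (0 : ℝ), Differentiable ℂ (szego ε (g ε)) := by
  obtain ⟨M, hM⟩ := hg.exists_bound
  filter_upwards [hg.1, hM, eventually_pos_le_one] with ε h1 h2 hε
  exact differentiable_szego hε.1 h1 h2

end

end LLL

/-! ### Assembly of the estimates. -/

open LLL
theorem theorem3 (β G : ℝ) (hG : 0 < G) (α : ℂ → ℂ)
    (hα : ∃ K : ℝ≥0, HolderWith K (1 / 2) α)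
    (hρ : ∀ z : ℂ, ‖α z‖ ^ 2 = rhoTF hexB β G z) :
    ∃ C ε₀ : ℝ, 0 < C ∧ 0 < ε₀ ∧ ∀ ε : ℝ, 0 < ε → ε ≤ ε₀ →
      -- the trial function is well defined and admissible
      (projectedTrial ε α hexTau ∈ fockSpace ε 0 ∧
        0 < fockNorm ε 0 (projectedTrial ε α hexTau) ∧
        trial ε α hexTau ∈ fockSpace ε 2 ∧
        fockNorm ε 0 (trial ε α hexTau) = 1) ∧
      -- it solves the Euler-Lagrange equation up to a small remainder
      (∃ R : ℂ → ℂ, R ∈ fockSpace ε 0 ∧ fockNorm ε 0 R ≤ C * ε ^ (1 / 4 : ℝ) ∧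
        ∀ z : ℂ, eulerLagrange β G ε (trial ε α hexTau) z
          = (muTF hexB β G : ℂ) * trial ε α hexTau z + R z) ∧
      -- its energy
      |energyLLL β G ε (trial ε α hexTau)
          - ∫ z : ℂ, (potential β z * ‖α z‖ ^ 2 + hexB * G / 2 * ‖α z‖ ^ 4)|
        ≤ C * ε ^ (1 / 4 : ℝ) ∧
      -- the upper bound on the ground state energy
      groundEnergyLLL β G ε ≤ energyLLL β G ε (trial ε α hexTau) ∧
      |energyLLL β G ε (trial ε α hexTau) - groundEnergyTF hexB β G|
        ≤ C * ε ^ (1 / 4 : ℝ) := by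
  obtain ⟨K, hK⟩ := hα
  have hτ := hexTau_im_pos
  have hbG : 0 < hexB * G := mul_pos hexB_pos hG
  have hαc : CompHolder α := by
    refine CompHolder.of_holderWith hK (R := 4 * (|β| + |muTF hexB β G| + 1)) (by positivity)
      fun z hz => ?_
    have h := hρ z
    rwa [rhoTF_eq_zero hbG hz, sq_eq_zero_iff, norm_eq_zero] at h
  have h1 : ∫ z, ‖α z‖ ^ 2 = 1 := by
    simp only [hρ]
    exact integral_rhoTF hbG
  have hm := latticeMoment_pos hτ 2
  have ha := hαc.decays_mul (unifBdd_latticeF hτ)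
  have hPd : Decays (fun _ => 1) (fun ε => projectedTrial ε α hexTau) := ha.szego
  have hPdiff : ∀ᶠ ε in nhdsWithin (0 : ℝ) (Set.Ioi 0),
      Differentiable ℂ (projectedTrial ε α hexTau) := eventually_differentiable_szego ha
  have htd : Decays (fun _ => 1) (fun ε => trial ε α hexTau) :=
    (hasProfile_trial hαc h1 hτ).decays (hαc.const_mul _) hτ
  have htdiff : ∀ᶠ ε in nhdsWithin (0 : ℝ) (Set.Ioi 0), Differentiable ℂ (trial ε α hexTau) := by
    filter_upwards [hPdiff] with ε h
    exact h.div_const _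
  -- The remainder is the defect of the equation itself; it is entire because its terms are
  -- multiples of projections or of the trial function.
  have hRd := decays_eulerLagrange_trial hG hαc hρ h1
  have hRdiff : ∀ᶠ ε in nhdsWithin (0 : ℝ) (Set.Ioi 0), Differentiable ℂ (fun z =>
      eulerLagrange β G ε (trial ε α hexTau) z - (muTF hexB β G : ℂ) * trial ε α hexTau z) := by
    obtain ⟨M, hM⟩ := htd.exists_bound
    filter_upwards [htdiff, eventually_differentiable_szego htd.norm_sq_mul,
      eventually_differentiable_szego htd.norm_sq_mul.szego.norm_sq_mul, hM,
      eventually_pos_le_one] with ε d1 d2 d3 hM hε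
    have d4 : Differentiable ℂ (szego ε (cubicTerm ε (trial ε α hexTau))) := by
      refine differentiable_szego hε.1 (continuous_cubicTerm ε d1.continuous) (M := (M * 1) ^ 3)
        fun w => ?_
      rw [gauss_mul_norm_cubicTerm]
      exact pow_le_pow_left₀ (mul_nonneg (gauss_pos _ _).le (norm_nonneg _)) (hM w) 3
    exact (((d2.const_mul _).add (d3.const_mul _)).add (d4.const_mul _)).sub (d1.const_mul _)
  obtain ⟨C₁, hC₁⟩ := hRd.fockNorm_le (eventually_quarter.mono fun _ h => h.1)
  obtain ⟨C₂, hC₂⟩ := energyLLL_trial (β := β) (G := G) hαc h1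
  have hall := (hPd.mem_fockSpace hPdiff 0).and ((eventually_half_moment_le hαc h1 hτ).and
    ((htd.mem_fockSpace htdiff 1).and ((htd.mem_fockSpace htdiff 2).and
      ((hRd.mem_fockSpace hRdiff 0).and (hC₁.and hC₂)))))
  -- Finitely many properties valid for small `ε` hold together on one interval `(0, ε₀]`.
  obtain ⟨ε₀, hε₀, hsub⟩ := mem_nhdsGT_iff_exists_Ioc_subset.1 hall
  refine ⟨max (max C₁ C₂) 1, ε₀, by positivity, hε₀, fun ε hε hεle => ?_⟩
  obtain ⟨hP, hN, ht1, ht2, hR, hRn, hE⟩ := hsub ⟨hε, hεle⟩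
  rw [Nat.cast_zero] at hP hR
  rw [Nat.cast_one] at ht1
  rw [Nat.cast_ofNat] at ht2
  have hq : 0 ≤ ε ^ (1 / 4 : ℝ) := Real.rpow_nonneg hε.le _
  have hb₁ : C₁ * ε ^ (1 / 4 : ℝ) ≤ max (max C₁ C₂) 1 * ε ^ (1 / 4 : ℝ) := by
    gcongr
    exact le_max_of_le_left (le_max_left _ _)
  have hb₂ : C₂ * ε ^ (1 / 4 : ℝ) ≤ max (max C₁ C₂) 1 * ε ^ (1 / 4 : ℝ) := by
    gcongr
    exact le_max_of_le_left (le_max_right _ _)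
  have hNpos : 0 < fockNorm ε 0 (projectedTrial ε α hexTau) := by
    refine lt_of_le_of_ne (Real.sqrt_nonneg _) fun h => ?_
    rw [← h] at hN
    norm_num at hN
    linarith
  have hnorm := fockNorm_trial hNpos
  refine ⟨⟨hP, hNpos, ht2, hnorm⟩, ⟨_, hR, hRn.trans hb₁, fun z => by ring⟩, hE.trans hb₂,
    groundEnergyLLL_le hG.le β ht1 ht2 hnorm, ?_⟩
  rw [groundEnergyTF_eq_integral hbG hρ]
  exact hE.trans hb₂
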